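/- Consider the Hunter--Saxton equation \[ \partial_t u+\partial_x\left[\tfrac12 u^2\right]=\tfrac12\int_{-\infty}^x w^2(y,t)\,dy,\qquad w=\partial_x u . \tag{HS} \] A continuous function $u$ on $\mathbb{R}\times[0,\infty)$ is a weak solution of (HS) if, for each $t\ge 0$, $u(\cdot,t)$ is absolutely continuous with $\partial_xu(x,t)=w(x,t)$ for a.e. $x$, $w\in L^\infty([0,\infty);L^2(\mathbb{R}))$, the map $t\mapsto u(\cdot,t)\in L^2_{loc}(\mathbb{R})$ is absolutely continuous, (HS) holds in the sense of distributions, and $w_0:=w(\cdot,0)\in L^2(\mathbb{R})$. Put $u_0:=u(\cdot,0)$. A characteristic emanating from $\zeta$ is a Lipschitz function $x$ of time with $x(0)=\zeta$ and $\dot x(t)=u(x(t),t)$ for a.e. $t$. The leftmost characteristic $x_l[\eta]$ is given by $x_l[\eta](t)=\inf x(t)$, the infimum being over all characteristics $x$ emanating from $\eta$. Let $I$ be the set of $\zeta\in\mathbb{R}$ at which $u_0'(\zeta)$ exists and equals $w_0(\zeta)$. For $s\in(0,\infty]$ let $I_s=\{\zeta\in I: w_0(\zeta)>-2/s\}$ (with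 $2/\infty=0$), and let $I_s^{unique}$ be the set of $\zeta\in I_s$ from which only one characteristic, denoted $x_\zeta$, emanates up to time $s$. Let $T_\zeta=\infty$ if $w_0(\zeta)\ge0$ and $T_\zeta=-2/w_0(\zeta)$ otherwise, and let $J$ be the set of $\zeta\in I$ such that, for a characteristic $x$ emanating from $\zeta$, for a.e. $t\in[0,T_\zeta)$ the derivative $\partial_xu(x(t),t)$ exists and equals $w(x(t),t)$. Let $J_s^{unique}=I_s^{unique}\cap J$. \textbf{Lemma.} Let $u$ be a weak solution of (HS), $w=\partial_xu$ a.e., let $T\in(0,\infty]$ and $[0,\tau]\subset[0,T)$. Then there is a sequence $\varepsilon_k>0$, decreasing to $0$, such that for almost every $\zeta\in J_T^{unique}$ the following holds. For every $k$ and $t\in[0,\tau]$ we have $x_\zeta(t)<x_l[\zeta+\varepsilon_k](t)$; the functions \[ t\mapsto w^2(x_\zeta(t),t)\quad\text{and}\quad t\mapsto\frac{1}{x_l[\zeta+\varepsilon_k](t)-x_\zeta(t)}\int_{x_\zeta(t)}^{x_l[\zeta+\varepsilon_k](t)}w^2(y,t)\,dy \] are integrable on $[0,\tau]$; and for every $0\le\sigma\le\tau$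 \[ \lim_{k\to\infty}\left|\int_\sigma^\tau\left(\frac{1}{x_l[\zeta+\varepsilon_k](t)-x_\zeta(t)}\int_{x_\zeta(t)}^{x_l[\zeta+\varepsilon_k](t)}w^2(y,t)\,dy-w^2(x_\zeta(t),t)\right)dt\right|=0 . \] -/

import Mathlib

open MeasureTheory Set Filter Topology
open scoped ENNReal NNReal ContDiff

namespace HunterSaxton

/-- `IsWeakSolution u w`: the function `u = u(x,t)`, considered for `t ≥ 0`, is a weak solution of
`∂ₜu + ∂ₓ(u²/2) = ½ ∫_{-∞}^x w²(y,t) dy`, and `w = ∂ₓu` almost everywhere.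
The initial data are `u₀ = u(·,0)` and `w₀ = w(·,0)`. -/
structure IsWeakSolution (u w : ℝ → ℝ → ℝ) : Prop where
  /-- `u` is continuous on `ℝ × [0,∞)`. -/
  continuousOn : ContinuousOn (fun p : ℝ × ℝ => u p.1 p.2) {p | 0 ≤ p.2}
  /-- For each `t ≥ 0` the function `u(·,t)` is absolutely continuous. -/
  absCont_space : ∀ t, 0 ≤ t → ∀ a b, AbsolutelyContinuousOnInterval (fun x => u x t) a b
  /-- For each `t ≥ 0`, `∂ₓu(x,t) = w(x,t)` for almost every `x`. -/
  hasDerivAt : ∀ t, 0 ≤ t → ∀ᵐ x, HasDerivAt (fun x' => u x' t) (w x t) x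
  /-- The initial derivative `w₀` is in `L²(ℝ)`. -/
  memLp_zero : MemLp (fun x => w x 0) 2 volume
  /-- `w ∈ L^∞([0,∞); L²(ℝ))`. -/
  bounded_energy : ∃ C : ℝ≥0, ∀ᵐ t ∂(volume.restrict (Ici (0 : ℝ))),
    eLpNorm (fun x => w x t) 2 volume ≤ C
  /-- `t ↦ u(·,t) ∈ L²_loc(ℝ)` is (locally) absolutely continuous on `[0,∞)`. -/
  absCont_time : ∀ R : ℝ, 0 < R →
    ∃ U : ℝ → Lp ℝ 2 (volume.restrict (Icc (-R) R)),
      (∀ t, 0 ≤ t → (U t : ℝ → ℝ) =ᵐ[volume.restrict (Icc (-R) R)] fun x => u x t) ∧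
      ∀ S, 0 < S → AbsolutelyContinuousOnInterval U 0 S
  /-- The equation holds in the sense of distributions. -/
  equation : ∀ φ : ℝ × ℝ → ℝ, ContDiff ℝ ∞ φ → HasCompactSupport φ →
    tsupport φ ⊆ {p | 0 < p.2} →
    ∫ p : ℝ × ℝ, (u p.1 p.2 * fderiv ℝ φ p (0, 1)
      + (1 / 2) * u p.1 p.2 ^ 2 * fderiv ℝ φ p (1, 0)
      + (1 / 2) * (∫ y in Iic p.1, w y p.2 ^ 2) * φ p) = 0

/-- `x` is, on `[0,S]`, a characteristic associated to `u` that emanates from `ζ`. -/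
def IsCharacteristic (u : ℝ → ℝ → ℝ) (S ζ : ℝ) (x : ℝ → ℝ) : Prop :=
  (∃ K : ℝ≥0, LipschitzOnWith K x (Icc 0 S)) ∧
  (∀ᵐ t ∂(volume.restrict (Icc 0 S)), HasDerivAt x (u (x t) t) t) ∧
  x 0 = ζ

/-- The leftmost characteristic `x_l[η]` emanating from `η`: at time `t ≥ 0` it is the infimum of
the values at `t` of the characteristics emanating from `η`. -/
noncomputable def leftmost (u : ℝ → ℝ → ℝ) (η t : ℝ) : ℝ :=
  sInf {z | ∃ x : ℝ → ℝ, IsCharacteristic u t η x ∧ x t = z}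

/-- The set `I` of the points `ζ` at which `u₀'(ζ)` exists and equals `w₀(ζ)`. -/
def setI (u w : ℝ → ℝ → ℝ) : Set ℝ :=
  {ζ | HasDerivAt (fun x => u x 0) (w ζ 0) ζ}

/-- The set `I_s = {ζ ∈ I : w₀(ζ) > -2/s}` for `s ∈ (0,∞]`, where `2/∞ = 0`. -/
noncomputable def setIAt (u w : ℝ → ℝ → ℝ) (s : ℝ≥0∞) : Set ℝ :=
  {ζ | ζ ∈ setI u w ∧ -(2 / s).toReal < w ζ 0}

/-- The set `I_s^unique` of the points of `I_s` from which only one characteristic emanates, up to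
time `s ∈ (0,∞]`. -/
noncomputable def setIUnique (u w : ℝ → ℝ → ℝ) (s : ℝ≥0∞) : Set ℝ :=
  {ζ | ζ ∈ setIAt u w s ∧ ∀ S : ℝ, 0 ≤ S → ENNReal.ofReal S ≤ s →
    ∀ x y : ℝ → ℝ, IsCharacteristic u S ζ x → IsCharacteristic u S ζ y → EqOn x y (Icc 0 S)}

open Classical in
/-- `T_ζ = ∞` if `w₀(ζ) ≥ 0`, and `T_ζ = -2/w₀(ζ)` otherwise. -/
noncomputable def lifespan (w : ℝ → ℝ → ℝ) (ζ : ℝ) : ℝ≥0∞ :=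
  if 0 ≤ w ζ 0 then ∞ else ENNReal.ofReal (-2 / w ζ 0)

/-- The set `Γ` of the points `(x,t)` at which `w = ∂ₓu` exists. -/
def setGamma (u w : ℝ → ℝ → ℝ) : Set (ℝ × ℝ) :=
  {p | HasDerivAt (fun x => u x p.2) (w p.1 p.2) p.1}

/-- The set `J` of the points `ζ ∈ I` for which a characteristic `x_ζ` on `[0,T_ζ)` emanating from
`ζ` satisfies `(x_ζ(t),t) ∈ Γ` for almost every `t ∈ [0,T_ζ)`. -/
noncomputable def setJ (u w : ℝ → ℝ → ℝ) : Set ℝ :=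
  {ζ | ζ ∈ setI u w ∧ ∃ x : ℝ → ℝ,
    (∀ S : ℝ, 0 ≤ S → ENNReal.ofReal S < lifespan w ζ → IsCharacteristic u S ζ x) ∧
    ∀ᵐ t : ℝ, 0 ≤ t → ENNReal.ofReal t < lifespan w ζ → (x t, t) ∈ setGamma u w}

/-- `J_s^unique = I_s^unique ∩ J`. -/
noncomputable def setJUnique (u w : ℝ → ℝ → ℝ) (s : ℝ≥0∞) : Set ℝ :=
  setIUnique u w s ∩ setJ u w

/-- The spatial average of `w²(·,t)` over the interval `[a,b]`. -/
noncomputable def energyAverage (w : ℝ → ℝ → ℝ) (a b t : ℝ) : ℝ :=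
  1 / (b - a) * ∫ y in a..b, w y t ^ 2

end HunterSaxton

/-! ### Primitives from distributional derivatives. -/

namespace HunterSaxton

/-! Let X(η,t) be the leftmost characteristic from η, and compare those from ζ and ζ+ε: H is their
gap, V = H' the difference of their velocities, e the energy ∫w² between them. Integrating the
equation over a thin window that moves with a characteristic shows that u along it grows at half the
energy to its left (`momentum`), so V' = e/2. Cauchy–Schwarz gives V² ≤ He. These two facts force H
above the square of the tangent line of √H at time 0 (`mul_sq_le_of_sq_deriv_le`). The condition
w₀(ζ) > -2/T makes 1 + w₀(ζ)τ/2 positive, hence H ≥ cε on [0,τ] with c independent of t and ε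
(`eventually_mul_le_gap`).

Put F(η) = ∫₀^τ (energy to the left of X(η,t)) dt. This is monotone, hence differentiable almost
everywhere, and its increment over [ζ,ζ+ε] is ∫e dt. Write W(t) = w(x_ζ(t),t). By the definition of
J, V/H → W for a.e. t, and H/ε → f = exp∫W. Cauchy–Schwarz reads e/ε ≥ (V/H)²(H/ε), and the right
side converges to W²f, so F'(ζ) ≥ ∫W²f.

The core is the opposite inequality for a.e. ζ: no energy concentrates next to a typical
characteristic (`ae_deriv_totalEnergy_le`). The measure w² dx dt is carried to the initial line by
the generalised inverse of X(·,t). Its Lebesgue density dominates F', and the change of variables x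
= X(ζ,t) bounds that density by ∫W²f. The change of variables loses nothing, because outside one
null set of ζ every X(·,t) has finite derivates, and such maps send null sets to null sets.

Hence e/ε − (V/H)²(H/ε) is nonnegative with integral tending to 0. Multiplying by ε/H ≤ 1/c gives
e/H − (V/H)² → 0 in L¹ (`tendsto_integral_average`). Here e/H is the spatial average of w², and
(V/H)² → W² by dominated convergence. The limit holds along all ε → 0⁺, so any sequence serves.
Uniqueness only identifies x_ζ, and the characteristic in the definition of J, with X(ζ,·). -/

theorem deriv_smoothTransition_eq_zero {y : ℝ} (hy : y < 0 ∨ 1 < y) :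
    deriv Real.smoothTransition y = 0 := by
  rcases hy with hy | hy
  · have : Real.smoothTransition =ᶠ[𝓝 y] fun _ => 0 := by
      filter_upwards [Iio_mem_nhds hy] with z hz
      exact Real.smoothTransition.zero_of_nonpos (le_of_lt hz)
    rw [this.deriv_eq]; simp
  · have : Real.smoothTransition =ᶠ[𝓝 y] fun _ => 1 := by
      filter_upwards [Ioi_mem_nhds hy] with z hz
      exact Real.smoothTransition.one_of_one_le (le_of_lt hz)
    rw [this.deriv_eq]; simp

theorem continuous_deriv_smoothTransition : Continuous (deriv Real.smoothTransition) :=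
  (Real.smoothTransition.contDiff (n := 1)).continuous_deriv le_rfl

theorem integral_deriv_smoothTransition :
    ∫ y in (0 : ℝ)..1, deriv Real.smoothTransition y = 1 := by
  rw [intervalIntegral.integral_deriv_eq_sub]
  · simp
  · intro x _
    exact (Real.smoothTransition.contDiff (n := 1)).differentiable one_ne_zero x
  · exact continuous_deriv_smoothTransition.intervalIntegrable _ _

/-- Rescaling the derivative of the smooth step. -/
theorem integral_mul_deriv_smoothTransition {f : ℝ → ℝ} {a b c d : ℝ} (hc : 0 < c)
    (ha : c * a - d ≤ 0) (hb : 1 ≤ c * b - d) (hf : ContinuousOn f (Icc a b)) :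
    ∫ x in a..b, f x * (c * deriv Real.smoothTransition (c * x - d))
      = ∫ y in (0 : ℝ)..1, f ((y + d) / c) * deriv Real.smoothTransition y := by
  have key : ∫ x in a..b, f x * (c * deriv Real.smoothTransition (c * x - d))
      = ∫ y in (c * a - d)..(c * b - d), f ((y + d) / c) * deriv Real.smoothTransition y := by
    rw [← intervalIntegral.mul_integral_comp_mul_sub, ← intervalIntegral.integral_const_mul]
    congr 1
    ext x
    have : (c * x - d + d) / c = x := by field_simp; ring
    rw [this]; ring
  have hcont : ContinuousOn (fun y => f ((y + d) / c) * deriv Real.smoothTransition y)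
      (Icc (c * a - d) (c * b - d)) := by
    refine ContinuousOn.mul (hf.comp (by fun_prop) ?_) continuous_deriv_smoothTransition.continuousOn
    intro y hy
    constructor
    · rw [le_div_iff₀ hc]; linarith [hy.1]
    · rw [div_le_iff₀ hc]; linarith [hy.2]
  have hint : ∀ p q, c * a - d ≤ p → p ≤ q → q ≤ c * b - d → IntervalIntegrable
      (fun y => f ((y + d) / c) * deriv Real.smoothTransition y) volume p q := by
    intro p q hp hpq hq
    apply ContinuousOn.intervalIntegrable
    rw [uIcc_of_le hpq]
    exact hcont.mono (Icc_subset_Icc hp hq)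
  rw [key, ← intervalIntegral.integral_add_adjacent_intervals (b := 0)
    (hint _ _ le_rfl ha (by linarith)) (hint _ _ ha (by linarith) le_rfl),
    ← intervalIntegral.integral_add_adjacent_intervals (a := 0) (b := 1)
    (hint _ _ ha (by linarith) hb) (hint _ _ (by linarith) hb le_rfl)]
  have h1 : ∫ y in (c * a - d)..0, f ((y + d) / c) * deriv Real.smoothTransition y = 0 := by
    apply intervalIntegral.integral_zero_ae
    have : ∀ᵐ y : ℝ, y ≠ 0 := by simp [ae_iff]
    filter_upwards [this] with y hy0 hy
    rw [uIoc_of_le ha] at hy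
    rw [deriv_smoothTransition_eq_zero (Or.inl (lt_of_le_of_ne hy.2 hy0)), mul_zero]
  have h2 : ∫ y in (1 : ℝ)..(c * b - d), f ((y + d) / c) * deriv Real.smoothTransition y = 0 := by
    apply intervalIntegral.integral_zero_ae
    filter_upwards with y hy
    rw [uIoc_of_le hb] at hy
    rw [deriv_smoothTransition_eq_zero (Or.inr hy.1), mul_zero]
  rw [h1, h2]; ring

/-- The kernel has mass one and the sample points tend to p, so dominated convergence applies: the
rescaled kernels approximate a Dirac mass at p from inside [a,b]. -/
theorem tendsto_integral_mul_deriv_smoothTransition {f : ℝ → ℝ} {a b p : ℝ} {d : ℕ → ℝ}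
    (hp : p ∈ Icc a b) (hf : ContinuousOn f (Icc a b))
    (hd : Tendsto (fun n : ℕ => d n / n) atTop (𝓝 p))
    (hmem : ∀ᶠ n : ℕ in atTop, ∀ y ∈ Icc (0 : ℝ) 1, (y + d n) / n ∈ Icc a b) :
    Tendsto (fun n : ℕ => ∫ y in (0 : ℝ)..1, f ((y + d n) / n) * deriv Real.smoothTransition y)
      atTop (𝓝 (f p)) := by
  have hlim : f p = ∫ y in (0 : ℝ)..1, f p * deriv Real.smoothTransition y := by
    rw [intervalIntegral.integral_const_mul, integral_deriv_smoothTransition, mul_one]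
  obtain ⟨M, hM⟩ := isCompact_Icc.exists_bound_of_continuousOn hf
  rw [hlim]
  apply intervalIntegral.tendsto_integral_filter_of_dominated_convergence
    (fun y => M * |deriv Real.smoothTransition y|)
  · filter_upwards [hmem] with n hn
    refine ContinuousOn.aestronglyMeasurable ?_ measurableSet_uIoc
    rw [uIoc_of_le zero_le_one]
    refine ContinuousOn.mul (hf.comp (by fun_prop) ?_) continuous_deriv_smoothTransition.continuousOn
    intro y hy; exact hn y (Ioc_subset_Icc_self hy)
  · filter_upwards [hmem] with n hn
    filter_upwards with y hy
    rw [uIoc_of_le zero_le_one] at hy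
    rw [norm_mul]
    exact mul_le_mul_of_nonneg_right (hM _ (hn y (Ioc_subset_Icc_self hy))) (abs_nonneg _)
  · exact (continuous_const.mul continuous_deriv_smoothTransition.abs).intervalIntegrable _ _
  · filter_upwards with y hy
    rw [uIoc_of_le zero_le_one] at hy
    refine Tendsto.mul ?_ tendsto_const_nhds
    have h1 : Tendsto (fun n : ℕ => (y + d n) / n) atTop (𝓝 p) := by
      have := (tendsto_const_div_atTop_nhds_zero_nat y).add hd
      simpa [add_div] using this
    refine (hf p hp).tendsto.comp (tendsto_nhdsWithin_iff.2 ⟨h1, ?_⟩)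
    filter_upwards [hmem] with n hn
    exact hn y (Ioc_subset_Icc_self hy)

/-- A continuous function on `[a, b]` whose distributional derivative is `g` is a primitive
of `g`. -/
theorem sub_eq_integral_of_weak_deriv {f g : ℝ → ℝ} {a b : ℝ} (hab : a < b)
    (hf : ContinuousOn f (Icc a b)) (hg : IntervalIntegrable g volume a b)
    (h : ∀ θ : ℝ → ℝ, ContDiff ℝ ∞ θ → HasCompactSupport θ → tsupport θ ⊆ Icc a b →
      ∫ x, (f x * deriv θ x + g x * θ x) = 0) :
    f b - f a = ∫ x in a..b, g x := by
  set s := Real.smoothTransition with hs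
  -- A plateau that rises on [a, a+1/n] and falls on [b−1/n, b]. Its derivative tends to a Dirac
  -- mass at a minus one at b, and the function itself to 1 on (a,b).
  set θ : ℕ → ℝ → ℝ := fun n x => s (n * x - n * a) - s (n * x - (n * b - 1)) with hθ
  have hbig : ∀ᶠ n : ℕ in atTop, (0 : ℝ) < n ∧ 1 ≤ n * (b - a) := by
    filter_upwards [eventually_gt_atTop 0, tendsto_natCast_atTop_atTop.eventually_ge_atTop
      (1 / (b - a))] with n hn hn'
    refine ⟨by exact_mod_cast hn, ?_⟩
    rwa [div_le_iff₀ (by linarith)] at hn'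
  have hsmooth : ∀ n, ContDiff ℝ ∞ (θ n) := fun n =>
    (Real.smoothTransition.contDiff.comp (by fun_prop)).sub
      (Real.smoothTransition.contDiff.comp (by fun_prop))
  have hzero : ∀ n : ℕ, 0 < (n : ℝ) → 1 ≤ n * (b - a) → ∀ x, x ∉ Icc a b → θ n x = 0 := by
    intro n hn hn' x hx
    simp only [mem_Icc, not_and_or, not_le] at hx
    rcases hx with hx | hx
    · have h1 : (n : ℝ) * x < n * a := by gcongr
      simp only [hθ, hs]
      rw [Real.smoothTransition.zero_of_nonpos (by linarith),
        Real.smoothTransition.zero_of_nonpos (by nlinarith)]; simp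
    · have h1 : (n : ℝ) * b < n * x := by gcongr
      simp only [hθ, hs]
      rw [Real.smoothTransition.one_of_one_le (by nlinarith),
        Real.smoothTransition.one_of_one_le (by linarith)]; simp
  have hsupp : ∀ n : ℕ, 0 < (n : ℝ) → 1 ≤ n * (b - a) → tsupport (θ n) ⊆ Icc a b := by
    intro n hn hn'
    apply closure_minimal _ isClosed_Icc
    intro x hx
    by_contra hx'
    exact hx (hzero n hn hn' x hx')
  have hderiv : ∀ n x, deriv (θ n) x = n * deriv s (n * x - n * a)
      - n * deriv s (n * x - (n * b - 1)) := by
    intro n x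
    have hd : ∀ y, HasDerivAt s (deriv s y) y := fun y =>
      ((Real.smoothTransition.contDiff (n := 1)).differentiable one_ne_zero y).hasDerivAt
    have h1 : ∀ e : ℝ, HasDerivAt (fun x : ℝ => s (n * x - e)) (n * deriv s (n * x - e)) x := by
      intro e
      have := (hd (n * x - e)).comp x (((hasDerivAt_id x).const_mul (n : ℝ)).sub_const e)
      simpa [Function.comp_def, mul_comm] using this
    exact ((h1 _).sub (h1 _)).deriv
  have hcd : Continuous (deriv s) := continuous_deriv_smoothTransition
  have hle : a ≤ b := hab.le
  have hEq : ∀ᶠ n : ℕ in atTop,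
      (∫ y in (0 : ℝ)..1, f ((y + (n * a)) / n) * deriv s y)
      - (∫ y in (0 : ℝ)..1, f ((y + (n * b - 1)) / n) * deriv s y)
      + ∫ x in a..b, g x * θ n x = 0 := by
    filter_upwards [hbig] with n ⟨hn, hn'⟩
    have hn2 : (n : ℝ) * b - n * a ≥ 1 := by linarith [mul_sub (n : ℝ) b a]
    rw [← integral_mul_deriv_smoothTransition hn (by linarith) (by linarith) hf,
      ← integral_mul_deriv_smoothTransition hn (by linarith) (by linarith) hf]
    have hi : ∀ e : ℝ, IntervalIntegrable (fun x => f x * (n * deriv s (n * x - e))) volume a b := by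
      intro e
      apply ContinuousOn.intervalIntegrable
      rw [uIcc_of_le hle]
      exact hf.mul (by fun_prop)
    have hi2 : IntervalIntegrable (fun x => g x * θ n x) volume a b := by
      apply hg.mul_continuousOn (hsmooth n).continuous.continuousOn
    have hout : ∀ x, x ∉ Icc a b → f x * deriv (θ n) x + g x * θ n x = 0 := by
      intro x hx
      have h1 : x ∉ tsupport (θ n) := fun h => hx (hsupp n hn hn' h)
      have h2 : deriv (θ n) x = 0 := by
        by_contra h3
        exact h1 (support_deriv_subset h3)
      rw [h2, hzero n hn hn' x hx]; ring
    rw [← intervalIntegral.integral_sub (hi _) (hi _),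
      ← intervalIntegral.integral_add ((hi _).sub (hi _)) hi2,
      ← h (θ n) (hsmooth n) (HasCompactSupport.of_support_subset_isCompact isCompact_Icc
        (subset_closure.trans (hsupp n hn hn'))) (hsupp n hn hn'),
      ← setIntegral_eq_integral_of_forall_compl_eq_zero hout,
      intervalIntegral.integral_of_le hle, ← integral_Icc_eq_integral_Ioc]
    congr 1; ext x; rw [hderiv]; ring
  have L1 : Tendsto (fun n : ℕ => ∫ y in (0 : ℝ)..1, f ((y + (n * a)) / n) * deriv s y)
      atTop (𝓝 (f a)) := by
    apply tendsto_integral_mul_deriv_smoothTransition (left_mem_Icc.2 hle) hf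
    · apply tendsto_const_nhds.congr'
      filter_upwards [hbig] with n ⟨hn, _⟩
      field_simp
    · filter_upwards [hbig] with n ⟨hn, hn'⟩ y hy
      constructor
      · rw [le_div_iff₀ hn]; linarith [hy.1]
      · rw [div_le_iff₀ hn]; linarith [hy.2]
  have L2 : Tendsto (fun n : ℕ => ∫ y in (0 : ℝ)..1, f ((y + (n * b - 1)) / n) * deriv s y)
      atTop (𝓝 (f b)) := by
    apply tendsto_integral_mul_deriv_smoothTransition (right_mem_Icc.2 hle) hf
    · have : Tendsto (fun n : ℕ => b - 1 / (n : ℝ)) atTop (𝓝 (b - 0)) :=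
        tendsto_const_nhds.sub (tendsto_const_div_atTop_nhds_zero_nat 1)
      rw [sub_zero] at this
      apply this.congr'
      filter_upwards [hbig] with n ⟨hn, _⟩
      field_simp
    · filter_upwards [hbig] with n ⟨hn, hn'⟩ y hy
      constructor
      · rw [le_div_iff₀ hn]; linarith [hy.1]
      · rw [div_le_iff₀ hn]; linarith [hy.2]
  have L3 : Tendsto (fun n : ℕ => ∫ x in a..b, g x * θ n x) atTop (𝓝 (∫ x in a..b, g x)) := by
    apply intervalIntegral.tendsto_integral_filter_of_dominated_convergence (fun x => |g x|)
    · filter_upwards with n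
      exact hg.def'.1.mul (hsmooth n).continuous.aestronglyMeasurable
    · filter_upwards with n
      filter_upwards with x _
      rw [norm_mul]
      apply mul_le_of_le_one_right (abs_nonneg _)
      rw [Real.norm_eq_abs, abs_le]
      have := Real.smoothTransition.nonneg (n * x - n * a)
      have := Real.smoothTransition.nonneg (n * x - (n * b - 1))
      have := Real.smoothTransition.le_one (n * x - n * a)
      have := Real.smoothTransition.le_one (n * x - (n * b - 1))
      constructor <;> simp only [hθ, hs] <;> linarith
    · exact hg.norm
    · have : ∀ᵐ y : ℝ, y ≠ b := by simp [ae_iff]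
      filter_upwards [this] with x hxb hx
      rw [uIoc_of_le hle] at hx
      have hxb' : 0 < b - x := sub_pos.2 (lt_of_le_of_ne hx.2 hxb)
      apply tendsto_const_nhds.congr'
      filter_upwards [tendsto_natCast_atTop_atTop.eventually_ge_atTop (1 / (b - x)),
        tendsto_natCast_atTop_atTop.eventually_ge_atTop (1 / (x - a))] with n h1 h2
      rw [div_le_iff₀ hxb'] at h1
      rw [div_le_iff₀ (by linarith [hx.1])] at h2
      simp only [hθ, hs]
      rw [Real.smoothTransition.one_of_one_le (by linarith),
        Real.smoothTransition.zero_of_nonpos (by linarith)]; simp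
  have := tendsto_nhds_unique (((L1.sub L2).add L3).congr' hEq) tendsto_const_nhds
  linarith

end HunterSaxton

/-! ### Normalisation of a weak solution. -/

namespace HunterSaxton

/-- The energy of `D(·,t)` to the left of `x`. -/
noncomputable def cumulEnergy (D : ℝ → ℝ → ℝ) (x t : ℝ) : ℝ := ∫ y in Iic x, D y t ^ 2

/-- A weak solution normalised so that it is globally continuous and its space derivative is
jointly measurable with energy at most `C` at every time. -/
structure IsEnergyFlow (v D : ℝ → ℝ → ℝ) (C : ℝ) : Prop where
  cont : Continuous (fun p : ℝ × ℝ => v p.1 p.2)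
  meas : Measurable (fun p : ℝ × ℝ => D p.1 p.2)
  integrable : ∀ t, Integrable (fun x => D x t ^ 2)
  bound : ∀ t, ∫ x, D x t ^ 2 ≤ C
  diff : ∀ᵐ t : ℝ, 0 ≤ t → ∀ x y, v y t - v x t = ∫ z in x..y, D z t
  weak : ∀ φ : ℝ × ℝ → ℝ, ContDiff ℝ ∞ φ → HasCompactSupport φ → tsupport φ ⊆ {p | 0 < p.2} →
    ∫ p : ℝ × ℝ, (v p.1 p.2 * fderiv ℝ φ p (0, 1) + (1 / 2) * v p.1 p.2 ^ 2 * fderiv ℝ φ p (1, 0)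
      + (1 / 2) * cumulEnergy D p.1 p.2 * φ p) = 0

/-- Nothing makes w jointly measurable, so it is replaced by the classical derivative of the
continuous function u, which is. Agreement at every point where w is the derivative, not merely for
a.e. x, is kept because a single characteristic is a null set in space. -/
theorem IsWeakSolution.exists_energyFlow {u w : ℝ → ℝ → ℝ} (hu : IsWeakSolution u w) :
    ∃ (v D : ℝ → ℝ → ℝ) (C : ℝ), IsEnergyFlow v D C ∧ (∀ x t, 0 ≤ t → v x t = u x t) ∧
      ∀ᵐ t : ℝ, 0 ≤ t → (∀ x, HasDerivAt (fun x' => u x' t) (w x t) x → D x t = w x t) ∧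
        ∀ᵐ x, D x t = w x t := by
  obtain ⟨C, hC⟩ := hu.bounded_energy
  -- Freezing u at its initial value for negative times gives continuity on the whole plane.
  set v : ℝ → ℝ → ℝ := fun x t => u x (max t 0) with hv
  have hvu : ∀ x t, 0 ≤ t → v x t = u x t := fun x t ht => by simp only [hv]; rw [max_eq_left ht]
  have hvfun : ∀ t, 0 ≤ t → (fun x => v x t) = fun x => u x t :=
    fun t ht => funext fun x => hvu x t ht
  have hcont : Continuous (fun p : ℝ × ℝ => v p.1 p.2) := by
    have : Continuous fun p : ℝ × ℝ => ((p.1, max p.2 0) : ℝ × ℝ) := by fun_prop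
    exact hu.continuousOn.comp_continuous this fun p => le_max_right p.2 0
  set D₀ : ℝ → ℝ → ℝ := fun x t => deriv (fun x' => v x' t) x with hD₀
  have hmeas₀ : Measurable (fun p : ℝ × ℝ => D₀ p.1 p.2) := by
    have h1 : Continuous (Function.uncurry fun t x : ℝ => v x t) :=
      hcont.comp (by fun_prop : Continuous fun p : ℝ × ℝ => (p.2, p.1))
    exact (measurable_deriv_with_param h1).comp measurable_swap
  -- The times that respect the energy bound. Off this set D is put equal to 0, so that the bound
  -- holds at every time; only a null set of nonnegative times is lost.
  set G : Set ℝ := {t | 0 ≤ t ∧ ∫⁻ x, ‖D₀ x t‖ₑ ^ 2 ≤ (C : ℝ≥0∞) ^ 2} with hG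
  have hGm : MeasurableSet G := by
    apply measurableSet_Ici.inter
    have : Measurable (fun p : ℝ × ℝ => ‖D₀ p.2 p.1‖ₑ ^ 2) :=
      ((hmeas₀.comp measurable_swap).enorm.pow_const 2)
    exact measurableSet_le this.lintegral_prod_right' measurable_const
  classical
  set D : ℝ → ℝ → ℝ := fun x t => if t ∈ G then D₀ x t else 0 with hD
  have hD₀w : ∀ t, 0 ≤ t → ∀ x, HasDerivAt (fun x' => u x' t) (w x t) x → D₀ x t = w x t := by
    intro t ht x hx
    simp only [hD₀]
    rw [hvfun t ht]
    exact hx.deriv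
  have hGae : ∀ᵐ t : ℝ, 0 ≤ t → t ∈ G := by
    rw [ae_restrict_iff' measurableSet_Ici] at hC
    filter_upwards [hC] with t ht h0
    refine ⟨h0, ?_⟩
    have h1 : ∫⁻ x, ‖D₀ x t‖ₑ ^ 2 = ∫⁻ x, ‖w x t‖ₑ ^ 2 := by
      apply lintegral_congr_ae
      filter_upwards [hu.hasDerivAt t h0] with x hx
      rw [hD₀w t h0 x hx]
    have h2 := ht h0
    rw [eLpNorm_eq_lintegral_rpow_enorm_toReal two_ne_zero ENNReal.ofNat_ne_top] at h2
    simp only [ENNReal.toReal_ofNat, ENNReal.rpow_ofNat, one_div] at h2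
    rw [h1]
    rw [ENNReal.rpow_inv_le_iff (by norm_num)] at h2
    simpa using h2
  have hDw : ∀ᵐ t : ℝ, 0 ≤ t → (∀ x, HasDerivAt (fun x' => u x' t) (w x t) x → D x t = w x t) ∧
        ∀ᵐ x, D x t = w x t := by
    filter_upwards [hGae] with t ht h0
    have h1 : ∀ x, HasDerivAt (fun x' => u x' t) (w x t) x → D x t = w x t := by
      intro x hx
      simp only [hD, if_pos (ht h0)]
      exact hD₀w t h0 x hx
    exact ⟨h1, (hu.hasDerivAt t h0).mono fun x hx => h1 x hx⟩
  have hDmeas : Measurable (fun p : ℝ × ℝ => D p.1 p.2) :=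
    Measurable.ite (measurable_snd hGm) hmeas₀ measurable_const
  have hlint : ∀ t, ∫⁻ x, ‖D x t ^ 2‖ₑ ≤ (C : ℝ≥0∞) ^ 2 := by
    intro t
    by_cases ht : t ∈ G
    · simp only [hD, if_pos ht, enorm_pow]
      exact ht.2
    · simp [hD, if_neg ht]
  have hDt : ∀ t, Measurable fun x => D x t ^ 2 := fun t =>
    (hDmeas.comp (measurable_id.prodMk measurable_const)).pow_const 2
  refine ⟨v, D, (C : ℝ) ^ 2, ⟨hcont, hDmeas, fun t => ⟨(hDt t).aestronglyMeasurable, ?_⟩, ?_, ?_, ?_⟩,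
    hvu, hDw⟩
  · exact (hlint t).trans_lt (by simp)
  · intro t
    rw [integral_eq_lintegral_of_nonneg_ae (Eventually.of_forall fun x => sq_nonneg _)
      (hDt t).aestronglyMeasurable]
    have h1 : ∫⁻ x, ENNReal.ofReal (D x t ^ 2) ≤ (C : ℝ≥0∞) ^ 2 := by
      refine le_trans (le_of_eq ?_) (hlint t)
      congr 1; ext x
      rw [Real.enorm_eq_ofReal (sq_nonneg _)]
    have h2 := ENNReal.toReal_mono (by simp) h1
    simpa using h2
  · filter_upwards [hGae] with t ht h0 x y
    have hac := hu.absCont_space t h0 x y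
    have := hac.integral_deriv_eq_sub
    rw [hvu _ _ h0, hvu _ _ h0, ← this]
    simp only [hD, if_pos (ht h0), hD₀, hvfun t h0]
  · intro φ h1 h2 h3
    refine (integral_congr_ae ?_).trans (hu.equation φ h1 h2 h3)
    have hae : ∀ᵐ p : ℝ × ℝ, 0 ≤ p.2 → ∀ᵐ x, D x p.2 = w x p.2 := by
      have := Measure.quasiMeasurePreserving_snd (μ := (volume : Measure ℝ)) (ν := (volume : Measure ℝ)) |>.ae hDw
      filter_upwards [this] with p hp h0
      exact (hp h0).2
    filter_upwards [hae] with p hp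
    by_cases h0 : 0 < p.2
    · have h4 : cumulEnergy D p.1 p.2 = ∫ y in Iic p.1, w y p.2 ^ 2 := by
        apply integral_congr_ae
        filter_upwards [ae_restrict_of_ae (hp h0.le)] with x hx
        simp only [hx]
      simp only [hvu _ _ h0.le, h4]
    · have h5 : p ∉ tsupport φ := fun h => h0 (h3 h)
      have h6 : φ p = 0 := image_eq_zero_of_notMem_tsupport h5
      have h7 : fderiv ℝ φ p = 0 := by
        by_contra h8
        exact h5 (support_fderiv_subset ℝ h8)
      simp [h6, h7]

end HunterSaxton

/-! ### Energy estimates in space. -/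

namespace HunterSaxton

/-- Cauchy–Schwarz, from the nonnegativity of the integrated squared deviation of f from its mean.
-/
theorem sq_integral_le_mul_integral_sq {f : ℝ → ℝ} {a b : ℝ} (hab : a ≤ b)
    (hf : IntervalIntegrable f volume a b) (hf2 : IntervalIntegrable (fun x => f x ^ 2) volume a b) :
    (∫ x in a..b, f x) ^ 2 ≤ (b - a) * ∫ x in a..b, f x ^ 2 := by
  rcases hab.eq_or_lt with rfl | hab'
  · simp
  set m := ∫ x in a..b, f x
  have hba : 0 < b - a := sub_pos.2 hab'
  have h1 : 0 ≤ ∫ x in a..b, (f x - m / (b - a)) ^ 2 :=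
    intervalIntegral.integral_nonneg hab fun x _ => sq_nonneg _
  have h2 : ∫ x in a..b, (f x - m / (b - a)) ^ 2
      = (∫ x in a..b, f x ^ 2) - 2 * (m / (b - a)) * m + (m / (b - a)) ^ 2 * (b - a) := by
    have : ∀ x, (f x - m / (b - a)) ^ 2
        = f x ^ 2 - 2 * (m / (b - a)) * f x + (m / (b - a)) ^ 2 := fun x => by ring
    simp_rw [this]
    rw [intervalIntegral.integral_add (hf2.sub (hf.const_mul _)) (by simp),
      intervalIntegral.integral_sub hf2 (hf.const_mul _), intervalIntegral.integral_const_mul]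
    simp only [intervalIntegral.integral_const, smul_eq_mul]
    ring
  have h3 : (∫ x in a..b, f x ^ 2) - 2 * (m / (b - a)) * m + (m / (b - a)) ^ 2 * (b - a)
      = (∫ x in a..b, f x ^ 2) - m ^ 2 / (b - a) := by
    field_simp; ring
  rw [h2, h3, sub_nonneg, div_le_iff₀ hba] at h1
  linarith

namespace IsEnergyFlow

variable {v D : ℝ → ℝ → ℝ} {C : ℝ}

theorem nonneg (h : IsEnergyFlow v D C) : 0 ≤ C :=
  (integral_nonneg fun _ => sq_nonneg _).trans (h.bound 0)

theorem measurable_left (h : IsEnergyFlow v D C) (t : ℝ) : Measurable fun x => D x t :=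
  h.meas.comp (measurable_id.prodMk measurable_const)

theorem intervalIntegrable (h : IsEnergyFlow v D C) (t a b : ℝ) :
    IntervalIntegrable (fun x => D x t) volume a b := by
  have : MemLp (fun x => D x t) 2 volume :=
    (memLp_two_iff_integrable_sq (h.measurable_left t).aestronglyMeasurable).2 (h.integrable t)
  exact ((this.locallyIntegrable (by norm_num)).integrableOn_isCompact
    isCompact_uIcc).intervalIntegrable

theorem intervalIntegrable_sq (h : IsEnergyFlow v D C) (t a b : ℝ) :
    IntervalIntegrable (fun x => D x t ^ 2) volume a b :=
  (h.integrable t).intervalIntegrable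

theorem sq_sub_le (h : IsEnergyFlow v D C) : ∀ᵐ t : ℝ, 0 ≤ t → ∀ x y, x ≤ y →
    (v y t - v x t) ^ 2 ≤ (y - x) * ∫ z in x..y, D z t ^ 2 := by
  filter_upwards [h.diff] with t ht h0 x y hxy
  rw [ht h0]
  exact sq_integral_le_mul_integral_sq hxy (h.intervalIntegrable _ _ _)
    (h.intervalIntegrable_sq _ _ _)

theorem cumulEnergy_sub (h : IsEnergyFlow v D C) (x y t : ℝ) :
    cumulEnergy D y t - cumulEnergy D x t = ∫ z in x..y, D z t ^ 2 :=
  intervalIntegral.integral_Iic_sub_Iic (h.integrable t).integrableOn (h.integrable t).integrableOn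

theorem cumulEnergy_nonneg (D : ℝ → ℝ → ℝ) (x t : ℝ) : 0 ≤ cumulEnergy D x t :=
  integral_nonneg fun _ => sq_nonneg _

theorem cumulEnergy_le (h : IsEnergyFlow v D C) (x t : ℝ) : cumulEnergy D x t ≤ C :=
  (setIntegral_le_integral (h.integrable t) (Eventually.of_forall fun _ => sq_nonneg _)).trans
    (h.bound t)

theorem abs_cumulEnergy_le (h : IsEnergyFlow v D C) (x t : ℝ) : |cumulEnergy D x t| ≤ C := by
  rw [abs_of_nonneg (cumulEnergy_nonneg D x t)]
  exact h.cumulEnergy_le x t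

theorem cumulEnergy_mono (h : IsEnergyFlow v D C) (t : ℝ) :
    Monotone fun x => cumulEnergy D x t := by
  intro x y hxy
  have := h.cumulEnergy_sub x y t
  have h2 : 0 ≤ ∫ z in x..y, D z t ^ 2 :=
    intervalIntegral.integral_nonneg hxy fun x _ => sq_nonneg _
  show cumulEnergy D x t ≤ cumulEnergy D y t
  linarith

theorem continuous_cumulEnergy (h : IsEnergyFlow v D C) (t : ℝ) :
    Continuous fun x => cumulEnergy D x t := by
  have h1 : (fun x => cumulEnergy D x t) = fun x =>
      cumulEnergy D 0 t + ∫ z in (0 : ℝ)..x, D z t ^ 2 := by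
    ext x; rw [← h.cumulEnergy_sub]; ring
  rw [h1]
  exact continuous_const.add (intervalIntegral.continuous_primitive
    (fun a b => h.intervalIntegrable_sq t a b) 0)

theorem measurable_cumulEnergy (h : IsEnergyFlow v D C) :
    Measurable fun p : ℝ × ℝ => cumulEnergy D p.1 p.2 := by
  have h1 : Measurable fun q : (ℝ × ℝ) × ℝ => (Iic q.1.1).indicator (fun y => D y q.1.2 ^ 2) q.2 := by
    have h2 : Measurable fun q : (ℝ × ℝ) × ℝ => D q.2 q.1.2 ^ 2 :=
      (h.meas.comp (by fun_prop : Measurable fun q : (ℝ × ℝ) × ℝ => (q.2, q.1.2))).pow_const 2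
    have h3 : MeasurableSet {q : (ℝ × ℝ) × ℝ | q.2 ≤ q.1.1} :=
      measurableSet_le (by fun_prop) (by fun_prop)
    have h4 := h2.indicator h3
    exact h4
  have h5 := h1.stronglyMeasurable.integral_prod_right' (ν := volume)
  convert h5.measurable using 2 with p
  exact (integral_indicator measurableSet_Iic).symm

/-- The bound does not depend on t, so it passes from a dense set of times to every t ≥ 0 by
continuity of v. This Hölder estimate is what controls characteristics globally. -/
theorem sq_sub_le_bound (h : IsEnergyFlow v D C) {t : ℝ} (ht : 0 ≤ t) (x y : ℝ) :
    (v y t - v x t) ^ 2 ≤ C * |y - x| := by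
  have hd : Dense {t : ℝ | 0 ≤ t → (v y t - v x t) ^ 2 ≤ C * |y - x|} := by
    apply Measure.dense_of_ae (μ := volume)
    filter_upwards [h.sq_sub_le] with t ht h0
    have hb : ∀ x y, ∫ z in x..y, D z t ^ 2 ≤ C := fun x y => by
      rw [← h.cumulEnergy_sub]
      have := cumulEnergy_nonneg D x t
      have := h.cumulEnergy_le y t
      linarith
    rcases le_total x y with hxy | hxy
    · rw [abs_of_nonneg (sub_nonneg.2 hxy)]
      have := ht h0 x y hxy
      nlinarith [hb x y, sub_nonneg.2 hxy]
    · rw [abs_sub_comm, abs_of_nonneg (sub_nonneg.2 hxy)]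
      have := ht h0 y x hxy
      nlinarith [hb y x, sub_nonneg.2 hxy]
  have hv : ∀ x, Continuous fun t => v x t := fun x =>
    h.cont.comp (by fun_prop : Continuous fun t : ℝ => (x, t))
  have hc : IsClosed {t : ℝ | (v y t - v x t) ^ 2 ≤ C * |y - x|} :=
    isClosed_le (((hv y).sub (hv x)).pow 2) continuous_const
  have h1 : Ioi (0 : ℝ) ⊆ {t : ℝ | (v y t - v x t) ^ 2 ≤ C * |y - x|} := by
    refine (hd.open_subset_closure_inter isOpen_Ioi).trans (closure_minimal ?_ hc)
    rintro t ⟨ht1, ht2⟩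
    exact ht2 (le_of_lt ht1)
  have h2 := closure_minimal h1 hc
  rw [closure_Ioi] at h2
  exact h2 ht

end IsEnergyFlow
end HunterSaxton

/-! ### The equation integrated over rectangles. -/

namespace HunterSaxton

theorem fderiv_mul_fst_snd {θ χ : ℝ → ℝ} (hθ : Differentiable ℝ θ) (hχ : Differentiable ℝ χ)
    (p q : ℝ × ℝ) : fderiv ℝ (fun p : ℝ × ℝ => θ p.1 * χ p.2) p q
      = θ p.1 * deriv χ p.2 * q.2 + χ p.2 * deriv θ p.1 * q.1 := by
  have h1 : HasFDerivAt (fun p : ℝ × ℝ => θ p.1) _ p :=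
    (hθ p.1).hasDerivAt.hasFDerivAt.comp p hasFDerivAt_fst
  have h2 : HasFDerivAt (fun p : ℝ × ℝ => χ p.2) _ p :=
    (hχ p.2).hasDerivAt.hasFDerivAt.comp p hasFDerivAt_snd
  rw [(h1.fun_mul h2).fderiv]
  simp
  ring

theorem deriv_eq_zero_of_notMem {θ : ℝ → ℝ} {s : Set ℝ} (h : tsupport θ ⊆ s) {x : ℝ} (hx : x ∉ s) :
    deriv θ x = 0 := by
  by_contra h3
  exact hx (h (support_deriv_subset h3))

theorem eq_zero_of_notMem {θ : ℝ → ℝ} {s : Set ℝ} (h : tsupport θ ⊆ s) {x : ℝ} (hx : x ∉ s) :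
    θ x = 0 := image_eq_zero_of_notMem_tsupport fun h' => hx (h h')

namespace IsEnergyFlow

variable {v D : ℝ → ℝ → ℝ} {C : ℝ}

theorem integrableOn_cumulEnergy_mul (h : IsEnergyFlow v D C) {f : ℝ × ℝ → ℝ}
    (hf : Continuous f) {a b t₁ t₂ : ℝ} :
    IntegrableOn (fun p : ℝ × ℝ => cumulEnergy D p.1 p.2 * f p) (Icc a b ×ˢ Icc t₁ t₂) := by
  have h1 : IntegrableOn f (Icc a b ×ˢ Icc t₁ t₂) :=
    hf.continuousOn.integrableOn_compact (isCompact_Icc.prod isCompact_Icc)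
  exact h1.bdd_mul h.measurable_cumulEnergy.aestronglyMeasurable
    (Eventually.of_forall fun p => h.abs_cumulEnergy_le p.1 p.2)

/-- Testing with a product θ(x)χ(t); the terms are grouped so that the result reads as a weak
derivative in x alone. -/
theorem integral_box (h : IsEnergyFlow v D C) {θ χ : ℝ → ℝ} {a b t₁ t₂ : ℝ} (ht₁ : 0 < t₁)
    (hθ : ContDiff ℝ ∞ θ) (hχ : ContDiff ℝ ∞ χ) (hsθ : tsupport θ ⊆ Icc a b)
    (hsχ : tsupport χ ⊆ Icc t₁ t₂) :
    ∫ p in Icc a b ×ˢ Icc t₁ t₂, ((1 / 2 * v p.1 p.2 ^ 2 * χ p.2) * deriv θ p.1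
      + (v p.1 p.2 * deriv χ p.2 + 1 / 2 * (cumulEnergy D p.1 p.2 * χ p.2)) * θ p.1) = 0 := by
  have hdθ : Differentiable ℝ θ := hθ.differentiable (by simp)
  have hdχ : Differentiable ℝ χ := hχ.differentiable (by simp)
  have hout : ∀ p : ℝ × ℝ, p ∉ Icc a b ×ˢ Icc t₁ t₂ → θ p.1 * χ p.2 = 0 := by
    intro p hp
    rw [mem_prod, not_and_or] at hp
    rcases hp with hp | hp
    · rw [eq_zero_of_notMem hsθ hp, zero_mul]
    · rw [eq_zero_of_notMem hsχ hp, mul_zero]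
  have hsupp : tsupport (fun p : ℝ × ℝ => θ p.1 * χ p.2) ⊆ Icc a b ×ˢ Icc t₁ t₂ := by
    apply closure_minimal _ (isClosed_Icc.prod isClosed_Icc)
    intro p hp
    by_contra hp'
    exact hp (hout p hp')
  have hw := h.weak (fun p => θ p.1 * χ p.2)
    ((hθ.comp contDiff_fst).mul (hχ.comp contDiff_snd))
    (HasCompactSupport.of_support_subset_isCompact (isCompact_Icc.prod isCompact_Icc)
      (subset_closure.trans hsupp))
    (fun p hp => lt_of_lt_of_le ht₁ (hsupp hp).2.1)
  simp_rw [fderiv_mul_fst_snd hdθ hdχ] at hw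
  rw [← setIntegral_eq_integral_of_forall_compl_eq_zero (s := Icc a b ×ˢ Icc t₁ t₂)] at hw
  · refine (congrArg _ ?_).trans hw
    ext p
    ring
  · intro p hp
    rw [hout p hp]
    rw [mem_prod, not_and_or] at hp
    rcases hp with hp | hp
    · rw [eq_zero_of_notMem hsθ hp, deriv_eq_zero_of_notMem hsθ hp]; ring
    · rw [eq_zero_of_notMem hsχ hp, deriv_eq_zero_of_notMem hsχ hp]; ring

/-- The equation integrated in space over `[a, b]` and tested in time. -/
theorem integral_time (h : IsEnergyFlow v D C) {χ : ℝ → ℝ} {a b t₁ t₂ : ℝ} (ht₁ : 0 < t₁)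
    (hab : a < b) (hχ : ContDiff ℝ ∞ χ) (hsχ : tsupport χ ⊆ Icc t₁ t₂) :
    ∫ t in Icc t₁ t₂, ((∫ x in a..b, v x t) * deriv χ t
      + (1 / 2 * v a t ^ 2 - 1 / 2 * v b t ^ 2 + 1 / 2 * ∫ x in a..b, cumulEnergy D x t) * χ t)
      = 0 := by
  have hv : Continuous fun p : ℝ × ℝ => v p.1 p.2 := h.cont
  have hχc : Continuous χ := hχ.continuous
  have hχd : Continuous (deriv χ) := hχ.continuous_deriv (by simp)
  set A : ℝ × ℝ → ℝ := fun p => 1 / 2 * v p.1 p.2 ^ 2 * χ p.2 with hA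
  set B : ℝ × ℝ → ℝ := fun p => v p.1 p.2 * deriv χ p.2 + 1 / 2 * (cumulEnergy D p.1 p.2 * χ p.2)
    with hB
  have hAc : Continuous A := by fun_prop
  have hBi : ∀ f : ℝ → ℝ, Continuous f →
      IntegrableOn (fun p : ℝ × ℝ => B p * f p.1) (Icc a b ×ˢ Icc t₁ t₂) := by
    intro f hf
    have h1 : IntegrableOn (fun p : ℝ × ℝ => v p.1 p.2 * deriv χ p.2 * f p.1)
        (Icc a b ×ˢ Icc t₁ t₂) :=
      Continuous.continuousOn (by fun_prop) |>.integrableOn_compact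
        (isCompact_Icc.prod isCompact_Icc)
    have h2 := (h.integrableOn_cumulEnergy_mul (f := fun p => χ p.2 * f p.1) (by fun_prop)
      (a := a) (b := b) (t₁ := t₁) (t₂ := t₂)).const_mul (1 / 2)
    refine (h1.add h2).congr (Eventually.of_forall fun p => ?_)
    simp only [hB, Pi.add_apply]; ring
  have hBi1 : IntegrableOn B (Icc a b ×ˢ Icc t₁ t₂) := by
    simpa using hBi (fun _ => 1) continuous_const
  have hBx : ∀ x, IntegrableOn (fun t => B (x, t)) (Icc t₁ t₂) := by
    intro x
    have h1 : IntegrableOn (fun t => v x t * deriv χ t) (Icc t₁ t₂) :=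
      Continuous.continuousOn (by
        have : Continuous fun t => v x t := hv.comp (by fun_prop : Continuous fun t : ℝ => (x, t))
        fun_prop) |>.integrableOn_compact isCompact_Icc
    have h2 : IntegrableOn (fun t => cumulEnergy D x t * χ t) (Icc t₁ t₂) :=
      (hχc.continuousOn.integrableOn_compact isCompact_Icc).bdd_mul
        (h.measurable_cumulEnergy.comp measurable_prodMk_left).aestronglyMeasurable
        (Eventually.of_forall fun t => h.abs_cumulEnergy_le x t)
    exact h1.add (h2.const_mul _)
  have hAx : ∀ x, IntegrableOn (fun t => A (x, t)) (Icc t₁ t₂) := fun x =>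
    (hAc.comp (by fun_prop : Continuous fun t : ℝ => (x, t))).continuousOn.integrableOn_compact
      isCompact_Icc
  set f : ℝ → ℝ := fun x => ∫ t in Icc t₁ t₂, A (x, t) with hf
  set g : ℝ → ℝ := fun x => ∫ t in Icc t₁ t₂, B (x, t) with hg
  have hfc : Continuous f := by
    apply continuous_parametric_integral_of_continuous (f := fun x t => A (x, t)) _ isCompact_Icc
    simpa [Function.uncurry_def] using hAc
  have hgi : IntegrableOn g (Icc a b) := by
    have : Integrable B (((volume : Measure ℝ).restrict (Icc a b)).prod
      ((volume : Measure ℝ).restrict (Icc t₁ t₂))) := by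
      rw [Measure.prod_restrict]; exact hBi1
    exact this.integral_prod_left
  -- With χ fixed, g is the distributional derivative of the continuous function f, so the flux
  -- difference across [a,b] is recovered from test functions in x.
  have key : f b - f a = ∫ x in a..b, g x := by
    apply sub_eq_integral_of_weak_deriv hab hfc.continuousOn
      ((intervalIntegrable_iff_integrableOn_Icc_of_le hab.le).2 hgi)
    intro θ hθ _ hsθ
    have hθc : Continuous θ := hθ.continuous
    have hθd : Continuous (deriv θ) := hθ.continuous_deriv (by simp)
    have hbox := h.integral_box ht₁ hθ hχ hsθ hsχ
    rw [← setIntegral_eq_integral_of_forall_compl_eq_zero (s := Icc a b)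
      (fun x hx => by rw [eq_zero_of_notMem hsθ hx, deriv_eq_zero_of_notMem hsθ hx]; ring)]
    rw [← hbox]
    have hi : IntegrableOn (fun p : ℝ × ℝ => A p * deriv θ p.1 + B p * θ p.1)
        (Icc a b ×ˢ Icc t₁ t₂) :=
      ((Continuous.continuousOn (by fun_prop)).integrableOn_compact
        (isCompact_Icc.prod isCompact_Icc)).add (hBi θ hθc)
    rw [Measure.volume_eq_prod, setIntegral_prod _ hi]
    congr 1
    ext x
    exact ((integral_add ((hAx x).mul_const _) ((hBx x).mul_const _)).trans
      (congrArg₂ _ (integral_mul_const _ _) (integral_mul_const _ _))).symm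
  rw [intervalIntegral.integral_of_le hab.le, ← integral_Icc_eq_integral_Ioc] at key
  have hsw : ∫ x in Icc a b, g x = ∫ t in Icc t₁ t₂, ∫ x in Icc a b, B (x, t) := by
    apply integral_integral_swap
    rw [Measure.prod_restrict]; exact hBi1
  have hinner : ∀ t, ∫ x in Icc a b, B (x, t) = (∫ x in a..b, v x t) * deriv χ t
      + 1 / 2 * (∫ x in a..b, cumulEnergy D x t) * χ t := by
    intro t
    have hvt : Continuous fun x => v x t := hv.comp (by fun_prop : Continuous fun x : ℝ => (x, t))
    have hct := h.continuous_cumulEnergy t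
    rw [integral_Icc_eq_integral_Ioc, ← intervalIntegral.integral_of_le hab.le]
    simp only [hB]
    rw [intervalIntegral.integral_add, intervalIntegral.integral_mul_const,
      intervalIntegral.integral_const_mul, intervalIntegral.integral_mul_const]
    · ring
    · exact Continuous.intervalIntegrable (by fun_prop) _ _
    · exact Continuous.intervalIntegrable (by fun_prop) _ _
  have hBs : IntegrableOn (fun t => ∫ x in Icc a b, B (x, t)) (Icc t₁ t₂) := by
    have : Integrable B (((volume : Measure ℝ).restrict (Icc a b)).prod
      ((volume : Measure ℝ).restrict (Icc t₁ t₂))) := by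
      rw [Measure.prod_restrict]; exact hBi1
    exact this.integral_prod_right
  rw [hsw] at key
  simp only [hf] at key
  rw [← integral_sub (hAx b) (hAx a), eq_comm, ← sub_eq_zero] at key
  refine Eq.trans (congrArg _ ?_) ((integral_sub hBs ((hAx b).sub (hAx a))).trans key)
  ext t
  simp only [hinner, hA, Pi.sub_apply]
  ring

theorem measurable_integral_cumulEnergy (h : IsEnergyFlow v D C) (a b : ℝ) :
    Measurable fun t => ∫ x in a..b, cumulEnergy D x t := by
  have h1 : Measurable fun p : ℝ × ℝ => cumulEnergy D p.2 p.1 :=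
    h.measurable_cumulEnergy.comp measurable_swap
  have h2 : ∀ s : Set ℝ, Measurable fun t => ∫ x in s, cumulEnergy D x t := fun s =>
    (h1.stronglyMeasurable.integral_prod_right' (ν := volume.restrict s)).measurable
  exact (h2 _).sub (h2 _)

theorem abs_integral_cumulEnergy_le (h : IsEnergyFlow v D C) (a b t : ℝ) :
    |∫ x in a..b, cumulEnergy D x t| ≤ C * |b - a| := by
  rw [← Real.norm_eq_abs]
  exact intervalIntegral.norm_integral_le_of_norm_le_const fun x _ => h.abs_cumulEnergy_le x t

/-- The flux balance of `v` over `[a, b]`. -/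
noncomputable def flux (v D : ℝ → ℝ → ℝ) (a b t : ℝ) : ℝ :=
  1 / 2 * v a t ^ 2 - 1 / 2 * v b t ^ 2 + 1 / 2 * ∫ x in a..b, cumulEnergy D x t

theorem intervalIntegrable_flux (h : IsEnergyFlow v D C) (a b t₁ t₂ : ℝ) :
    IntervalIntegrable (flux v D a b) volume t₁ t₂ := by
  have hvt : ∀ x, Continuous fun t => v x t := fun x =>
    h.cont.comp (by fun_prop : Continuous fun t : ℝ => (x, t))
  have h1 : IntervalIntegrable (fun t => 1 / 2 * v a t ^ 2 - 1 / 2 * v b t ^ 2) volume t₁ t₂ :=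
    Continuous.intervalIntegrable (by have := hvt a; have := hvt b; fun_prop) _ _
  refine h1.add (IntervalIntegrable.const_mul ?_ _)
  refine (intervalIntegrable_const (c := C * |b - a|)).mono_fun
    (h.measurable_integral_cumulEnergy a b).aestronglyMeasurable
    (Eventually.of_forall fun t => ?_)
  exact (h.abs_integral_cumulEnergy_le a b t).trans (le_abs_self _)

theorem continuous_integral (h : IsEnergyFlow v D C) (a b : ℝ) :
    Continuous fun t => ∫ x in a..b, v x t := by
  apply intervalIntegral.continuous_parametric_intervalIntegral_of_continuous'
  exact h.cont.comp (by fun_prop : Continuous fun p : ℝ × ℝ => (p.2, p.1))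

/-- By `integral_time`, the flux is the distributional time derivative of ∫v dx for t > 0. Test
functions do not reach t = 0; that endpoint follows by continuity of both sides in the lower time.
-/
theorem integral_sub_integral (h : IsEnergyFlow v D C) {a b t₁ t₂ : ℝ} (hab : a ≤ b)
    (ht₁ : 0 ≤ t₁) (ht : t₁ ≤ t₂) :
    (∫ x in a..b, v x t₂) - ∫ x in a..b, v x t₁ = ∫ t in t₁..t₂, flux v D a b t := by
  rcases hab.eq_or_lt with rfl | hab
  · simp [flux]
  rcases ht.eq_or_lt with rfl | ht
  · simp
  have hpos : ∀ s, 0 < s → s < t₂ →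
      (∫ x in a..b, v x t₂) - ∫ x in a..b, v x s = ∫ t in s..t₂, flux v D a b t := by
    intro s hs hst
    apply sub_eq_integral_of_weak_deriv hst (h.continuous_integral a b).continuousOn
      (h.intervalIntegrable_flux a b _ _)
    intro χ hχ _ hsχ
    rw [← h.integral_time hs hab hχ hsχ]
    rw [← setIntegral_eq_integral_of_forall_compl_eq_zero (s := Icc s t₂)
      (fun x hx => by rw [eq_zero_of_notMem hsχ hx, deriv_eq_zero_of_notMem hsχ hx]; ring)]
    rfl
  have h1 : Continuous fun s => (∫ x in a..b, v x t₂) - ∫ x in a..b, v x s :=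
    continuous_const.sub (h.continuous_integral a b)
  have h2 : Continuous fun s => ∫ t in s..t₂, flux v D a b t := by
    have := (intervalIntegral.continuous_primitive
      (fun p q => h.intervalIntegrable_flux a b p q) t₂).neg
    refine this.congr fun s => ?_
    exact (intervalIntegral.integral_symm t₂ s).symm
  have h3 : IsClosed {s | (∫ x in a..b, v x t₂) - ∫ x in a..b, v x s
      = ∫ t in s..t₂, flux v D a b t} := isClosed_eq h1 h2
  have h4 : Ioo 0 t₂ ⊆ {s | (∫ x in a..b, v x t₂) - ∫ x in a..b, v x s
      = ∫ t in s..t₂, flux v D a b t} := fun s hs => hpos s hs.1 hs.2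
  have h5 := closure_minimal h4 h3
  rw [closure_Ioo (by linarith)] at h5
  exact h5 ⟨ht₁, ht.le⟩

end IsEnergyFlow
end HunterSaxton

/-! ### Growth of the velocity along a characteristic. -/

namespace HunterSaxton

/-- `x` is a continuous curve that solves `x(t) = η + ∫₀ᵗ v(x(s), s) ds` on `[0, S]`. -/
def IsIntegralChar (v : ℝ → ℝ → ℝ) (S η : ℝ) (x : ℝ → ℝ) : Prop :=
  Continuous x ∧ ∀ t ∈ Icc 0 S, x t = η + ∫ s in (0 : ℝ)..t, v (x s) s

theorem tendsto_average_right {f : ℝ → ℝ} (hf : Continuous f) (x : ℝ) :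
    Tendsto (fun δ => δ⁻¹ * ∫ y in x..(x + δ), f y) (𝓝[>] 0) (𝓝 (f x)) := by
  have h1 : HasDerivAt (fun z => ∫ y in x..z, f y) (f x) x :=
    (hf.integral_hasStrictDerivAt x x).hasDerivAt
  have h2 := (hasDerivAt_iff_tendsto_slope_zero.1 h1).mono_left
    (nhdsWithin_mono (0 : ℝ) (fun y (hy : y ∈ Ioi 0) => ne_of_gt hy))
  simpa using h2

namespace IsEnergyFlow

variable {v D : ℝ → ℝ → ℝ} {C : ℝ}

theorem continuous_time (h : IsEnergyFlow v D C) (x : ℝ) : Continuous fun t => v x t :=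
  h.cont.comp (by fun_prop : Continuous fun t : ℝ => (x, t))

theorem continuous_space (h : IsEnergyFlow v D C) (t : ℝ) : Continuous fun x => v x t :=
  h.cont.comp (by fun_prop : Continuous fun x : ℝ => (x, t))

theorem continuous_comp (h : IsEnergyFlow v D C) {x y : ℝ → ℝ} (hx : Continuous x)
    (hy : Continuous y) : Continuous fun t => v (x t) (y t) :=
  h.cont.comp (hx.prodMk hy)

/-- Shifting a window changes the integral only by two end pieces of length |a − b|, on which the
integrand is at most C. -/
theorem abs_integral_cumulEnergy_sub_le (h : IsEnergyFlow v D C) (a b δ t : ℝ) :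
    |(∫ y in a..(a + δ), cumulEnergy D y t) - ∫ y in b..(b + δ), cumulEnergy D y t|
      ≤ 2 * C * |a - b| := by
  have hi : ∀ p q, IntervalIntegrable (fun y => cumulEnergy D y t) volume p q :=
    fun p q => (h.continuous_cumulEnergy t).intervalIntegrable p q
  have e : (∫ y in a..(a + δ), cumulEnergy D y t) - ∫ y in b..(b + δ), cumulEnergy D y t
      = (∫ y in a..b, cumulEnergy D y t) + ∫ y in (b + δ)..(a + δ), cumulEnergy D y t := by
    have h1 := intervalIntegral.integral_add_adjacent_intervals (hi a b) (hi b (b + δ))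
    have h2 := intervalIntegral.integral_add_adjacent_intervals (hi a (b + δ)) (hi (b + δ) (a + δ))
    linarith
  rw [e]
  refine (abs_add_le _ _).trans ?_
  have h1 := h.abs_integral_cumulEnergy_le a b t
  have h2 := h.abs_integral_cumulEnergy_le (b + δ) (a + δ) t
  rw [abs_sub_comm] at h1
  have : a + δ - (b + δ) = a - b := by ring
  rw [this] at h2
  linarith

/-- The rate of change of `∫ v(y,t) dy` over an interval of length `δ` that moves with the left
end point `x(t)`. -/
noncomputable def movingFlux (v D : ℝ → ℝ → ℝ) (x : ℝ → ℝ) (δ s : ℝ) : ℝ :=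
  -(1 / 2) * (v (x s + δ) s - v (x s) s) ^ 2 + 1 / 2 * ∫ y in (x s)..(x s + δ), cumulEnergy D y s

theorem measurable_integral_moving (h : IsEnergyFlow v D C) {x : ℝ → ℝ} (hx : Continuous x) (δ : ℝ) :
    Measurable fun s => ∫ y in (x s)..(x s + δ), cumulEnergy D y s := by
  have h1 : Measurable fun p : ℝ × ℝ => cumulEnergy D (x p.1 + p.2) p.1 :=
    h.measurable_cumulEnergy.comp
      (by have := hx.measurable; fun_prop : Measurable fun p : ℝ × ℝ => (x p.1 + p.2, p.1))
  have h2 : ∀ s : Set ℝ, Measurable fun t => ∫ y in s, cumulEnergy D (x t + y) t := fun s =>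
    (h1.stronglyMeasurable.integral_prod_right' (ν := volume.restrict s)).measurable
  have h3 : (fun s => ∫ y in (x s)..(x s + δ), cumulEnergy D y s)
      = fun s => ∫ y in (0 : ℝ)..δ, cumulEnergy D (x s + y) s := by
    ext s
    rw [intervalIntegral.integral_comp_add_left (fun y => cumulEnergy D y s)]
    simp
  rw [h3]
  exact (h2 _).sub (h2 _)

theorem intervalIntegrable_movingFlux (h : IsEnergyFlow v D C) {x : ℝ → ℝ} (hx : Continuous x)
    (δ a b : ℝ) : IntervalIntegrable (movingFlux v D x δ) volume a b := by
  have h1 : Continuous fun s => v (x s + δ) s := h.continuous_comp (by fun_prop) continuous_id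
  have h2 : Continuous fun s => v (x s) s := h.continuous_comp hx continuous_id
  refine IntervalIntegrable.add
    (Continuous.intervalIntegrable (continuous_const.mul ((h1.sub h2).pow 2)) _ _)
    (IntervalIntegrable.const_mul ?_ _)
  refine (intervalIntegrable_const (c := C * |δ|)).mono_fun
    (h.measurable_integral_moving hx δ).aestronglyMeasurable
    (Eventually.of_forall fun t => ?_)
  have := h.abs_integral_cumulEnergy_le (x t) (x t + δ) t
  rw [add_sub_cancel_left] at this
  exact this.trans (le_abs_self _)

/-- The change is made in two moves: time runs from t to t' with the window frozen at x(t), which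
gives the flux; then at the fixed time t' the window slides to x(t'), which is a substitution along
the curve. -/
theorem integral_moving_sub (h : IsEnergyFlow v D C) {S η : ℝ} {x : ℝ → ℝ}
    (hx : IsIntegralChar v S η x) {δ : ℝ} (hδ : 0 ≤ δ) {t t' : ℝ} (ht : 0 ≤ t) (htt : t ≤ t')
    (ht' : t' ≤ S) :
    (∫ y in (x t')..(x t' + δ), v y t') - ∫ y in (x t)..(x t + δ), v y t
      = ∫ s in t..t', (flux v D (x t) (x t + δ) s
          + (v (x s + δ) t' - v (x s) t') * v (x s) s) := by
  have hvx : Continuous fun s => v (x s) s := h.continuous_comp hx.1 continuous_id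
  -- This primitive equals x on [0,S] but is differentiable on the whole line, as the substitution
  -- rule needs.
  set X : ℝ → ℝ := fun t => η + ∫ s in (0 : ℝ)..t, v (x s) s with hX
  have hXd : ∀ s, HasDerivAt X (v (x s) s) s := fun s =>
    (hvx.integral_hasStrictDerivAt 0 s).hasDerivAt.const_add η
  have hsub : ∀ d, ∫ s in t..t', v (x s + d) t' * v (x s) s
      = ∫ y in (x t + d)..(x t' + d), v y t' := by
    intro d
    have hg : Continuous fun z => v (z + d) t' := h.continuous_comp (by fun_prop) continuous_const
    have h1 := intervalIntegral.integral_comp_mul_deriv (a := t) (b := t') (fun s _ => hXd s)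
      hvx.continuousOn hg
    have h2 : X t = x t := (hx.2 t ⟨ht, htt.trans ht'⟩).symm
    have h3 : X t' = x t' := (hx.2 t' ⟨ht.trans htt, ht'⟩).symm
    rw [h2, h3, intervalIntegral.integral_comp_add_right (fun y => v y t')] at h1
    rw [← h1]
    apply intervalIntegral.integral_congr
    intro s hs
    rw [uIcc_of_le htt] at hs
    have h4 : X s = x s := (hx.2 s ⟨ht.trans hs.1, hs.2.trans ht'⟩).symm
    simp only [Function.comp, h4]
  have hi : ∀ p q, IntervalIntegrable (fun y => v y t') volume p q :=
    fun p q => (h.continuous_space t').intervalIntegrable p q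
  have hc1 : ∀ d, Continuous fun s => v (x s + d) t' * v (x s) s := fun d =>
    (h.continuous_comp (by have := hx.1; fun_prop) continuous_const).mul hvx
  have h0 := hsub 0
  simp only [add_zero] at h0
  have hc2 : Continuous fun s => (v (x s + δ) t' - v (x s) t') * v (x s) s :=
    ((h.continuous_comp (by have := hx.1; fun_prop) continuous_const).sub
      (h.continuous_comp hx.1 continuous_const)).mul hvx
  rw [intervalIntegral.integral_add (h.intervalIntegrable_flux _ _ _ _)
    (hc2.intervalIntegrable _ _),
    ← h.integral_sub_integral (by linarith) ht htt]
  have h5 : ∫ s in t..t', (v (x s + δ) t' - v (x s) t') * v (x s) s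
      = (∫ s in t..t', v (x s + δ) t' * v (x s) s) - ∫ s in t..t', v (x s) t' * v (x s) s := by
    rw [← intervalIntegral.integral_sub ((hc1 δ).intervalIntegrable _ _)
      (by have := hc1 0; simp only [add_zero] at this; exact this.intervalIntegrable _ _)]
    simp only [sub_mul]
  rw [h5, hsub δ, h0]
  have h6 := intervalIntegral.integral_add_adjacent_intervals (hi (x t) (x t + δ))
    (hi (x t + δ) (x t' + δ))
  have h7 := intervalIntegral.integral_add_adjacent_intervals (hi (x t) (x t'))
    (hi (x t') (x t' + δ))
  linarith

/-- The difference of the two sides, as a function of the final time, is continuous with zero right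
derivative, hence constant: freezing the window over a short time step costs an error of smaller
order than the step. -/
theorem integral_moving_eq (h : IsEnergyFlow v D C) {S η : ℝ} {x : ℝ → ℝ}
    (hx : IsIntegralChar v S η x) {δ : ℝ} (hδ : 0 ≤ δ) {T : ℝ} (hT : T ∈ Icc 0 S) :
    (∫ y in (x T)..(x T + δ), v y T) - ∫ y in (x 0)..(x 0 + δ), v y 0
      = ∫ s in (0 : ℝ)..T, movingFlux v D x δ s := by
  have hxc : Continuous x := hx.1
  have hvx : Continuous fun s => v (x s) s := h.continuous_comp hxc continuous_id
  have hvxδ : Continuous fun s => v (x s + δ) s := h.continuous_comp (by fun_prop) continuous_id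
  set R : ℝ → ℝ := fun t => (∫ y in (x t)..(x t + δ), v y t)
    - ∫ s in (0 : ℝ)..t, movingFlux v D x δ s with hR
  have hRc : Continuous R := by
    apply Continuous.sub
    · have h1 : (fun t => ∫ y in (x t)..(x t + δ), v y t)
          = fun t => ∫ y in (0 : ℝ)..δ, v (x t + y) t := by
        ext s
        rw [intervalIntegral.integral_comp_add_left (fun y => v y s)]
        simp
      rw [h1]
      apply intervalIntegral.continuous_parametric_intervalIntegral_of_continuous'
      exact h.cont.comp (by fun_prop : Continuous fun p : ℝ × ℝ => (x p.1 + p.2, p.1))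
    · exact intervalIntegral.continuous_primitive (h.intervalIntegrable_movingFlux hxc δ) 0
  have hconst := constant_of_has_deriv_right_zero (f := R) (a := 0) (b := S) hRc.continuousOn ?_
  · have := hconst T hT
    simp only [hR, intervalIntegral.integral_same] at this
    linarith
  intro t ht
  -- E bounds the integrand of the error at time s when the step ends at t'. It is continuous in
  -- (s,t') and vanishes at (t,t), hence is below ε nearby.
  set q : ℝ → ℝ → ℝ := fun a s => 1 / 2 * v a s ^ 2 - 1 / 2 * v (a + δ) s ^ 2 with hq
  set E : ℝ × ℝ → ℝ := fun p => |q (x t) p.1 - q (x p.1) p.1| + C * |x t - x p.1|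
    + |(v (x p.1 + δ) p.2 - v (x p.1) p.2 - (v (x p.1 + δ) p.1 - v (x p.1) p.1)) * v (x p.1) p.1|
    with hE
  have hEc : Continuous E := by
    have c1 : ∀ f : ℝ × ℝ → ℝ × ℝ, Continuous f → Continuous fun p => v (f p).1 (f p).2 :=
      fun f hf => h.cont.comp hf
    have e1 := c1 (fun p => (x t, p.1)) (by fun_prop)
    have e2 := c1 (fun p => (x t + δ, p.1)) (by fun_prop)
    have e3 := c1 (fun p => (x p.1, p.1)) (by fun_prop)
    have e4 := c1 (fun p => (x p.1 + δ, p.1)) (by fun_prop)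
    have e5 := c1 (fun p => (x p.1, p.2)) (by fun_prop)
    have e6 := c1 (fun p => (x p.1 + δ, p.2)) (by fun_prop)
    have e7 : Continuous fun p : ℝ × ℝ => C * |x t - x p.1| := by fun_prop
    exact ((((((e1.pow 2).const_mul _).sub ((e2.pow 2).const_mul _)).sub
      (((e3.pow 2).const_mul _).sub ((e4.pow 2).const_mul _))).abs).add e7).add
      (((e6.sub e5).sub (e4.sub e3)).mul e3).abs
  have hE0 : E (t, t) = 0 := by simp [hE]
  rw [hasDerivWithinAt_iff_isLittleO, Asymptotics.isLittleO_iff]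
  intro ε hε
  have hev : ∀ᶠ p in 𝓝 (t, t), E p < ε := by
    have := hEc.tendsto (t, t)
    rw [hE0] at this
    exact this.eventually_lt_const hε
  rw [Metric.eventually_nhds_iff] at hev
  obtain ⟨ρ, hρ, hev⟩ := hev
  have hnhds : ∀ᶠ t' in 𝓝[≥] t, t' ∈ Ico t (min (t + ρ) S) :=
    Ico_mem_nhdsGE (lt_min (by linarith) ht.2)
  filter_upwards [hnhds] with t' ht'
  have htt : t ≤ t' := ht'.1
  have ht'S : t' ≤ S := (ht'.2.trans_le (min_le_right _ _)).le
  have ht'ρ : t' < t + ρ := ht'.2.trans_le (min_le_left _ _)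
  have hdiff : R t' - R t = ∫ s in t..t', (flux v D (x t) (x t + δ) s
      + (v (x s + δ) t' - v (x s) t') * v (x s) s - movingFlux v D x δ s) := by
    rw [intervalIntegral.integral_sub _ (h.intervalIntegrable_movingFlux hxc δ _ _),
      ← h.integral_moving_sub hx hδ ht.1 htt ht'S]
    · have := intervalIntegral.integral_add_adjacent_intervals
        (h.intervalIntegrable_movingFlux hxc δ 0 t) (h.intervalIntegrable_movingFlux hxc δ t t')
      simp only [hR]
      linarith
    · refine (h.intervalIntegrable_flux _ _ _ _).add (Continuous.intervalIntegrable ?_ _ _)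
      exact ((h.continuous_comp (by fun_prop) continuous_const).sub
        (h.continuous_comp (by fun_prop) continuous_const)).mul hvx
  have hbd : ‖∫ s in t..t', (flux v D (x t) (x t + δ) s
      + (v (x s + δ) t' - v (x s) t') * v (x s) s - movingFlux v D x δ s)‖ ≤ ε * |t' - t| := by
    apply intervalIntegral.norm_integral_le_of_norm_le_const
    intro s hs
    rw [uIoc_of_le htt] at hs
    have hEs : E (s, t') < ε := by
      apply hev
      rw [Prod.dist_eq, max_lt_iff, Real.dist_eq, Real.dist_eq, abs_lt, abs_lt]
      refine ⟨⟨?_, ?_⟩, ?_, ?_⟩ <;> simp only <;> linarith [hs.1, hs.2]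
    refine le_trans ?_ hEs.le
    have hP := h.abs_integral_cumulEnergy_sub_le (x t) (x s) δ s
    -- With p = v(x,s) and q = v(x+δ,s), the flux and transport terms combine as ½p² − ½q² + (q −
    -- p)p = −½(q − p)².
    have e : flux v D (x t) (x t + δ) s + (v (x s + δ) t' - v (x s) t') * v (x s) s
        - movingFlux v D x δ s = (q (x t) s - q (x s) s)
        + 1 / 2 * ((∫ y in (x t)..(x t + δ), cumulEnergy D y s)
          - ∫ y in (x s)..(x s + δ), cumulEnergy D y s)
        + (v (x s + δ) t' - v (x s) t' - (v (x s + δ) s - v (x s) s)) * v (x s) s := by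
      simp only [flux, movingFlux, hq]; ring
    rw [e, Real.norm_eq_abs]
    refine (abs_add_le _ _).trans (add_le_add ((abs_add_le _ _).trans (add_le_add le_rfl ?_)) le_rfl)
    rw [abs_mul, abs_of_nonneg (by norm_num : (0 : ℝ) ≤ 1 / 2)]
    linarith
  rw [← hdiff] at hbd
  simpa using hbd

/-- Along a characteristic, `v` grows at the rate of one half of the energy to its left. -/
theorem momentum (h : IsEnergyFlow v D C) {S η : ℝ} {x : ℝ → ℝ}
    (hx : IsIntegralChar v S η x) {T : ℝ} (hT : T ∈ Icc 0 S) :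
    v (x T) T - v η 0 = 1 / 2 * ∫ s in (0 : ℝ)..T, cumulEnergy D (x s) s := by
  have hxc : Continuous x := hx.1
  have hx0 : x 0 = η := by simpa using hx.2 0 ⟨le_rfl, hT.1.trans hT.2⟩
  -- The identity for a window of length δ is divided by δ and δ → 0⁺.
  have hL : Tendsto (fun δ => δ⁻¹ * ((∫ y in (x T)..(x T + δ), v y T)
      - ∫ y in (x 0)..(x 0 + δ), v y 0)) (𝓝[>] 0) (𝓝 (v (x T) T - v η 0)) := by
    have := (tendsto_average_right (h.continuous_space T) (x T)).sub
      (tendsto_average_right (h.continuous_space 0) (x 0))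
    rw [hx0] at this ⊢
    refine this.congr fun δ => ?_
    ring
  have hRt : Tendsto (fun δ => ∫ s in (0 : ℝ)..T, δ⁻¹ * movingFlux v D x δ s) (𝓝[>] 0)
      (𝓝 (∫ s in (0 : ℝ)..T, 1 / 2 * cumulEnergy D (x s) s)) := by
    apply intervalIntegral.tendsto_integral_filter_of_dominated_convergence (fun _ => C)
    · filter_upwards with δ
      exact ((h.intervalIntegrable_movingFlux hxc δ 0 T).const_mul _).def'.1
    · filter_upwards [self_mem_nhdsWithin] with δ (hδ : 0 < δ)
      filter_upwards [h.sq_sub_le] with s hs hsT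
      rw [uIoc_of_le hT.1] at hsT
      have h1 := hs hsT.1.le (x s) (x s + δ) (by linarith)
      rw [← h.cumulEnergy_sub, add_sub_cancel_left] at h1
      have h2 := h.abs_integral_cumulEnergy_le (x s) (x s + δ) s
      rw [add_sub_cancel_left, abs_of_pos hδ, abs_le] at h2
      have h3 : 0 ≤ ∫ y in (x s)..(x s + δ), cumulEnergy D y s :=
        intervalIntegral.integral_nonneg (by linarith) fun y _ => cumulEnergy_nonneg D y s
      have h4 : (v (x s + δ) s - v (x s) s) ^ 2 ≤ δ * C :=
        h1.trans (mul_le_mul_of_nonneg_left (by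
          linarith [h.cumulEnergy_le (x s + δ) s, cumulEnergy_nonneg D (x s) s]) hδ.le)
      rw [Real.norm_eq_abs, abs_mul, abs_of_pos (inv_pos.2 hδ), inv_mul_le_iff₀ hδ, movingFlux,
        abs_le]
      constructor <;> nlinarith [sq_nonneg (v (x s + δ) s - v (x s) s)]
    · exact intervalIntegrable_const
    · filter_upwards [h.sq_sub_le] with s hs hsT
      rw [uIoc_of_le hT.1] at hsT
      have hPc := h.continuous_cumulEnergy s
      -- The quadratic term disappears: by Cauchy–Schwarz, the squared increment divided by δ is at
      -- most the energy in [x, x+δ], which tends to 0.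
      have h1 : Tendsto (fun δ => δ⁻¹ * (v (x s + δ) s - v (x s) s) ^ 2) (𝓝[>] 0) (𝓝 0) := by
        have h2 : Tendsto (fun δ => cumulEnergy D (x s + δ) s - cumulEnergy D (x s) s)
            (𝓝[>] 0) (𝓝 0) := by
          have : Continuous fun δ => cumulEnergy D (x s + δ) s - cumulEnergy D (x s) s := by
            have := hPc.comp (by fun_prop : Continuous fun δ => x s + δ)
            exact this.sub continuous_const
          have := this.tendsto 0
          simp only [add_zero, sub_self] at this
          exact this.mono_left nhdsWithin_le_nhds
        refine squeeze_zero' ?_ ?_ h2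
        · filter_upwards [self_mem_nhdsWithin] with δ (hδ : 0 < δ)
          positivity
        · filter_upwards [self_mem_nhdsWithin] with δ (hδ : 0 < δ)
          have h1 := hs hsT.1.le (x s) (x s + δ) (by linarith)
          rw [← h.cumulEnergy_sub, add_sub_cancel_left] at h1
          rwa [inv_mul_le_iff₀ hδ]
      have h2 := (h1.const_mul (-(1 / 2))).add
        ((tendsto_average_right hPc (x s)).const_mul (1 / 2))
      simp only [mul_zero, zero_add] at h2
      refine h2.congr fun δ => ?_
      simp only [movingFlux]; ring
  rw [← intervalIntegral.integral_const_mul]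
  refine tendsto_nhds_unique hL (hRt.congr' ?_)
  filter_upwards [self_mem_nhdsWithin] with δ (hδ : 0 < δ)
  rw [intervalIntegral.integral_const_mul, h.integral_moving_eq hx hδ.le hT]

end IsEnergyFlow
end HunterSaxton

/-! ### Integral curves and existence of leftmost characteristics. -/

namespace HunterSaxton

theorem max_min_mem_Icc {S : ℝ} (hS : 0 ≤ S) (t : ℝ) : max 0 (min t S) ∈ Icc 0 S :=
  ⟨le_max_left _ _, max_le hS (min_le_right _ _)⟩

theorem max_min_eq_self {S t : ℝ} (ht : t ∈ Icc 0 S) : max 0 (min t S) = t := by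
  rw [min_eq_left ht.2, max_eq_right ht.1]

theorem isIntegralChar_clamp {v : ℝ → ℝ → ℝ} {S η : ℝ} (hS : 0 ≤ S) {x : ℝ → ℝ}
    (hx : ContinuousOn x (Icc 0 S)) (hxe : ∀ t ∈ Icc 0 S, x t = η + ∫ s in (0 : ℝ)..t, v (x s) s) :
    IsIntegralChar v S η fun t => x (max 0 (min t S)) := by
  refine ⟨hx.comp_continuous (by fun_prop) (max_min_mem_Icc hS), fun t ht => ?_⟩
  simp only [max_min_eq_self ht]
  rw [hxe t ht]
  congr 1
  apply intervalIntegral.integral_congr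
  intro s hs
  rw [uIcc_of_le ht.1] at hs
  simp only [max_min_eq_self ⟨hs.1, hs.2.trans ht.2⟩]

namespace IsIntegralChar

variable {v w : ℝ → ℝ → ℝ} {S η : ℝ} {x y : ℝ → ℝ}

theorem apply_zero (hx : IsIntegralChar v S η x) (hS : 0 ≤ S) : x 0 = η := by
  simpa using hx.2 0 ⟨le_rfl, hS⟩

theorem mono (hx : IsIntegralChar v S η x) {S' : ℝ} (hS : S' ≤ S) : IsIntegralChar v S' η x :=
  ⟨hx.1, fun t ht => hx.2 t ⟨ht.1, ht.2.trans hS⟩⟩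

theorem hasDerivAt_primitive (hv : Continuous fun p : ℝ × ℝ => v p.1 p.2)
    (hx : IsIntegralChar v S η x) (t : ℝ) :
    HasDerivAt (fun t => η + ∫ s in (0 : ℝ)..t, v (x s) s) (v (x t) t) t := by
  have : Continuous fun s => v (x s) s := hv.comp (hx.1.prodMk continuous_id)
  exact (this.integral_hasStrictDerivAt 0 t).hasDerivAt.const_add η

theorem hasDerivWithinAt (hv : Continuous fun p : ℝ × ℝ => v p.1 p.2)
    (hx : IsIntegralChar v S η x) {t : ℝ} (ht : t ∈ Ico 0 S) :
    HasDerivWithinAt x (v (x t) t) (Ici t) t := by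
  refine (hasDerivAt_primitive hv hx t).hasDerivWithinAt.congr_of_eventuallyEq ?_
    (hx.2 t ⟨ht.1, ht.2.le⟩)
  filter_upwards [Ico_mem_nhdsGE ht.2] with s hs
  exact hx.2 s ⟨ht.1.trans hs.1, hs.2.le⟩

theorem hasDerivAt (hv : Continuous fun p : ℝ × ℝ => v p.1 p.2)
    (hx : IsIntegralChar v S η x) {t : ℝ} (ht : t ∈ Ioo 0 S) :
    HasDerivAt x (v (x t) t) t := by
  refine (hasDerivAt_primitive hv hx t).congr_of_eventuallyEq ?_
  filter_upwards [Ioo_mem_nhds ht.1 ht.2] with s hs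
  exact hx.2 s ⟨hs.1.le, hs.2.le⟩

/-- Strict comparison of integral curves. -/
theorem le_of_lt (hv : Continuous fun p : ℝ × ℝ => v p.1 p.2)
    (hw : Continuous fun p : ℝ × ℝ => w p.1 p.2) (hvw : ∀ z t, 0 ≤ t → v z t < w z t) {η' : ℝ}
    (hη : η ≤ η') (hx : IsIntegralChar v S η x) (hy : IsIntegralChar w S η' y) {t : ℝ}
    (ht : t ∈ Icc 0 S) : x t ≤ y t := by
  have hS : 0 ≤ S := ht.1.trans ht.2
  refine image_le_of_deriv_right_lt_deriv_boundary' hx.1.continuousOn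
    (fun s hs => hx.hasDerivWithinAt hv hs) ?_ hy.1.continuousOn
    (fun s hs => hy.hasDerivWithinAt hw hs) ?_ ht
  · rw [hx.apply_zero hS, hy.apply_zero hS]; exact hη
  · intro s hs hxy
    rw [hxy]
    exact hvw _ _ hs.1

/-- A pointwise limit of bounded approximate characteristics is a characteristic. -/
theorem of_tendsto (hv : Continuous fun p : ℝ × ℝ => v p.1 p.2) (hS : 0 ≤ S) {y g : ℕ → ℝ → ℝ}
    {e : ℕ → ℝ} {ηs : ℕ → ℝ} {B : ℝ} (hη : Tendsto ηs atTop (𝓝 η)) (he : Tendsto e atTop (𝓝 0))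
    (hg : ∀ n, Continuous (g n))
    (hy : ∀ n, ∀ t ∈ Icc 0 S, y n t = ηs n + ∫ s in (0 : ℝ)..t, g n s)
    (hgv : ∀ n, ∀ s ∈ Icc 0 S, |g n s - v (y n s) s| ≤ e n)
    (hB : ∀ n, ∀ s ∈ Icc 0 S, |y n s| ≤ B)
    (hlim : ∀ s ∈ Icc 0 S, Tendsto (fun n => y n s) atTop (𝓝 (x s))) :
    IsIntegralChar v S η fun t => x (max 0 (min t S)) := by
  obtain ⟨M, hM⟩ := ((isCompact_Icc (a := -B) (b := B)).prod
    (isCompact_Icc (a := (0 : ℝ)) (b := S))).exists_bound_of_continuousOn hv.continuousOn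
  obtain ⟨E, hE⟩ := he.bddAbove_range
  have hgb : ∀ n, ∀ s ∈ Icc 0 S, ‖g n s‖ ≤ M + E := by
    intro n s hs
    have h1 := hM (y n s, s) ⟨abs_le.1 (hB n s hs), hs⟩
    have h2 := hgv n s hs
    have h3 : e n ≤ E := hE ⟨n, rfl⟩
    have h4 : g n s = (g n s - v (y n s) s) + v (y n s) s := by ring
    rw [h4]
    refine (norm_add_le _ _).trans ?_
    rw [Real.norm_eq_abs (g n s - _)]
    simp only at h1
    linarith
  have hglim : ∀ s ∈ Icc 0 S, Tendsto (fun n => g n s) atTop (𝓝 (v (x s) s)) := by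
    intro s hs
    have h1 : Tendsto (fun n => g n s - v (y n s) s) atTop (𝓝 0) :=
      squeeze_zero_norm (fun n => hgv n s hs) he
    have h2 : Tendsto (fun n => v (y n s) s) atTop (𝓝 (v (x s) s)) :=
      (hv.tendsto (x s, s)).comp ((hlim s hs).prodMk_nhds tendsto_const_nhds)
    simpa using h1.add h2
  have hxe : ∀ t ∈ Icc 0 S, x t = η + ∫ s in (0 : ℝ)..t, v (x s) s := by
    intro t ht
    have h1 : Tendsto (fun n => ηs n + ∫ s in (0 : ℝ)..t, g n s) atTop
        (𝓝 (η + ∫ s in (0 : ℝ)..t, v (x s) s)) := by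
      apply hη.add
      apply intervalIntegral.tendsto_integral_filter_of_dominated_convergence (fun _ => M + E)
      · exact Eventually.of_forall fun n => (hg n).aestronglyMeasurable
      · refine Eventually.of_forall fun n => Eventually.of_forall fun s hs => ?_
        rw [uIoc_of_le ht.1] at hs
        exact hgb n s ⟨hs.1.le, hs.2.trans ht.2⟩
      · exact intervalIntegrable_const
      · refine Eventually.of_forall fun s hs => ?_
        rw [uIoc_of_le ht.1] at hs
        exact hglim s ⟨hs.1.le, hs.2.trans ht.2⟩
    exact tendsto_nhds_unique (hlim t ht) (h1.congr fun n => (hy n t ht).symm)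
  refine isIntegralChar_clamp hS ?_ hxe
  -- A pointwise limit need not be continuous. Here the integrand is a bounded limit of continuous
  -- functions, so the integral equation itself makes x continuous.
  have hint : IntegrableOn (fun s => v (x s) s) (Icc 0 S) := by
    refine (integrable_const (M + E)).mono' ?_ ?_
    · refine aestronglyMeasurable_of_tendsto_ae atTop
        (fun n => (hg n).aestronglyMeasurable.restrict) ?_
      exact (ae_restrict_iff' measurableSet_Icc).2 (Eventually.of_forall hglim)
    · refine (ae_restrict_iff' measurableSet_Icc).2 (Eventually.of_forall fun s hs => ?_)
      exact le_of_tendsto (hglim s hs).norm (Eventually.of_forall fun n => hgb n s hs)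
  have h2 := (intervalIntegral.continuousOn_primitive_interval (a := 0) (b := S)
    (f := fun s => v (x s) s) (μ := volume) (by rwa [uIcc_of_le hS]))
  rw [uIcc_of_le hS] at h2
  exact (continuousOn_const.add h2).congr hxe

end IsIntegralChar

namespace IsEnergyFlow

variable {v D : ℝ → ℝ → ℝ} {C : ℝ}

theorem abs_sub_le (h : IsEnergyFlow v D C) {t : ℝ} (ht : 0 ≤ t) {x y d : ℝ} (hd : |y - x| ≤ d) :
    |v y t - v x t| ≤ √(C * d) := by
  apply Real.abs_le_sqrt
  exact (h.sq_sub_le_bound ht x y).trans (mul_le_mul_of_nonneg_left hd h.nonneg)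

/-- Global solvability for vector fields that are Lipschitz in space and at bounded distance
of `v`. -/
theorem exists_isIntegralChar_of_lipschitz (h : IsEnergyFlow v D C) {S : ℝ} (hS : 0 ≤ S) (η : ℝ)
    {w : ℝ → ℝ → ℝ} (hw : Continuous fun p : ℝ × ℝ => w p.1 p.2) {K : ℝ≥0}
    (hK : ∀ t, 0 ≤ t → LipschitzWith K fun z => w z t)
    (hwv : ∀ z t, 0 ≤ t → |w z t - v z t| ≤ 3) : ∃ y, IsIntegralChar w S η y := by
  obtain ⟨M, hM⟩ := (isCompact_Icc (a := (0 : ℝ)) (b := S)).exists_bound_of_continuousOn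
    (h.continuous_time η).continuousOn
  have hM0 : 0 ≤ M := (norm_nonneg _).trans (hM 0 ⟨le_rfl, hS⟩)
  have hC := h.nonneg
  -- The radius of the Picard–Lindelöf ball. On it the speed is at most M + √(Ca) + 3, and over time
  -- S each of (M + 3)S and √(Ca)S is at most a/2. Square-root growth of v in space makes this
  -- possible for every S.
  set a : ℝ≥0 := ⟨4 * C * S ^ 2 + 2 * (M + 3) * S, by positivity⟩ with ha
  have haR : (a : ℝ) = 4 * C * S ^ 2 + 2 * (M + 3) * S := rfl
  set L : ℝ≥0 := ⟨M + √(C * a) + 3, by positivity⟩ with hL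
  have hLR : (L : ℝ) = M + √(C * a) + 3 := rfl
  have hPL : IsPicardLindelof (fun t z => w z t) (tmin := 0) (tmax := S) ⟨0, le_rfl, hS⟩ η a 0 L K :=
    { lipschitzOnWith := fun t ht => (hK t ht.1).lipschitzOnWith
      continuousOn := fun z _ =>
        (hw.comp (by fun_prop : Continuous fun t : ℝ => (z, t))).continuousOn
      norm_le := by
        intro t ht z hz
        have h1 := h.abs_sub_le ht.1 (x := η) (y := z) (d := a) (by
          rw [← Real.dist_eq]; exact hz)
        have h2 := hM t ht
        have h3 := hwv z t ht.1
        rw [Real.norm_eq_abs] at h2 ⊢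
        rw [hLR]
        have h4 : w z t = (w z t - v z t) + (v z t - v η t) + v η t := by ring
        rw [h4]
        refine (abs_add_le _ _).trans ?_
        have := abs_add_le (w z t - v z t) (v z t - v η t)
        linarith
      mul_max_le := by
        have h1 : √(C * a) * S ≤ a / 2 := by
          have h2 : √(C * a) * S = √(C * a * S ^ 2) := by
            rw [Real.sqrt_mul (mul_nonneg hC (NNReal.coe_nonneg a)) (S ^ 2), Real.sqrt_sq hS]
          rw [h2]
          apply Real.sqrt_le_iff.2
          refine ⟨by positivity, ?_⟩
          have h3 : 4 * C * S ^ 2 ≤ a := by rw [haR]; nlinarith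
          have h4 : (0 : ℝ) ≤ a := a.2
          nlinarith
        have h5 : (M + 3) * S ≤ a / 2 := by
          rw [haR]
          have : 0 ≤ C * S ^ 2 := by positivity
          linarith
        simp only [sub_zero, sub_self, NNReal.coe_zero, hLR]
        rw [max_eq_left hS]
        linarith }
  obtain ⟨y, hy0, hy⟩ := hPL.exists_eq_forall_mem_Icc_hasDerivWithinAt₀
  have hyc : ContinuousOn y (Icc 0 S) := fun t ht => (hy t ht).continuousWithinAt
  refine ⟨_, isIntegralChar_clamp hS hyc fun t ht => ?_⟩
  have hsub : Icc 0 t ⊆ Icc 0 S := Icc_subset_Icc le_rfl ht.2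
  have h1 := intervalIntegral.integral_eq_sub_of_hasDeriv_right_of_le ht.1 (hyc.mono hsub)
    (f' := fun s => w (y s) s) (fun s hs =>
      ((hy s (hsub (Ioo_subset_Icc_self hs))).hasDerivAt
        (Icc_mem_nhds hs.1 (hs.2.trans_le ht.2))).hasDerivWithinAt)
    (by
      apply ContinuousOn.intervalIntegrable
      rw [uIcc_of_le ht.1]
      exact hw.comp_continuousOn ((hyc.mono hsub).prodMk continuousOn_id))
  simp only at hy0
  rw [h1, hy0]
  ring

/-- The average of `v(·,t)` over `[z, z + δ]`. -/
noncomputable def steklov (v : ℝ → ℝ → ℝ) (δ z t : ℝ) : ℝ := δ⁻¹ * ∫ y in z..(z + δ), v y t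

theorem continuous_steklov (h : IsEnergyFlow v D C) (δ : ℝ) :
    Continuous fun p : ℝ × ℝ => steklov v δ p.1 p.2 := by
  have h1 : (fun p : ℝ × ℝ => steklov v δ p.1 p.2)
      = fun p => δ⁻¹ * ∫ y in (0 : ℝ)..δ, v (p.1 + y) p.2 := by
    ext p
    rw [intervalIntegral.integral_comp_add_left (fun y => v y p.2)]
    simp [steklov]
  rw [h1]
  apply continuous_const.mul
  apply intervalIntegral.continuous_parametric_intervalIntegral_of_continuous'
  exact h.cont.comp (by fun_prop : Continuous fun q : (ℝ × ℝ) × ℝ => (q.1.1 + q.2, q.1.2))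

theorem lipschitzWith_steklov (h : IsEnergyFlow v D C) {δ : ℝ} (hδ : 0 < δ) {t : ℝ} (ht : 0 ≤ t) :
    LipschitzWith (Real.toNNReal (δ⁻¹ * √(C * δ))) fun z => steklov v δ z t := by
  have hd : ∀ z, HasDerivAt (fun z => steklov v δ z t) (δ⁻¹ * (v (z + δ) t - v z t)) z := by
    intro z
    have hc := h.continuous_space t
    have h1 : ∀ y, HasDerivAt (fun z => ∫ y in (0 : ℝ)..z, v y t) (v y t) y := fun y =>
      (hc.integral_hasStrictDerivAt 0 y).hasDerivAt
    have h2 := (((h1 (z + δ)).comp_add_const z δ).sub (h1 z)).const_mul δ⁻¹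
    refine h2.congr_of_eventuallyEq (Eventually.of_forall fun y => ?_)
    simp only [steklov, Pi.sub_apply]
    rw [intervalIntegral.integral_interval_sub_left (hc.intervalIntegrable _ _)
      (hc.intervalIntegrable _ _)]
  apply lipschitzWith_of_nnnorm_deriv_le fun z => (hd z).differentiableAt
  intro z
  rw [(hd z).deriv, ← NNReal.coe_le_coe, coe_nnnorm, Real.coe_toNNReal _ (by positivity),
    Real.norm_eq_abs, abs_mul, abs_of_pos (inv_pos.2 hδ)]
  gcongr
  exact h.abs_sub_le ht (by rw [add_sub_cancel_left, abs_of_pos hδ])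

theorem abs_steklov_sub_le (h : IsEnergyFlow v D C) {δ : ℝ} (hδ : 0 < δ) {t : ℝ} (ht : 0 ≤ t)
    (z : ℝ) : |steklov v δ z t - v z t| ≤ √(C * δ) := by
  have hc := h.continuous_space t
  have h1 : steklov v δ z t - v z t = δ⁻¹ * ∫ y in z..(z + δ), (v y t - v z t) := by
    rw [intervalIntegral.integral_sub (hc.intervalIntegrable _ _) intervalIntegrable_const,
      steklov, intervalIntegral.integral_const, smul_eq_mul]
    field_simp
    ring
  have h2 : ‖∫ y in z..(z + δ), (v y t - v z t)‖ ≤ √(C * δ) * |z + δ - z| := by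
    apply intervalIntegral.norm_integral_le_of_norm_le_const
    intro y hy
    rw [uIoc_of_le (by linarith)] at hy
    exact h.abs_sub_le ht (by rw [abs_of_pos (by linarith [hy.1])]; linarith [hy.2])
  rw [add_sub_cancel_left, abs_of_pos hδ, Real.norm_eq_abs] at h2
  rw [h1, abs_mul, abs_of_pos (inv_pos.2 hδ), inv_mul_le_iff₀ hδ]
  linarith

/-- Steklov averages, lowered by twice their error bound, lie strictly below v. The ratio 1/4 makes
the bands [v − 3·4⁻ⁿ, v − 4⁻ⁿ] disjoint, so the fields increase strictly with n. -/
theorem exists_lipschitz_approx (h : IsEnergyFlow v D C) : ∃ w : ℕ → ℝ → ℝ → ℝ,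
    (∀ n, Continuous fun p : ℝ × ℝ => w n p.1 p.2) ∧
    (∀ n, ∃ K : ℝ≥0, ∀ t, 0 ≤ t → LipschitzWith K fun z => w n z t) ∧
    ∀ n z t, 0 ≤ t → v z t - 3 * (1 / 4) ^ n ≤ w n z t ∧ w n z t ≤ v z t - (1 / 4) ^ n := by
  have hC := h.nonneg
  -- Chosen so that √(Cδ) ≤ 4⁻ⁿ; the denominator C + 1 allows C = 0.
  set δ : ℕ → ℝ := fun n => ((1 / 4) ^ n) ^ 2 / (C + 1) with hδ
  have hδ0 : ∀ n, 0 < δ n := fun n => by simp only [hδ]; positivity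
  have hsq : ∀ n, √(C * δ n) ≤ (1 / 4) ^ n := by
    intro n
    apply Real.sqrt_le_iff.2
    refine ⟨by positivity, ?_⟩
    simp only [hδ]
    rw [← mul_div_assoc, div_le_iff₀ (by linarith)]
    nlinarith [sq_nonneg (((1 : ℝ) / 4) ^ n)]
  refine ⟨fun n z t => steklov v (δ n) z t - 2 * (1 / 4) ^ n, fun n => ?_, fun n => ?_, ?_⟩
  · exact (h.continuous_steklov _).sub continuous_const
  · exact ⟨Real.toNNReal ((δ n)⁻¹ * √(C * δ n)) + 0, fun t ht =>
      (h.lipschitzWith_steklov (hδ0 n) ht).sub (LipschitzWith.const (2 * (1 / 4 : ℝ) ^ n))⟩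
  · intro n z t ht
    have := abs_le.1 ((h.abs_steklov_sub_le (hδ0 n) ht z).trans (hsq n))
    constructor <;> linarith [this.1, this.2]

/-- From every point there emanates a leftmost characteristic. -/
theorem exists_leftChar (h : IsEnergyFlow v D C) {S : ℝ} (hS : 0 ≤ S) (η : ℝ) :
    ∃ X, IsIntegralChar v S η X ∧ ∀ S' η' x, S' ≤ S → η ≤ η' → IsIntegralChar v S' η' x →
      ∀ t ∈ Icc 0 S', X t ≤ x t := by
  obtain ⟨w, hwc, hwL, hwv⟩ := h.exists_lipschitz_approx
  have hp : ∀ n : ℕ, (0 : ℝ) < (1 / 4) ^ n := fun n => by positivity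
  have hp1 : ∀ n : ℕ, ((1 : ℝ) / 4) ^ n ≤ 1 := fun n =>
    pow_le_one₀ (by norm_num) (by norm_num)
  have hex : ∀ n, ∃ y, IsIntegralChar (w n) S η y := by
    intro n
    obtain ⟨K, hK⟩ := hwL n
    refine h.exists_isIntegralChar_of_lipschitz hS η (hwc n) hK fun z t ht => ?_
    have := hwv n z t ht
    rw [abs_le]
    constructor <;> linarith [this.1, this.2, hp n, hp1 n]
  choose y hy using hex
  -- An upper barrier: w₀ + 4 ≥ v + 1 exceeds all the approximating fields and still stays within
  -- distance 3 of v.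
  obtain ⟨Y, hY⟩ : ∃ y, IsIntegralChar (fun z t => w 0 z t + 4) S η y := by
    obtain ⟨K, hK⟩ := hwL 0
    refine h.exists_isIntegralChar_of_lipschitz hS η ((hwc 0).add continuous_const) (K := K + 0)
      (fun t ht => (hK t ht).add (LipschitzWith.const 4)) fun z t ht => ?_
    have := hwv 0 z t ht
    rw [abs_le]
    constructor <;> linarith [this.1, this.2, hp 0, hp1 0]
  have hmono : ∀ t ∈ Icc 0 S, Monotone fun n => y n t := by
    intro t ht
    refine monotone_nat_of_le_succ fun n => ?_
    refine IsIntegralChar.le_of_lt (hwc n) (hwc (n + 1)) (fun z t ht => ?_) le_rfl (hy n)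
      (hy (n + 1)) ht
    have h1 := (hwv n z t ht).2
    have h2 := (hwv (n + 1) z t ht).1
    have h3 : ((1 : ℝ) / 4) ^ (n + 1) = (1 / 4) ^ n / 4 := by rw [pow_succ]; ring
    rw [h3] at h2
    linarith [hp n]
  have hYub : ∀ n, ∀ t ∈ Icc 0 S, y n t ≤ Y t := by
    intro n t ht
    refine IsIntegralChar.le_of_lt (hwc n) ((hwc 0).add continuous_const) (fun z t ht => ?_) le_rfl
      (hy n) hY ht
    have h1 := (hwv n z t ht).2
    have h2 := (hwv 0 z t ht).1
    simp only [pow_zero] at h2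
    linarith [hp n]
  have hlim : ∀ t ∈ Icc 0 S, Tendsto (fun n => y n t) atTop (𝓝 (⨆ n, y n t)) := fun t ht =>
    tendsto_atTop_ciSup (hmono t ht) ⟨Y t, by rintro _ ⟨n, rfl⟩; exact hYub n t ht⟩
  obtain ⟨B₁, hB₁⟩ := (isCompact_Icc (a := (0 : ℝ)) (b := S)).exists_bound_of_continuousOn
    (hy 0).1.continuousOn
  obtain ⟨B₂, hB₂⟩ := (isCompact_Icc (a := (0 : ℝ)) (b := S)).exists_bound_of_continuousOn
    hY.1.continuousOn
  -- The increasing limit of the approximate curves is a characteristic. It is leftmost because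
  -- every approximate curve already lies below each characteristic that starts at or to the right
  -- of η.
  have hchar : IsIntegralChar v S η fun t => ⨆ n, y n (max 0 (min t S)) := by
    refine IsIntegralChar.of_tendsto (x := fun t => ⨆ n, y n t) (y := y)
      (g := fun n s => w n (y n s) s) (e := fun n => 3 * (1 / 4) ^ n) (ηs := fun _ => η)
      (B := max B₁ B₂) h.cont hS tendsto_const_nhds ?_ ?_ (fun n t ht => (hy n).2 t ht) ?_ ?_ hlim
    · have := (tendsto_pow_atTop_nhds_zero_of_lt_one (r := (1 : ℝ) / 4) (by norm_num)
        (by norm_num)).const_mul 3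
      simpa using this
    · exact fun n => (hwc n).comp ((hy n).1.prodMk continuous_id)
    · intro n s hs
      have := hwv n (y n s) s hs.1
      rw [abs_le]
      constructor <;> linarith [this.1, this.2, hp n]
    · intro n s hs
      have h1 := abs_le.1 (hB₁ s hs)
      have h2 := abs_le.1 (hB₂ s hs)
      have h3 := hmono s hs (Nat.zero_le n)
      simp only at h3
      rw [abs_le]
      constructor
      · linarith [le_max_left B₁ B₂]
      · linarith [hYub n s hs, le_max_right B₁ B₂]
  refine ⟨_, hchar, fun S' η' x hS' hη hx t ht => ?_⟩
  have ht' : t ∈ Icc 0 S := ⟨ht.1, ht.2.trans hS'⟩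
  simp only [max_min_eq_self ht']
  refine ciSup_le fun n => ?_
  refine IsIntegralChar.le_of_lt (hwc n) h.cont (fun z t ht => ?_) hη ((hy n).mono hS') hx ht
  linarith [(hwv n z t ht).2, hp n]

end IsEnergyFlow
end HunterSaxton

/-! ### The flow of leftmost characteristics. -/

namespace HunterSaxton

/-- Lipschitz curves are absolutely continuous, so the equation valid for a.e. t integrates.
Clamping time to [0,S] makes the curve globally continuous. -/
theorem IsCharacteristic.isIntegralChar {u v : ℝ → ℝ → ℝ} (hvu : ∀ x t, 0 ≤ t → v x t = u x t)
    {S ζ : ℝ} (hS : 0 ≤ S) {x : ℝ → ℝ} (hx : IsCharacteristic u S ζ x) :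
    IsIntegralChar v S ζ fun t => x (max 0 (min t S)) := by
  obtain ⟨⟨K, hK⟩, hd, h0⟩ := hx
  refine isIntegralChar_clamp hS hK.continuousOn fun t ht => ?_
  have hac : AbsolutelyContinuousOnInterval x 0 t := by
    apply LipschitzOnWith.absolutelyContinuousOnInterval (K := K)
    rw [uIcc_of_le ht.1]
    exact hK.mono (Icc_subset_Icc le_rfl ht.2)
  have h1 : ∫ s in (0 : ℝ)..t, v (x s) s = ∫ s in (0 : ℝ)..t, deriv x s := by
    apply intervalIntegral.integral_congr_ae
    rw [ae_restrict_iff' measurableSet_Icc] at hd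
    filter_upwards [hd] with s hs hst
    rw [uIoc_of_le ht.1] at hst
    rw [(hs ⟨hst.1.le, hst.2.trans ht.2⟩).deriv, hvu _ _ hst.1.le]
  rw [h1, hac.integral_deriv_eq_sub, h0]
  ring

theorem IsCharacteristic.mono {u : ℝ → ℝ → ℝ} {S ζ : ℝ} {x : ℝ → ℝ}
    (hx : IsCharacteristic u S ζ x) {S' : ℝ} (hS : S' ≤ S) : IsCharacteristic u S' ζ x := by
  obtain ⟨⟨K, hK⟩, hd, h0⟩ := hx
  have hsub : Icc 0 S' ⊆ Icc 0 S := Icc_subset_Icc le_rfl hS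
  exact ⟨⟨K, hK.mono hsub⟩, ae_mono (Measure.restrict_mono hsub le_rfl) hd, h0⟩

theorem IsIntegralChar.isCharacteristic {u v : ℝ → ℝ → ℝ}
    (hv : Continuous fun p : ℝ × ℝ => v p.1 p.2) (hvu : ∀ x t, 0 ≤ t → v x t = u x t)
    {S ζ : ℝ} (hS : 0 ≤ S) {x : ℝ → ℝ} (hx : IsIntegralChar v S ζ x) :
    IsCharacteristic u S ζ x := by
  have hvx : Continuous fun s => v (x s) s := hv.comp (hx.1.prodMk continuous_id)
  refine ⟨?_, ?_, hx.apply_zero hS⟩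
  · obtain ⟨M, hM⟩ := (isCompact_Icc (a := (0 : ℝ)) (b := S)).exists_bound_of_continuousOn
      hvx.continuousOn
    refine ⟨Real.toNNReal M, ?_⟩
    have h1 := (convex_Icc (0 : ℝ) S).lipschitzOnWith_of_nnnorm_hasDerivWithin_le
      (C := Real.toNNReal M)
      (fun t _ => (IsIntegralChar.hasDerivAt_primitive hv hx t).hasDerivWithinAt)
      (fun t ht => by
        rw [← NNReal.coe_le_coe, coe_nnnorm]
        exact (hM t ht).trans (Real.le_coe_toNNReal M))
    intro s hs t ht
    rw [hx.2 s hs, hx.2 t ht]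
    exact h1 hs ht
  · rw [ae_restrict_iff' measurableSet_Icc]
    have h1 : ∀ᵐ t : ℝ, t ≠ 0 := by simp [ae_iff]
    have h2 : ∀ᵐ t : ℝ, t ≠ S := by simp [ae_iff]
    filter_upwards [h1, h2] with t h0 hS' ht
    have := hx.hasDerivAt hv (t := t) ⟨lt_of_le_of_ne ht.1 (Ne.symm h0), lt_of_le_of_ne ht.2 hS'⟩
    rwa [hvu _ _ ht.1] at this

/-- `X η` is the leftmost characteristic from `η` on `[0, S]`, extended by constants. -/
structure IsLeftFlow (v : ℝ → ℝ → ℝ) (S : ℝ) (X : ℝ → ℝ → ℝ) : Prop where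
  nonneg : 0 ≤ S
  char : ∀ η, IsIntegralChar v S η (X η)
  clamp : ∀ η t, X η (max 0 (min t S)) = X η t
  least : ∀ η S' η' x, S' ≤ S → η ≤ η' → IsIntegralChar v S' η' x → ∀ t ∈ Icc 0 S', X η t ≤ x t

theorem IsEnergyFlow.exists_leftFlow {v D : ℝ → ℝ → ℝ} {C : ℝ} (h : IsEnergyFlow v D C) {S : ℝ}
    (hS : 0 ≤ S) : ∃ X, IsLeftFlow v S X := by
  choose X hX hX' using fun η => h.exists_leftChar hS η
  refine ⟨fun η t => X η (max 0 (min t S)), hS, fun η => ?_, fun η t => ?_, ?_⟩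
  · exact isIntegralChar_clamp hS (hX η).1.continuousOn (hX η).2
  · simp only [max_min_eq_self (max_min_mem_Icc hS t)]
  · intro η S' η' x hS' hη hx t ht
    simp only [max_min_eq_self ⟨ht.1, ht.2.trans hS'⟩]
    exact hX' η S' η' x hS' hη hx t ht

namespace IsLeftFlow

variable {v X : ℝ → ℝ → ℝ} {S : ℝ}

theorem continuous (hX : IsLeftFlow v S X) (η : ℝ) : Continuous (X η) := (hX.char η).1

theorem apply_zero (hX : IsLeftFlow v S X) (η : ℝ) : X η 0 = η := (hX.char η).apply_zero hX.nonneg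

theorem monotone (hX : IsLeftFlow v S X) (t : ℝ) : Monotone fun η => X η t := by
  intro η η' hη
  simp only
  rw [← hX.clamp η, ← hX.clamp η']
  exact hX.least η S η' _ le_rfl hη (hX.char η') _ (max_min_mem_Icc hX.nonneg t)

/-- The infimum at time t runs over characteristics known only up to t; they are covered because
`least` compares with curves on any shorter interval. It is attained by X(η,·). -/
theorem leftmost_eq {u : ℝ → ℝ → ℝ} (hX : IsLeftFlow v S X)
    (hv : Continuous fun p : ℝ × ℝ => v p.1 p.2) (hvu : ∀ x t, 0 ≤ t → v x t = u x t) (η : ℝ) {t : ℝ}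
    (ht : t ∈ Icc 0 S) : leftmost u η t = X η t := by
  refine IsLeast.csInf_eq ⟨⟨X η, ?_, rfl⟩, ?_⟩
  · exact ((hX.char η).isCharacteristic hv hvu hX.nonneg).mono ht.2
  · rintro z ⟨x, hx, rfl⟩
    have h1 := hX.least η t η _ ht.2 le_rfl (hx.isIntegralChar hvu ht.1) t ⟨ht.1, le_rfl⟩
    simpa [max_eq_right ht.1] using h1

/-- The limit of X(η',·) as η' increases to η is again a characteristic from η. It lies below X(η,·)
by monotonicity and above it by minimality. -/
theorem tendsto_left (hX : IsLeftFlow v S X) (hv : Continuous fun p : ℝ × ℝ => v p.1 p.2)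
    (η t : ℝ) : Tendsto (fun η' => X η' t) (𝓝[<] η) (𝓝 (X η t)) := by
  set a : ℕ → ℝ := fun n => η - 1 / ((n : ℝ) + 1) with ha
  have ha_lt : ∀ n, a n < η := fun n => by
    simp only [ha]; linarith [Nat.one_div_pos_of_nat (α := ℝ) (n := n)]
  have ha_lim : Tendsto a atTop (𝓝 η) := by
    have := tendsto_one_div_add_atTop_nhds_zero_nat (𝕜 := ℝ)
    simpa [ha] using this.const_sub η
  have ha_lim' : Tendsto a atTop (𝓝[<] η) :=
    tendsto_nhdsWithin_iff.2 ⟨ha_lim, Eventually.of_forall ha_lt⟩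
  set x : ℝ → ℝ := fun s => sSup ((fun η' => X η' s) '' Iio η) with hx
  have hlim : ∀ s, Tendsto (fun η' => X η' s) (𝓝[<] η) (𝓝 (x s)) := fun s =>
    (hX.monotone s).tendsto_nhdsLT η
  have hle : ∀ s, x s ≤ X η s := fun s =>
    le_of_tendsto ((hlim s).comp ha_lim') (Eventually.of_forall fun n =>
      hX.monotone s (ha_lt n).le)
  obtain ⟨B₁, hB₁⟩ := (isCompact_Icc (a := (0 : ℝ)) (b := S)).exists_bound_of_continuousOn
    (hX.continuous (η - 1)).continuousOn
  obtain ⟨B₂, hB₂⟩ := (isCompact_Icc (a := (0 : ℝ)) (b := S)).exists_bound_of_continuousOn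
    (hX.continuous η).continuousOn
  have hchar : IsIntegralChar v S η fun s => x (max 0 (min s S)) := by
    refine IsIntegralChar.of_tendsto (y := fun n => X (a n)) (g := fun n s => v (X (a n) s) s)
      (e := fun _ => 0) (ηs := a) (B := max B₁ B₂) hv hX.nonneg ha_lim tendsto_const_nhds ?_
      (fun n t ht => (hX.char (a n)).2 t ht) (by simp) ?_ (fun s _ => (hlim s).comp ha_lim')
    · exact fun n => hv.comp ((hX.continuous _).prodMk continuous_id)
    · intro n s hs
      have h1 := abs_le.1 (hB₁ s hs)
      have h2 := abs_le.1 (hB₂ s hs)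
      have h3 : X (η - 1) s ≤ X (a n) s := hX.monotone s (by
        simp only [ha]
        have : 1 / ((n : ℝ) + 1) ≤ 1 := by
          rw [div_le_one (by positivity)]; linarith [n.cast_nonneg (α := ℝ)]
        linarith)
      have h4 : X (a n) s ≤ X η s := hX.monotone s (ha_lt n).le
      rw [abs_le]
      constructor
      · linarith [le_max_left B₁ B₂]
      · linarith [le_max_right B₁ B₂]
  have heq : x t = X η t := by
    refine le_antisymm (hle t) ?_
    have hm := max_min_mem_Icc hX.nonneg t
    have h1 := hX.least η S η _ le_rfl le_rfl hchar _ hm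
    simp only [max_min_eq_self hm, hX.clamp] at h1
    have h2 : x (max 0 (min t S)) = x t := by simp only [hx, hX.clamp]
    rwa [h2] at h1
  rw [← heq]
  exact hlim t

/-- Monotonicity and left continuity in η reduce superlevel sets to countable unions over rational
starting points. -/
theorem measurable (hX : IsLeftFlow v S X) (hv : Continuous fun p : ℝ × ℝ => v p.1 p.2) :
    Measurable fun p : ℝ × ℝ => X p.1 p.2 := by
  refine measurable_of_Ioi fun c => ?_
  have h1 : (fun p : ℝ × ℝ => X p.1 p.2) ⁻¹' Ioi c
      = ⋃ q : ℚ, {p : ℝ × ℝ | (q : ℝ) ≤ p.1} ∩ {p | c < X q p.2} := by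
    ext p
    simp only [mem_preimage, mem_Ioi, mem_iUnion, mem_inter_iff, mem_ofPred_eq]
    constructor
    · intro hp
      have h2 := (hX.tendsto_left hv p.1 p.2).eventually_const_lt hp
      obtain ⟨a, ha, haI⟩ := mem_nhdsLT_iff_exists_Ioo_subset.1 h2
      obtain ⟨q, hq1, hq2⟩ := exists_rat_btwn (mem_Iio.1 ha)
      exact ⟨q, hq2.le, haI ⟨hq1, hq2⟩⟩
    · rintro ⟨q, hq, hc⟩
      exact hc.trans_le (hX.monotone p.2 hq)
  rw [h1]
  refine MeasurableSet.iUnion fun q => ?_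
  exact (measurableSet_le measurable_const measurable_fst).inter
    (measurableSet_lt measurable_const ((hX.continuous q).measurable.comp measurable_snd))

end IsLeftFlow
end HunterSaxton

/-! ### Separation of neighbouring characteristics. -/

namespace HunterSaxton

/-- A quadratic in l with nonpositive discriminant, by V² ≤ HE. -/
theorem add_sq_mul_sub_nonneg {H V E l : ℝ} (hH : 0 ≤ H) (hE : 0 ≤ E) (hV : V ^ 2 ≤ H * E) :
    0 ≤ E + l ^ 2 * H - 2 * (l * V) := by
  rcases hH.eq_or_lt with rfl | hH
  · have : V = 0 := by nlinarith [sq_nonneg V]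
    subst this; simpa using hE
  · have h1 : 0 ≤ H * (E + l ^ 2 * H - 2 * (l * V)) := by nlinarith [sq_nonneg (V - l * H)]
    exact nonneg_of_mul_nonneg_right h1 hH

/-- If `H'' ≥ (H')² / (2 H)`, then `H` lies above the square of the tangent line of `√H`. -/
theorem mul_sq_le_of_sq_deriv_le {H V E : ℝ → ℝ} {S ε V₀ : ℝ} (hε : 0 < ε)
    (hH : ContinuousOn H (Icc 0 S)) (hHd : ∀ t ∈ Ioo 0 S, HasDerivAt H (V t) t) (hH0 : H 0 = ε)
    (hHn : ∀ t ∈ Icc 0 S, 0 ≤ H t) (hVc : Continuous V)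
    (hV : ∀ t ∈ Icc 0 S, V t = V₀ + 1 / 2 * ∫ s in (0 : ℝ)..t, E s)
    (hEi : ∀ t, IntervalIntegrable E volume 0 t)
    (hE : ∀ᵐ s : ℝ, s ∈ Icc 0 S → 0 ≤ E s ∧ V s ^ 2 ≤ H s * E s)
    (hS : 0 < 1 + V₀ / ε * S / 2) {t : ℝ} (ht : t ∈ Icc 0 S) :
    ε * (1 + V₀ / ε * t / 2) ^ 2 ≤ H t := by
  set p := V₀ / ε with hp
  set a : ℝ → ℝ := fun t => 1 + p * t / 2 with ha
  have hapos : ∀ t ∈ Icc 0 S, 0 < a t := by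
    intro t ht
    simp only [ha]
    rcases le_total 0 p with h0 | h0
    · have := mul_nonneg h0 ht.1; linarith
    · have : p * S ≤ p * t := mul_le_mul_of_nonpos_left ht.2 h0
      linarith
  have had : ∀ t, HasDerivAt a (p / 2) t := by
    intro t
    have := (((hasDerivAt_id t).const_mul p).div_const 2).const_add 1
    simpa [ha] using this
  have hac : Continuous a := continuous_iff_continuousAt.2 fun t => (had t).continuousAt
  -- The logarithmic derivative of the comparison solution εa², for which equality holds; it
  -- satisfies l' = −l²/2.
  set l : ℝ → ℝ := fun t => p / a t with hl
  have hlc : ContinuousOn l (Icc 0 S) :=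
    continuousOn_const.div hac.continuousOn fun t ht => (hapos t ht).ne'
  -- V − lH starts at 0, and its derivative is half of E + l²H − 2lV, which is nonnegative.
  have hVl : ∀ t ∈ Icc 0 S, l t * H t ≤ V t := by
    intro t ht
    have hsub : Icc 0 t ⊆ Icc 0 S := Icc_subset_Icc le_rfl ht.2
    have hld : ∀ s ∈ Ioo 0 t, HasDerivAt (fun s => l s * H s)
        (l s * V s - l s ^ 2 * H s / 2) s := by
      intro s hs
      have hs' : s ∈ Icc 0 S := hsub (Ioo_subset_Icc_self hs)
      have h1 := ((hasDerivAt_const s p).div (had s) (hapos s hs').ne').mul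
        (hHd s ⟨hs.1, hs.2.trans_le ht.2⟩)
      refine h1.congr_deriv ?_
      have := (hapos s hs').ne'
      simp only [hl, Pi.div_apply]
      field_simp
      ring
    have hint : IntervalIntegrable (fun s => l s * V s - l s ^ 2 * H s / 2) volume 0 t := by
      apply ContinuousOn.intervalIntegrable
      rw [uIcc_of_le ht.1]
      have h1 := hlc.mono hsub
      have h2 := hH.mono hsub
      fun_prop
    have h1 := intervalIntegral.integral_eq_sub_of_hasDerivAt_of_le ht.1
      ((hlc.mono hsub).mul (hH.mono hsub)) hld hint
    have h2 : 0 ≤ ∫ s in (0 : ℝ)..t, (1 / 2 * E s - (l s * V s - l s ^ 2 * H s / 2)) := by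
      apply intervalIntegral.integral_nonneg_of_ae_restrict ht.1
      filter_upwards [ae_restrict_of_ae hE, ae_restrict_mem measurableSet_Icc] with s hs hst
      have h3 := hs (hsub hst)
      have := add_sq_mul_sub_nonneg (l := l s) (hHn s (hsub hst)) h3.1 h3.2
      simp only [Pi.zero_apply]
      linarith
    rw [intervalIntegral.integral_sub ((hEi t).const_mul _) hint,
      intervalIntegral.integral_const_mul, h1] at h2
    have h3 : l 0 * H 0 = V₀ := by
      simp only [hl, ha, hH0, hp]; field_simp; ring
    simp only [Pi.mul_apply] at h2
    rw [h3] at h2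
    rw [hV t ht]
    linarith
  -- The derivative of H/a² is (V − lH)/a².
  have hmono : MonotoneOn (fun t => H t / a t ^ 2) (Icc 0 S) := by
    have hd : ∀ t ∈ Ioo 0 S, HasDerivAt (fun t => H t / a t ^ 2)
        ((V t * a t ^ 2 - H t * (2 * a t * (p / 2))) / (a t ^ 2) ^ 2) t := by
      intro t ht
      have := (hHd t ht).fun_div ((had t).fun_pow 2)
        (pow_ne_zero 2 (hapos t (Ioo_subset_Icc_self ht)).ne')
      simpa using this
    apply monotoneOn_of_deriv_nonneg (convex_Icc 0 S)
    · exact hH.div (hac.pow 2).continuousOn fun t ht => pow_ne_zero 2 (hapos t ht).ne'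
    · rw [interior_Icc]
      exact fun t ht => (hd t ht).differentiableAt.differentiableWithinAt
    · rw [interior_Icc]
      intro t ht
      rw [(hd t ht).deriv]
      have h0 := hapos t (Ioo_subset_Icc_self ht)
      have h1 := hVl t (Ioo_subset_Icc_self ht)
      apply div_nonneg _ (by positivity)
      have h2 : l t * a t = p := by simp only [hl]; field_simp
      have h3 : V t * a t ^ 2 - H t * (2 * a t * (p / 2)) = a t ^ 2 * (V t - l t * H t) := by
        rw [← h2]; ring
      rw [h3]
      exact mul_nonneg (by positivity) (by linarith)
  have h0 := hmono ⟨le_rfl, ht.1.trans ht.2⟩ ht ht.1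
  simp only [hH0] at h0
  have ha0 : a 0 = 1 := by simp [ha]
  rw [ha0, le_div_iff₀ (pow_pos (hapos t ht) 2)] at h0
  simpa using h0

/-- Energy between the leftmost characteristics from `η` and `η'`. -/
noncomputable def energyBetween (D X : ℝ → ℝ → ℝ) (η η' s : ℝ) : ℝ :=
  cumulEnergy D (X η' s) s - cumulEnergy D (X η s) s

/-- Total energy in `[0, S]` to the left of the leftmost characteristic from `η`. -/
noncomputable def totalEnergy (D X : ℝ → ℝ → ℝ) (S η : ℝ) : ℝ :=
  ∫ s in (0 : ℝ)..S, cumulEnergy D (X η s) s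

namespace IsLeftFlow

variable {v D X : ℝ → ℝ → ℝ} {C S : ℝ}

theorem measurable_cumulEnergy (hX : IsLeftFlow v S X) (h : IsEnergyFlow v D C) (η : ℝ) :
    Measurable fun s => cumulEnergy D (X η s) s :=
  h.measurable_cumulEnergy.comp ((hX.continuous η).measurable.prodMk measurable_id)

theorem intervalIntegrable_cumulEnergy (hX : IsLeftFlow v S X) (h : IsEnergyFlow v D C)
    (η a b : ℝ) : IntervalIntegrable (fun s => cumulEnergy D (X η s) s) volume a b := by
  refine (intervalIntegrable_const (c := C)).mono_fun
    (hX.measurable_cumulEnergy h η).aestronglyMeasurable (Eventually.of_forall fun s => ?_)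
  exact (h.abs_cumulEnergy_le _ _).trans (le_abs_self _)

theorem intervalIntegrable_energyBetween (hX : IsLeftFlow v S X) (h : IsEnergyFlow v D C)
    (η η' a b : ℝ) : IntervalIntegrable (energyBetween D X η η') volume a b :=
  (hX.intervalIntegrable_cumulEnergy h η' a b).sub (hX.intervalIntegrable_cumulEnergy h η a b)

theorem energyBetween_nonneg (hX : IsLeftFlow v S X) (h : IsEnergyFlow v D C) {η η' : ℝ}
    (hη : η ≤ η') (s : ℝ) : 0 ≤ energyBetween D X η η' s :=
  sub_nonneg.2 (h.cumulEnergy_mono s (hX.monotone s hη))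

theorem energyBetween_eq (h : IsEnergyFlow v D C) (η η' s : ℝ) :
    energyBetween D X η η' s = ∫ y in (X η s)..(X η' s), D y s ^ 2 :=
  h.cumulEnergy_sub _ _ _

theorem continuous_velocity (hX : IsLeftFlow v S X) (h : IsEnergyFlow v D C) (η : ℝ) :
    Continuous fun t => v (X η t) t := h.continuous_comp (hX.continuous η) continuous_id

theorem velocity_sub (hX : IsLeftFlow v S X) (h : IsEnergyFlow v D C) (η η' : ℝ) {t : ℝ}
    (ht : t ∈ Icc 0 S) : v (X η' t) t - v (X η t) t
      = (v η' 0 - v η 0) + 1 / 2 * ∫ s in (0 : ℝ)..t, energyBetween D X η η' s := by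
  have h1 := h.momentum (hX.char η) ht
  have h2 := h.momentum (hX.char η') ht
  simp only [energyBetween]
  rw [intervalIntegral.integral_sub (hX.intervalIntegrable_cumulEnergy h _ _ _)
    (hX.intervalIntegrable_cumulEnergy h _ _ _)]
  linarith

theorem integral_energyBetween (hX : IsLeftFlow v S X) (h : IsEnergyFlow v D C) (η η' : ℝ) :
    ∫ s in (0 : ℝ)..S, energyBetween D X η η' s = totalEnergy D X S η' - totalEnergy D X S η :=
  intervalIntegral.integral_sub (hX.intervalIntegrable_cumulEnergy h _ _ _)
    (hX.intervalIntegrable_cumulEnergy h _ _ _)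

theorem integral_energyBetween_le (hX : IsLeftFlow v S X) (h : IsEnergyFlow v D C) {η η' : ℝ}
    (hη : η ≤ η') {t : ℝ} (ht : t ∈ Icc 0 S) : ∫ s in (0 : ℝ)..t, energyBetween D X η η' s
      ≤ totalEnergy D X S η' - totalEnergy D X S η := by
  rw [← hX.integral_energyBetween h]
  exact intervalIntegral.integral_mono_interval le_rfl ht.1 ht.2
    (Eventually.of_forall fun s => hX.energyBetween_nonneg h hη s)
    (hX.intervalIntegrable_energyBetween h _ _ _ _)

/-- Monotonicity is what gives differentiability at almost every starting point. -/
theorem totalEnergy_mono (hX : IsLeftFlow v S X) (h : IsEnergyFlow v D C) :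
    Monotone (totalEnergy D X S) := by
  intro η η' hη
  have h1 := hX.integral_energyBetween_le h hη ⟨le_rfl, hX.nonneg⟩
  simp only [intervalIntegral.integral_same] at h1
  linarith

theorem velocity_sub_le (hX : IsLeftFlow v S X) (h : IsEnergyFlow v D C) {η η' : ℝ}
    (hη : η ≤ η') {t : ℝ} (ht : t ∈ Icc 0 S) : v (X η' t) t - v (X η t) t
      ≤ (v η' 0 - v η 0) + 1 / 2 * (totalEnergy D X S η' - totalEnergy D X S η) := by
  rw [hX.velocity_sub h η η' ht]
  linarith [hX.integral_energyBetween_le h hη ht]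

theorem le_velocity_sub (hX : IsLeftFlow v S X) (h : IsEnergyFlow v D C) {η η' : ℝ}
    (hη : η ≤ η') {t : ℝ} (ht : t ∈ Icc 0 S) :
    v η' 0 - v η 0 ≤ v (X η' t) t - v (X η t) t := by
  rw [hX.velocity_sub h η η' ht]
  have : 0 ≤ ∫ s in (0 : ℝ)..t, energyBetween D X η η' s :=
    intervalIntegral.integral_nonneg ht.1 fun s _ => hX.energyBetween_nonneg h hη s
  linarith

theorem gap_eq (hX : IsLeftFlow v S X) (h : IsEnergyFlow v D C) (η η' : ℝ) {t : ℝ}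
    (ht : t ∈ Icc 0 S) : X η' t - X η t
      = (η' - η) + ∫ s in (0 : ℝ)..t, (v (X η' s) s - v (X η s) s) := by
  rw [(hX.char η').2 t ht, (hX.char η).2 t ht, intervalIntegral.integral_sub
    ((hX.continuous_velocity h _).intervalIntegrable _ _)
    ((hX.continuous_velocity h _).intervalIntegrable _ _)]
  ring

theorem gap_le (hX : IsLeftFlow v S X) (h : IsEnergyFlow v D C) {η η' : ℝ}
    (hη : η ≤ η') (t : ℝ) : X η' t - X η t ≤ (η' - η) + S * (|v η' 0 - v η 0|
      + 1 / 2 * (totalEnergy D X S η' - totalEnergy D X S η)) := by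
  rw [← hX.clamp η, ← hX.clamp η']
  set t' := max 0 (min t S)
  have ht : t' ∈ Icc 0 S := max_min_mem_Icc hX.nonneg t
  rw [hX.gap_eq h η η' ht]
  set M := |v η' 0 - v η 0| + 1 / 2 * (totalEnergy D X S η' - totalEnergy D X S η)
  have hM : 0 ≤ M := by
    have := hX.totalEnergy_mono h hη
    have := abs_nonneg (v η' 0 - v η 0)
    simp only [M]; linarith
  have h1 : ∫ s in (0 : ℝ)..t', (v (X η' s) s - v (X η s) s) ≤ ∫ s in (0 : ℝ)..t', M := by
    apply intervalIntegral.integral_mono_on ht.1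
      (((hX.continuous_velocity h _).sub (hX.continuous_velocity h _)).intervalIntegrable _ _)
      intervalIntegrable_const
    intro s hs
    exact (hX.velocity_sub_le h hη ⟨hs.1, hs.2.trans ht.2⟩).trans
      (add_le_add (le_abs_self _) le_rfl)
  rw [intervalIntegral.integral_const, smul_eq_mul, sub_zero] at h1
  have := mul_le_mul_of_nonneg_right ht.2 hM
  linarith

theorem sq_velocity_sub_le (hX : IsLeftFlow v S X) (h : IsEnergyFlow v D C) {η η' : ℝ}
    (hη : η ≤ η') : ∀ᵐ s : ℝ, 0 ≤ s → (v (X η' s) s - v (X η s) s) ^ 2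
      ≤ (X η' s - X η s) * energyBetween D X η η' s := by
  filter_upwards [h.sq_sub_le] with s hs h0
  rw [energyBetween_eq h]
  exact hs h0 _ _ (hX.monotone s hη)

theorem hasDerivAt_gap (hX : IsLeftFlow v S X) (h : IsEnergyFlow v D C) (η η' : ℝ) {t : ℝ}
    (ht : t ∈ Ioo 0 S) :
    HasDerivAt (fun t => X η' t - X η t) (v (X η' t) t - v (X η t) t) t :=
  ((hX.char η').hasDerivAt h.cont ht).sub ((hX.char η).hasDerivAt h.cont ht)

/-- Neighbouring characteristics do not meet before the blow-up time of the comparison Riccati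
equation. -/
theorem le_gap (hX : IsLeftFlow v S X) (h : IsEnergyFlow v D C) {η η' : ℝ} (hη : η < η')
    (hS : 0 < 1 + (v η' 0 - v η 0) / (η' - η) * S / 2) {t : ℝ} (ht : t ∈ Icc 0 S) :
    (η' - η) * (1 + (v η' 0 - v η 0) / (η' - η) * t / 2) ^ 2 ≤ X η' t - X η t := by
  refine mul_sq_le_of_sq_deriv_le (H := fun t => X η' t - X η t)
    (V := fun t => v (X η' t) t - v (X η t) t) (E := energyBetween D X η η') (sub_pos.2 hη)
    ((hX.continuous _).sub (hX.continuous _)).continuousOn (fun t ht => hX.hasDerivAt_gap h η η' ht)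
    (by simp [hX.apply_zero]) (fun t _ => sub_nonneg.2 (hX.monotone t hη.le))
    ((hX.continuous_velocity h _).sub (hX.continuous_velocity h _))
    (fun t ht => hX.velocity_sub h η η' ht)
    (fun t => hX.intervalIntegrable_energyBetween h _ _ _ _) ?_ hS ht
  filter_upwards [hX.sq_velocity_sub_le h hη.le] with s hs hsS
  exact ⟨hX.energyBetween_nonneg h hη.le s, hs hsS.1⟩

end IsLeftFlow
end HunterSaxton

/-! ### Null images and the generalised inverse of the flow. -/

namespace HunterSaxton

/-- `f` has finite derivates at `x`. -/
def HasBoundedSlopesAt (f : ℝ → ℝ) (x : ℝ) : Prop :=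
  ∃ L : ℝ, ∀ᶠ y in 𝓝 x, |f y - f x| ≤ L * |y - x|

theorem HasBoundedSlopesAt.continuousAt {f : ℝ → ℝ} {x : ℝ} (h : HasBoundedSlopesAt f x) :
    ContinuousAt f x := by
  obtain ⟨L, hL⟩ := h
  have h1 : Tendsto (fun y => L * |y - x|) (𝓝 x) (𝓝 0) := by
    have : Continuous fun y => L * |y - x| := by fun_prop
    simpa using this.tendsto x
  have h2 : Tendsto (fun y => f y - f x) (𝓝 x) (𝓝 0) := squeeze_zero_norm' hL h1
  have h3 : Tendsto f (𝓝 x) (𝓝 (f x)) := by simpa using h2.add_const (f x)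
  exact h3

theorem hasBoundedSlopesAt_of_differentiableAt {f : ℝ → ℝ} {x : ℝ} (h : DifferentiableAt ℝ f x) :
    HasBoundedSlopesAt f x := by
  obtain ⟨L, hL⟩ := h.isBigO_sub.bound
  exact ⟨L, hL⟩

/-- The image of a null set on which a function has finite derivates is a null set. -/
theorem volume_image_eq_zero_of_hasBoundedSlopesAt {f : ℝ → ℝ} {s : Set ℝ} (hs : volume s = 0)
    (hf : ∀ x ∈ s, HasBoundedSlopesAt f x) : volume (f '' s) = 0 := by
  -- On each piece the slope bound n holds at scale 1/(n+1), and the floor condition confines the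
  -- piece to a cell of that length. Hence f is n-Lipschitz there and maps it to a null set.
  set A : ℕ → ℤ → Set ℝ := fun n k => {x ∈ s | (∀ y, |y - x| ≤ 1 / ((n : ℝ) + 1) →
    |f y - f x| ≤ n * |y - x|) ∧ ⌊x * ((n : ℝ) + 1)⌋ = k} with hA
  have hcov : s ⊆ ⋃ n, ⋃ k, A n k := by
    intro x hx
    obtain ⟨L, hL⟩ := hf x hx
    obtain ⟨r, hr, hL⟩ := Metric.eventually_nhds_iff.1 hL
    obtain ⟨n, hn⟩ := exists_nat_gt (max L (1 / r))
    simp only [mem_iUnion]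
    refine ⟨n, _, hx, fun y hy => ?_, rfl⟩
    have hn0 : (0 : ℝ) < n := (one_div_pos.2 hr).trans ((le_max_right _ _).trans_lt hn)
    have h1 : 1 / ((n : ℝ) + 1) < r := by
      rw [div_lt_iff₀ (by positivity)]
      have h2 := (le_max_right L (1 / r)).trans_lt hn
      rw [div_lt_iff₀ hr] at h2
      nlinarith
    have h2 : |f y - f x| ≤ L * |y - x| := hL (by rw [Real.dist_eq]; linarith)
    exact h2.trans (mul_le_mul_of_nonneg_right ((le_max_left _ _).trans hn.le) (abs_nonneg _))
  have hpiece : ∀ n k, volume (f '' A n k) = 0 := by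
    intro n k
    have hlip : LipschitzOnWith n f (A n k) := by
      apply LipschitzOnWith.of_dist_le_mul
      intro x hx y hy
      rw [Real.dist_eq, Real.dist_eq]
      refine hy.2.1 x ?_
      have h1 := Int.abs_sub_lt_one_of_floor_eq_floor (hx.2.2.trans hy.2.2.symm)
      rw [← sub_mul, abs_mul, abs_of_pos (by positivity : (0 : ℝ) < (n : ℝ) + 1)] at h1
      rw [le_div_iff₀ (by positivity)]
      exact h1.le
    have h1 := hlip.hausdorffMeasure_image_le (d := 1) zero_le_one
    rw [hausdorffMeasure_real] at h1
    have h2 : volume (A n k) = 0 := measure_mono_null (fun x hx => hx.1) hs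
    rw [h2, mul_zero] at h1
    exact le_antisymm h1 zero_le
  refine measure_mono_null (image_mono hcov) ?_
  rw [image_iUnion]
  refine measure_iUnion_null fun n => ?_
  rw [image_iUnion]
  exact measure_iUnion_null fun k => hpiece n k

/-- The generalised inverse of `X(·,t)`. -/
noncomputable def footpoint (X : ℝ → ℝ → ℝ) (x t : ℝ) : ℝ := sSup {η | X η t < x}

namespace IsLeftFlow

variable {v D X : ℝ → ℝ → ℝ} {C S : ℝ}

/-- The speed along the curve from η grows at most like √|η|, so the displacement is at most K +
|η|/2. Thus X(·,t) tends to ±∞ with η, and the supremum defining `footpoint` is over a nonempty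
bounded set. -/
theorem exists_abs_sub_le (hX : IsLeftFlow v S X) (h : IsEnergyFlow v D C) :
    ∃ K, ∀ η t, |X η t - η| ≤ K + |η| / 2 := by
  have hC := h.nonneg
  have hS := hX.nonneg
  refine ⟨S * (|v 0 0| + C * S / 2) + C * S ^ 2 / 2, fun η t => ?_⟩
  rw [← hX.clamp]
  set t' := max 0 (min t S)
  have ht : t' ∈ Icc 0 S := max_min_mem_Icc hS t
  have h1 : ∀ s ∈ Icc 0 S, |v (X η s) s| ≤ |v 0 0| + √(C * |η|) + C * S / 2 := by
    intro s hs
    have h2 := h.momentum (hX.char η) hs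
    have h3 := h.abs_sub_le le_rfl (x := 0) (y := η) (d := |η|) (by simp)
    have h4 : ‖∫ r in (0 : ℝ)..s, cumulEnergy D (X η r) r‖ ≤ C * |s - 0| :=
      intervalIntegral.norm_integral_le_of_norm_le_const fun r _ => h.abs_cumulEnergy_le _ _
    rw [sub_zero, abs_of_nonneg hs.1, Real.norm_eq_abs] at h4
    have h5 : C * s ≤ C * S := mul_le_mul_of_nonneg_left hs.2 hC
    have h6 := abs_le.1 h3
    have h7 := abs_le.1 h4
    have h8 := le_abs_self (v 0 0)
    have h9 := neg_abs_le (v 0 0)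
    rw [abs_le]
    constructor <;> linarith [h6.1, h6.2, h7.1, h7.2]
  have h2 : X η t' - η = ∫ s in (0 : ℝ)..t', v (X η s) s := by
    rw [(hX.char η).2 t' ht]; ring
  have h3 : ‖∫ s in (0 : ℝ)..t', v (X η s) s‖
      ≤ (|v 0 0| + √(C * |η|) + C * S / 2) * |t' - 0| := by
    apply intervalIntegral.norm_integral_le_of_norm_le_const
    intro s hs
    rw [uIoc_of_le ht.1] at hs
    exact h1 s ⟨hs.1.le, hs.2.trans ht.2⟩
  rw [sub_zero, abs_of_nonneg ht.1, Real.norm_eq_abs, ← h2] at h3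
  -- The inequality between arithmetic and geometric means, for √C·S and √|η|.
  have h4 : √(C * |η|) * S ≤ C * S ^ 2 / 2 + |η| / 2 := by
    have h5 : √(C * |η|) = √C * √|η| := Real.sqrt_mul hC _
    have h6 : (√C * S) ^ 2 = C * S ^ 2 := by rw [mul_pow, Real.sq_sqrt hC]
    have h7 : √|η| ^ 2 = |η| := Real.sq_sqrt (abs_nonneg _)
    rw [h5]
    nlinarith [sq_nonneg (√C * S - √|η|)]
  have h5 : (|v 0 0| + √(C * |η|) + C * S / 2) * t' ≤ (|v 0 0| + √(C * |η|) + C * S / 2) * S :=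
    mul_le_mul_of_nonneg_left ht.2 (by positivity)
  nlinarith

theorem nonempty_lt (hX : IsLeftFlow v S X) (h : IsEnergyFlow v D C) (x t : ℝ) :
    {η | X η t < x}.Nonempty := by
  obtain ⟨K, hK⟩ := hX.exists_abs_sub_le h
  refine ⟨-(2 * (|K| + |x| + 1)), ?_⟩
  have h1 := (abs_le.1 (hK (-(2 * (|K| + |x| + 1))) t)).2
  rw [abs_neg, abs_of_nonneg (by positivity : (0 : ℝ) ≤ 2 * (|K| + |x| + 1))] at h1
  show X _ t < x
  linarith [le_abs_self K, neg_abs_le x]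

theorem bddAbove_lt (hX : IsLeftFlow v S X) (h : IsEnergyFlow v D C) (x t : ℝ) :
    BddAbove {η | X η t < x} := by
  obtain ⟨K, hK⟩ := hX.exists_abs_sub_le h
  refine ⟨2 * (|K| + |x| + 1), fun η (hη : X η t < x) => ?_⟩
  by_contra hlt
  push Not at hlt
  have h0 : 0 ≤ η := by linarith [abs_nonneg K, abs_nonneg x]
  have h1 := (abs_le.1 (hK η t)).1
  rw [abs_of_nonneg h0] at h1
  linarith [le_abs_self K, le_abs_self x]

theorem lt_footpoint_iff (hX : IsLeftFlow v S X) (h : IsEnergyFlow v D C) {x t a : ℝ} :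
    a < footpoint X x t ↔ ∃ η, a < η ∧ X η t < x := by
  rw [footpoint, lt_csSup_iff (hX.bddAbove_lt h x t) (hX.nonempty_lt h x t)]
  exact ⟨fun ⟨η, h1, h2⟩ => ⟨η, h2, h1⟩, fun ⟨η, h1, h2⟩ => ⟨η, h2, h1⟩⟩

theorem measurable_footpoint (hX : IsLeftFlow v S X) (h : IsEnergyFlow v D C) :
    Measurable fun p : ℝ × ℝ => footpoint X p.1 p.2 := by
  refine measurable_of_Ioi fun a => ?_
  have h1 : (fun p : ℝ × ℝ => footpoint X p.1 p.2) ⁻¹' Ioi a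
      = ⋃ q : {q : ℚ // a < q}, {p : ℝ × ℝ | X (q : ℚ) p.2 < p.1} := by
    ext p
    simp only [mem_preimage, mem_Ioi, hX.lt_footpoint_iff h, mem_iUnion]
    constructor
    · rintro ⟨η, hη, hx⟩
      obtain ⟨q, hq1, hq2⟩ := exists_rat_btwn hη
      exact ⟨⟨q, hq1⟩, (hX.monotone p.2 hq2.le).trans_lt hx⟩
    · rintro ⟨q, hq⟩
      exact ⟨_, q.2, hq⟩
  rw [h1]
  refine MeasurableSet.iUnion fun q => ?_
  exact measurableSet_lt ((hX.continuous _).measurable.comp measurable_snd) measurable_fst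

theorem footpoint_mem_Icc (hX : IsLeftFlow v S X) (h : IsEnergyFlow v D C) {x t a b : ℝ}
    (ha : X a t < x) (hb : x ≤ X b t) : footpoint X x t ∈ Icc a b := by
  refine ⟨le_csSup (hX.bddAbove_lt h x t) ha, csSup_le (hX.nonempty_lt h x t) fun η (hη : X η t < x) => ?_⟩
  by_contra hlt
  push Not at hlt
  exact absurd (hX.monotone t hlt.le) (not_le.2 (hη.trans_le hb))

/-- Left continuity, which always holds, gives one inequality; the other can fail only if X(·,t)
jumps over x at its footpoint, and continuity there excludes this. -/
theorem apply_footpoint (hX : IsLeftFlow v S X) (h : IsEnergyFlow v D C) {x t : ℝ}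
    (hc : ContinuousAt (fun η => X η t) (footpoint X x t)) : X (footpoint X x t) t = x := by
  set ζ := footpoint X x t with hζ
  apply le_antisymm
  · refine le_of_tendsto (hX.tendsto_left h.cont ζ t) ?_
    filter_upwards [self_mem_nhdsWithin] with η (hη : η < ζ)
    obtain ⟨η', h1, h2⟩ := (hX.lt_footpoint_iff h).1 hη
    exact ((hX.monotone t h1.le).trans_lt h2).le
  · refine ge_of_tendsto (hc.tendsto.mono_left (nhdsWithin_le_nhds (s := Ioi ζ))) ?_
    filter_upwards [self_mem_nhdsWithin] with η (hη : ζ < η)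
    by_contra hlt
    push Not at hlt
    exact absurd (le_csSup (hX.bddAbove_lt h x t) hlt) (not_le.2 hη)

end IsLeftFlow
end HunterSaxton

/-! ### Transport of the energy to the initial line. -/

namespace HunterSaxton

/-- The energy measure `D² dx dt` on `ℝ × [0, S]`, transported to the initial line along the
leftmost characteristics. -/
noncomputable def footEnergy (D X : ℝ → ℝ → ℝ) (S : ℝ) : Measure ℝ :=
  (((volume : Measure ℝ).prod (volume.restrict (Icc 0 S))).withDensity
    fun p => ENNReal.ofReal (D p.1 p.2 ^ 2)).map fun p => footpoint X p.1 p.2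

/-- The upper right derivative of `X(·,t)` at `ζ` along the sequence `1 / (n + 1)`. -/
noncomputable def upperStretch (X : ℝ → ℝ → ℝ) (ζ t : ℝ) : ℝ≥0∞ :=
  limsup (fun n : ℕ => ENNReal.ofReal ((X (ζ + 1 / ((n : ℝ) + 1)) t - X ζ t) / (1 / ((n : ℝ) + 1))))
    atTop

/-- The energy carried by the characteristic from `ζ` during `[0, S]`, per unit of initial
length. -/
noncomputable def carriedEnergy (D X : ℝ → ℝ → ℝ) (S ζ : ℝ) : ℝ≥0∞ :=
  ∫⁻ t in Icc 0 S, upperStretch X ζ t * ENNReal.ofReal (D (X ζ t) t ^ 2)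

theorem tendsto_one_div_add_nhdsGT : Tendsto (fun n : ℕ => 1 / ((n : ℝ) + 1)) atTop (𝓝[>] 0) :=
  tendsto_nhdsWithin_iff.2 ⟨tendsto_one_div_add_atTop_nhds_zero_nat,
    Eventually.of_forall fun _ => mem_Ioi.2 Nat.one_div_pos_of_nat⟩

theorem upperStretch_eq {X : ℝ → ℝ → ℝ} {ζ t f : ℝ}
    (h : Tendsto (fun ε => (X (ζ + ε) t - X ζ t) / ε) (𝓝[>] 0) (𝓝 f)) :
    upperStretch X ζ t = ENNReal.ofReal f :=
  (ENNReal.tendsto_ofReal (h.comp tendsto_one_div_add_nhdsGT)).limsup_eq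

theorem upperStretch_eq_deriv {X : ℝ → ℝ → ℝ} {ζ t : ℝ}
    (h : DifferentiableAt ℝ (fun η => X η t) ζ) :
    upperStretch X ζ t = ENNReal.ofReal (deriv (fun η => X η t) ζ) := by
  apply upperStretch_eq
  have h2 := (hasDerivAt_iff_tendsto_slope_zero.1 h.hasDerivAt).mono_left
    (nhdsWithin_mono (0 : ℝ) (fun y (hy : y ∈ Ioi 0) => ne_of_gt hy))
  refine h2.congr fun ε => ?_
  rw [smul_eq_mul, div_eq_inv_mul]

namespace IsLeftFlow

variable {v D X : ℝ → ℝ → ℝ} {C S : ℝ}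

theorem measurable_upperStretch (hX : IsLeftFlow v S X) (h : IsEnergyFlow v D C) :
    Measurable fun p : ℝ × ℝ => upperStretch X p.1 p.2 := by
  have hm := hX.measurable h.cont
  apply Measurable.limsup
  intro n
  have h1 : Measurable fun p : ℝ × ℝ => X (p.1 + 1 / ((n : ℝ) + 1)) p.2 :=
    hm.comp (by fun_prop : Measurable fun p : ℝ × ℝ => (p.1 + 1 / ((n : ℝ) + 1), p.2))
  exact ((h1.sub hm).div_const _).ennreal_ofReal

theorem measurable_along (hX : IsLeftFlow v S X) (h : IsEnergyFlow v D C) :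
    Measurable fun p : ℝ × ℝ => D (X p.1 p.2) p.2 :=
  h.meas.comp ((hX.measurable h.cont).prodMk measurable_snd)

theorem measurable_carried (hX : IsLeftFlow v S X) (h : IsEnergyFlow v D C) :
    Measurable fun p : ℝ × ℝ => upperStretch X p.1 p.2 * ENNReal.ofReal (D (X p.1 p.2) p.2 ^ 2) :=
  (hX.measurable_upperStretch h).mul ((hX.measurable_along h).pow_const 2).ennreal_ofReal

theorem footEnergy_apply (hX : IsLeftFlow v S X) (h : IsEnergyFlow v D C) {B : Set ℝ}
    (hB : MeasurableSet B) : footEnergy D X S B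
      = ∫⁻ t in Icc 0 S, ∫⁻ x in {x | footpoint X x t ∈ B}, ENNReal.ofReal (D x t ^ 2) := by
  have hZ := hX.measurable_footpoint h
  have hf : Measurable fun p : ℝ × ℝ => ENNReal.ofReal (D p.1 p.2 ^ 2) :=
    (h.meas.pow_const 2).ennreal_ofReal
  rw [footEnergy, Measure.map_apply hZ hB, withDensity_apply _ (hZ hB),
    ← lintegral_indicator (hZ hB), lintegral_prod_symm' _ (hf.indicator (hZ hB))]
  refine lintegral_congr fun t => ?_
  rw [← lintegral_indicator
    (show MeasurableSet {x | footpoint X x t ∈ B} from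
      (hZ.comp (measurable_id.prodMk measurable_const) : Measurable fun x => footpoint X x t) hB)]
  rfl

theorem isFiniteMeasure_footEnergy (hX : IsLeftFlow v S X) (h : IsEnergyFlow v D C) :
    IsFiniteMeasure (footEnergy D X S) := by
  refine ⟨?_⟩
  rw [hX.footEnergy_apply h MeasurableSet.univ]
  have h1 : ∀ t, ∫⁻ x in {x | footpoint X x t ∈ (univ : Set ℝ)}, ENNReal.ofReal (D x t ^ 2)
      ≤ ENNReal.ofReal C := by
    intro t
    refine (setLIntegral_le_lintegral _ _).trans ?_
    rw [← ofReal_integral_eq_lintegral_ofReal (h.integrable t)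
      (Eventually.of_forall fun x => sq_nonneg _)]
    exact ENNReal.ofReal_le_ofReal (h.bound t)
  refine (lintegral_mono h1).trans_lt ?_
  rw [setLIntegral_const]
  exact ENNReal.mul_lt_top ENNReal.ofReal_lt_top (by simp)

/-- At each time, all points of (X(a,t), X(b,t)] have their footpoint in [a,b]. -/
theorem ofReal_totalEnergy_sub_le (hX : IsLeftFlow v S X) (h : IsEnergyFlow v D C) {a b : ℝ}
    (hab : a ≤ b) : ENNReal.ofReal (totalEnergy D X S b - totalEnergy D X S a)
      ≤ footEnergy D X S (Icc a b) := by
  rw [hX.footEnergy_apply h measurableSet_Icc, ← hX.integral_energyBetween h,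
    intervalIntegral.integral_of_le hX.nonneg, ← integral_Icc_eq_integral_Ioc,
    ofReal_integral_eq_lintegral_ofReal
      ((intervalIntegrable_iff_integrableOn_Icc_of_le hX.nonneg).1
        (hX.intervalIntegrable_energyBetween h a b 0 S))
      (Eventually.of_forall fun t => hX.energyBetween_nonneg h hab t)]
  refine lintegral_mono fun t => ?_
  have hle := hX.monotone t hab
  rw [energyBetween_eq h, intervalIntegral.integral_of_le hle,
    ofReal_integral_eq_lintegral_ofReal (h.integrable t).integrableOn
      (Eventually.of_forall fun x => sq_nonneg _)]
  exact lintegral_mono_set fun x hx => hX.footpoint_mem_Icc h hx.1 hx.2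

/-- The region is contained in the image of B. Where X(·,t) is differentiable, the change of
variables for monotone maps applies; the rest of B is null, and finite derivates make its image
null. -/
theorem lintegral_footpoint_le (hX : IsLeftFlow v S X) (h : IsEnergyFlow v D C) {B : Set ℝ}
    (hB : MeasurableSet B) {t : ℝ} (hBt : ∀ ζ ∈ B, HasBoundedSlopesAt (fun η => X η t) ζ) :
    ∫⁻ x in {x | footpoint X x t ∈ B}, ENNReal.ofReal (D x t ^ 2)
      ≤ ∫⁻ ζ in B, upperStretch X ζ t * ENNReal.ofReal (D (X ζ t) t ^ 2) := by
  set Y : ℝ → ℝ := fun η => X η t with hY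
  set N : Set ℝ := {ζ | ¬ DifferentiableAt ℝ Y ζ} with hN
  have hN0 : volume N = 0 := (hX.monotone t).ae_differentiableAt
  have hNm : MeasurableSet N := (measurableSet_of_differentiableAt ℝ Y).compl
  have hsub : {x | footpoint X x t ∈ B} ⊆ Y '' (B \ N) ∪ Y '' (B ∩ N) := by
    intro x hx
    rw [← image_union, sdiff_union_inter]
    exact ⟨_, hx, hX.apply_footpoint h (hBt _ hx).continuousAt⟩
  have hnull : volume (Y '' (B ∩ N)) = 0 :=
    volume_image_eq_zero_of_hasBoundedSlopesAt (measure_mono_null inter_subset_right hN0)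
      fun ζ hζ => hBt ζ hζ.1
  calc ∫⁻ x in {x | footpoint X x t ∈ B}, ENNReal.ofReal (D x t ^ 2)
      ≤ ∫⁻ x in Y '' (B \ N) ∪ Y '' (B ∩ N), ENNReal.ofReal (D x t ^ 2) := lintegral_mono_set hsub
    _ ≤ (∫⁻ x in Y '' (B \ N), ENNReal.ofReal (D x t ^ 2))
        + ∫⁻ x in Y '' (B ∩ N), ENNReal.ofReal (D x t ^ 2) := lintegral_union_le _ _ _
    _ = ∫⁻ x in Y '' (B \ N), ENNReal.ofReal (D x t ^ 2) := by
        rw [setLIntegral_measure_zero _ _ hnull, add_zero]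
    _ = ∫⁻ ζ in B \ N, ENNReal.ofReal (deriv Y ζ) * ENNReal.ofReal (D (Y ζ) t ^ 2) := by
        refine lintegral_image_eq_lintegral_deriv_mul_of_monotoneOn (hB.diff hNm) (fun ζ hζ => ?_)
          ((hX.monotone t).monotoneOn _) _
        exact (not_not.1 hζ.2).hasDerivAt.hasDerivWithinAt
    _ = ∫⁻ ζ in B \ N, upperStretch X ζ t * ENNReal.ofReal (D (X ζ t) t ^ 2) := by
        refine setLIntegral_congr_fun (hB.diff hNm) fun ζ hζ => ?_
        rw [upperStretch_eq_deriv (not_not.1 hζ.2)]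
    _ ≤ _ := lintegral_mono_set sdiff_subset

theorem footEnergy_le (hX : IsLeftFlow v S X) (h : IsEnergyFlow v D C) {B : Set ℝ}
    (hB : MeasurableSet B) (hBt : ∀ ζ ∈ B, ∀ t, HasBoundedSlopesAt (fun η => X η t) ζ) :
    footEnergy D X S B ≤ ∫⁻ ζ in B, carriedEnergy D X S ζ := by
  rw [hX.footEnergy_apply h hB]
  refine (lintegral_mono fun t => hX.lintegral_footpoint_le h hB fun ζ hζ => hBt ζ hζ t).trans ?_
  rw [lintegral_lintegral_swap]
  · rfl
  · exact ((hX.measurable_carried h).comp measurable_swap).aemeasurable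

/-- By `gap_le`, the increments of X(·,t) are controlled by those of η, v(·,0) and the total energy.
None of these involves t, so one null set serves all times. -/
theorem ae_hasBoundedSlopesAt (hX : IsLeftFlow v S X) (h : IsEnergyFlow v D C)
    (hv0 : ∀ᵐ ζ : ℝ, DifferentiableAt ℝ (fun x => v x 0) ζ) :
    ∀ᵐ ζ : ℝ, ∀ t, HasBoundedSlopesAt (fun η => X η t) ζ := by
  filter_upwards [hv0, (hX.totalEnergy_mono h).ae_differentiableAt] with ζ h1 h2 t
  obtain ⟨L₁, hL₁⟩ := hasBoundedSlopesAt_of_differentiableAt h1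
  obtain ⟨L₂, hL₂⟩ := hasBoundedSlopesAt_of_differentiableAt h2
  refine ⟨1 + S * (L₁ + 1 / 2 * L₂), ?_⟩
  filter_upwards [hL₁, hL₂] with y hy1 hy2
  have hS := hX.nonneg
  have key : ∀ a b, a ≤ b → |v b 0 - v a 0| ≤ L₁ * (b - a) →
      totalEnergy D X S b - totalEnergy D X S a ≤ L₂ * (b - a) →
      |X b t - X a t| ≤ (1 + S * (L₁ + 1 / 2 * L₂)) * (b - a) := by
    intro a b hab ha hb
    rw [abs_of_nonneg (sub_nonneg.2 (hX.monotone t hab))]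
    refine (hX.gap_le h hab t).trans ?_
    have : S * (|v b 0 - v a 0| + 1 / 2 * (totalEnergy D X S b - totalEnergy D X S a))
        ≤ S * (L₁ * (b - a) + 1 / 2 * (L₂ * (b - a))) := by gcongr
    linarith
  rcases le_total ζ y with hy | hy
  · rw [abs_of_nonneg (sub_nonneg.2 hy)] at hy1 hy2 ⊢
    exact key ζ y hy hy1 ((le_abs_self _).trans hy2)
  · rw [abs_sub_comm, abs_sub_comm y ζ, abs_of_nonneg (sub_nonneg.2 hy)] at hy1 hy2 ⊢
    exact key y ζ hy hy1 ((le_abs_self _).trans hy2)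

/-- Almost everywhere the density of the total energy is at most the energy that is carried by
the characteristic: nothing concentrates in its neighbourhood. -/
theorem ae_deriv_totalEnergy_le (hX : IsLeftFlow v S X) (h : IsEnergyFlow v D C)
    (hv0 : ∀ᵐ ζ : ℝ, DifferentiableAt ℝ (fun x => v x 0) ζ) :
    ∀ᵐ ζ : ℝ, DifferentiableAt ℝ (totalEnergy D X S) ζ ∧
      ENNReal.ofReal (deriv (totalEnergy D X S) ζ) ≤ carriedEnergy D X S ζ := by
  have hfin := hX.isFiniteMeasure_footEnergy h
  set m := footEnergy D X S with hm
  -- Densities are compared by testing on measurable sets; removing N, which is null, leaves points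
  -- where `footEnergy_le` applies.
  have hle : m.rnDeriv volume ≤ᵐ[volume] carriedEnergy D X S := by
    refine ae_le_of_forall_setLIntegral_le_of_sigmaFinite (Measure.measurable_rnDeriv _ _)
      fun B hB _ => ?_
    have hbd := hX.ae_hasBoundedSlopesAt h hv0
    set N := toMeasurable volume {ζ | ¬ ∀ t, HasBoundedSlopesAt (fun η => X η t) ζ} with hN
    have hN0 : volume N = 0 := by rw [hN, measure_toMeasurable]; exact hbd
    have hNm : MeasurableSet N := measurableSet_toMeasurable _ _
    calc ∫⁻ ζ in B, m.rnDeriv volume ζ = ∫⁻ ζ in B \ N, m.rnDeriv volume ζ :=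
          setLIntegral_congr (sdiff_null_ae_eq_self hN0).symm
      _ ≤ m (B \ N) := Measure.setLIntegral_rnDeriv_le _
      _ ≤ ∫⁻ ζ in B \ N, carriedEnergy D X S ζ := by
          refine hX.footEnergy_le h (hB.diff hNm) fun ζ hζ => ?_
          by_contra hc
          exact hζ.2 (subset_toMeasurable _ _ hc)
      _ ≤ _ := lintegral_mono_set sdiff_subset
  -- For a.e. ζ, the ratio of m([ζ,y]) to y − ζ tends to the density of m; a singular part of m
  -- contributes nothing.
  filter_upwards [hle, VitaliFamily.ae_tendsto_rnDeriv
    (IsUnifLocDoublingMeasure.vitaliFamily (volume : Measure ℝ) 1) m,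
    (hX.totalEnergy_mono h).ae_differentiableAt] with ζ h1 h2 h3
  refine ⟨h3, le_trans ?_ h1⟩
  have h4 := h2.comp (Real.tendsto_Icc_vitaliFamily_right ζ)
  have h5 : Tendsto (fun y => (totalEnergy D X S y - totalEnergy D X S ζ) / (y - ζ)) (𝓝[>] ζ)
      (𝓝 (deriv (totalEnergy D X S) ζ)) := by
    have := (hasDerivAt_iff_tendsto_slope.1 h3.hasDerivAt).mono_left
      (nhdsWithin_mono ζ (fun y (hy : y ∈ Ioi ζ) => ne_of_gt hy))
    refine this.congr fun y => ?_
    rw [slope_def_field]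
  refine le_of_tendsto_of_tendsto (ENNReal.tendsto_ofReal h5) h4 ?_
  filter_upwards [self_mem_nhdsWithin] with y (hy : ζ < y)
  simp only [Function.comp, Real.volume_Icc]
  rw [ENNReal.ofReal_div_of_pos (sub_pos.2 hy)]
  exact ENNReal.div_le_div_right (hX.ofReal_totalEnergy_sub_le h hy.le) _

end IsLeftFlow
end HunterSaxton

/-! ### Convergence of the averages along one characteristic. -/

namespace HunterSaxton

theorem tendsto_slope_nhdsGT {f : ℝ → ℝ} {f' x : ℝ} (h : HasDerivAt f f' x) :
    Tendsto (fun ε => (f (x + ε) - f x) / ε) (𝓝[>] 0) (𝓝 f') := by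
  have h2 := (hasDerivAt_iff_tendsto_slope_zero.1 h).mono_left
    (nhdsWithin_mono (0 : ℝ) (fun y (hy : y ∈ Ioi 0) => ne_of_gt hy))
  refine h2.congr fun ε => ?_
  rw [smul_eq_mul, div_eq_inv_mul]

namespace IsLeftFlow

variable {v D X : ℝ → ℝ → ℝ} {C S ζ w₀ : ℝ}

/-- The difference quotients of v(·,0) tend to w₀, so 1 + pS/2 stays above half its limit. An affine
function of t on [0,S] is at least the smaller of its end values, and the one at t = 0 is 1. -/
theorem eventually_mul_le_gap (hX : IsLeftFlow v S X) (h : IsEnergyFlow v D C)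
    (hw₀ : HasDerivAt (fun x => v x 0) w₀ ζ) (hpos : 0 < 1 + w₀ * S / 2) :
    ∃ c > 0, ∀ᶠ ε in 𝓝[>] 0, ∀ t ∈ Icc 0 S, c * ε ≤ X (ζ + ε) t - X ζ t := by
  have hS := hX.nonneg
  set d := min 1 ((1 + w₀ * S / 2) / 2) with hd
  have hd0 : 0 < d := lt_min one_pos (by linarith)
  refine ⟨d ^ 2, by positivity, ?_⟩
  have hlim : Tendsto (fun ε => 1 + (v (ζ + ε) 0 - v ζ 0) / ε * S / 2) (𝓝[>] 0)
      (𝓝 (1 + w₀ * S / 2)) :=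
    (((tendsto_slope_nhdsGT hw₀).mul_const S).div_const 2).const_add 1
  filter_upwards [self_mem_nhdsWithin, hlim.eventually_const_lt
    (show (1 + w₀ * S / 2) / 2 < 1 + w₀ * S / 2 by linarith)] with ε (hε : 0 < ε) hp t ht
  have h1 := hX.le_gap h (η := ζ) (η' := ζ + ε) (by linarith) (t := t)
  rw [add_sub_cancel_left] at h1
  set p := (v (ζ + ε) 0 - v ζ 0) / ε
  have h2 := h1 (by linarith) ht
  have h3 : d ≤ 1 + p * t / 2 := by
    rcases le_total 0 p with h0 | h0
    · have := mul_nonneg h0 ht.1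
      linarith [min_le_left 1 ((1 + w₀ * S / 2) / 2)]
    · have : p * S ≤ p * t := mul_le_mul_of_nonpos_left ht.2 h0
      linarith [min_le_right 1 ((1 + w₀ * S / 2) / 2)]
  have h4 : d ^ 2 ≤ (1 + p * t / 2) ^ 2 := pow_le_pow_left₀ hd0.le h3 2
  nlinarith

/-- The velocity difference only increases in time: it is bounded below by its initial value, and
above by adding half the increment of the total energy. Both are O(ε) at ζ. -/
theorem eventually_abs_velocity_le (hX : IsLeftFlow v S X) (h : IsEnergyFlow v D C)
    (hw₀ : HasDerivAt (fun x => v x 0) w₀ ζ) (hF : DifferentiableAt ℝ (totalEnergy D X S) ζ) :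
    ∃ M, 0 ≤ M ∧ ∀ᶠ ε in 𝓝[>] 0, ∀ t ∈ Icc 0 S, |v (X (ζ + ε) t) t - v (X ζ t) t| ≤ M * ε := by
  set F := totalEnergy D X S
  refine ⟨|w₀| + 1 + 1 / 2 * (|deriv F ζ| + 1), by positivity, ?_⟩
  filter_upwards [self_mem_nhdsWithin,
    (tendsto_slope_nhdsGT hw₀).abs.eventually_lt_const (lt_add_one _),
    (tendsto_slope_nhdsGT hF.hasDerivAt).abs.eventually_lt_const (lt_add_one _)]
    with ε (hε : 0 < ε) h1 h2 t ht
  rw [abs_div, abs_of_pos hε, div_lt_iff₀ hε] at h1 h2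
  have hle : ζ ≤ ζ + ε := by linarith
  have h3 := hX.velocity_sub_le h hle ht
  have h4 := hX.le_velocity_sub h hle ht
  have h5 := abs_lt.1 h1
  have h6 := abs_lt.1 h2
  have h7 : 0 ≤ (|deriv F ζ| + 1) * ε := by positivity
  rw [abs_le]
  constructor
  · linarith [h5.1]
  · linarith [h5.2, h6.2]

theorem gap_le_of_abs_velocity_le (hX : IsLeftFlow v S X) (h : IsEnergyFlow v D C) {M ε : ℝ}
    (hM : 0 ≤ M) (hε : 0 < ε)
    (hV : ∀ t ∈ Icc 0 S, |v (X (ζ + ε) t) t - v (X ζ t) t| ≤ M * ε) {t : ℝ} (ht : t ∈ Icc 0 S) :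
    X (ζ + ε) t - X ζ t ≤ (1 + S * M) * ε := by
  rw [hX.gap_eq h ζ (ζ + ε) ht]
  have h1 : ‖∫ s in (0 : ℝ)..t, (v (X (ζ + ε) s) s - v (X ζ s) s)‖ ≤ M * ε * |t - 0| := by
    apply intervalIntegral.norm_integral_le_of_norm_le_const
    intro s hs
    rw [uIoc_of_le ht.1] at hs
    exact hV s ⟨hs.1.le, hs.2.trans ht.2⟩
  rw [sub_zero, abs_of_nonneg ht.1, Real.norm_eq_abs] at h1
  have h2 : M * ε * t ≤ M * ε * S := mul_le_mul_of_nonneg_left ht.2 (by positivity)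
  linarith [le_abs_self (∫ s in (0 : ℝ)..t, (v (X (ζ + ε) s) s - v (X ζ s) s))]

/-- The quotient is the derivative of the logarithm of the gap, which equals ε at time 0. -/
theorem integral_velocity_div_gap (hX : IsLeftFlow v S X) (h : IsEnergyFlow v D C) {ε : ℝ}
    (hε : 0 < ε) (hgap : ∀ t ∈ Icc 0 S, 0 < X (ζ + ε) t - X ζ t) {t : ℝ} (ht : t ∈ Icc 0 S) :
    (X (ζ + ε) t - X ζ t) / ε = Real.exp (∫ s in (0 : ℝ)..t,
      (v (X (ζ + ε) s) s - v (X ζ s) s) / (X (ζ + ε) s - X ζ s)) := by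
  have hsub : Icc 0 t ⊆ Icc 0 S := Icc_subset_Icc le_rfl ht.2
  have hc : Continuous fun t => X (ζ + ε) t - X ζ t := (hX.continuous _).sub (hX.continuous _)
  have hVc : Continuous fun t => v (X (ζ + ε) t) t - v (X ζ t) t :=
    (hX.continuous_velocity h _).sub (hX.continuous_velocity h _)
  have h1 := intervalIntegral.integral_eq_sub_of_hasDerivAt_of_le ht.1
    (f := fun s => Real.log (X (ζ + ε) s - X ζ s))
    (f' := fun s => (v (X (ζ + ε) s) s - v (X ζ s) s) / (X (ζ + ε) s - X ζ s))
    (hc.continuousOn.log fun s hs => (hgap s (hsub hs)).ne')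
    (fun s hs => (hX.hasDerivAt_gap h ζ (ζ + ε) ⟨hs.1, hs.2.trans_le ht.2⟩).log
      (hgap s (hsub (Ioo_subset_Icc_self hs))).ne')
    (by
      apply ContinuousOn.intervalIntegrable
      rw [uIcc_of_le ht.1]
      exact hVc.continuousOn.div hc.continuousOn fun s hs => (hgap s (hsub hs)).ne')
  rw [h1]
  simp only [hX.apply_zero, add_sub_cancel_left]
  rw [Real.exp_sub, Real.exp_log (hgap t ht), Real.exp_log hε]

theorem measurable_velocity_div_gap (hX : IsLeftFlow v S X) (h : IsEnergyFlow v D C) (η η' : ℝ) :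
    Measurable fun t => (v (X η' t) t - v (X η t) t) / (X η' t - X η t) :=
  ((hX.continuous_velocity h _).measurable.sub (hX.continuous_velocity h _).measurable).div
    ((hX.continuous _).measurable.sub (hX.continuous _).measurable)

theorem intervalIntegrable_energyBetween_div_gap (hX : IsLeftFlow v S X) (h : IsEnergyFlow v D C)
    {η η' σ : ℝ} (hσ : σ ∈ Icc 0 S) (hgap : ∀ t ∈ Icc 0 S, 0 < X η' t - X η t) :
    IntervalIntegrable (fun t => energyBetween D X η η' t / (X η' t - X η t)) volume σ S := by
  simp only [div_eq_mul_inv]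
  apply (hX.intervalIntegrable_energyBetween h η η' σ S).mul_continuousOn
  rw [uIcc_of_le hσ.2]
  exact (((hX.continuous _).sub (hX.continuous _)).continuousOn).inv₀ fun t ht =>
    (hgap t ⟨hσ.1.trans ht.1, ht.2⟩).ne'

/-- The averaged energy next to a characteristic converges to the energy density on it. -/
theorem tendsto_integral_average (hX : IsLeftFlow v S X) (h : IsEnergyFlow v D C)
    (hw₀ : HasDerivAt (fun x => v x 0) w₀ ζ) (hpos : 0 < 1 + w₀ * S / 2)
    (hF : DifferentiableAt ℝ (totalEnergy D X S) ζ)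
    (hFK : ENNReal.ofReal (deriv (totalEnergy D X S) ζ) ≤ carriedEnergy D X S ζ)
    (hW : ∀ᵐ t : ℝ, t ∈ Icc 0 S → HasDerivAt (fun x => v x t) (D (X ζ t) t) (X ζ t)) :
    IntervalIntegrable (fun t => D (X ζ t) t ^ 2) volume 0 S ∧
    ∀ σ ∈ Icc 0 S, Tendsto (fun ε => ∫ t in σ..S, (energyBetween D X ζ (ζ + ε) t
      / (X (ζ + ε) t - X ζ t) - D (X ζ t) t ^ 2)) (𝓝[>] 0) (𝓝 0) := by
  have hS := hX.nonneg
  obtain ⟨c, hc, hgap⟩ := hX.eventually_mul_le_gap h hw₀ hpos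
  obtain ⟨M, hM, hV⟩ := hX.eventually_abs_velocity_le h hw₀ hF
  set H : ℝ → ℝ → ℝ := fun ε t => X (ζ + ε) t - X ζ t with hH
  set V : ℝ → ℝ → ℝ := fun ε t => v (X (ζ + ε) t) t - v (X ζ t) t with hVdef
  set e : ℝ → ℝ → ℝ := fun ε t => energyBetween D X ζ (ζ + ε) t with he
  set W : ℝ → ℝ := fun t => D (X ζ t) t with hWdef
  set B := M / c with hB
  have hB0 : 0 ≤ B := by positivity
  have hgood : ∀ᶠ ε in 𝓝[>] 0, 0 < ε ∧ ∀ t ∈ Icc 0 S, 0 < H ε t ∧ c * ε ≤ H ε t ∧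
      H ε t ≤ (1 + S * M) * ε ∧ |V ε t / H ε t| ≤ B := by
    filter_upwards [self_mem_nhdsWithin, hgap, hV] with ε (hε : 0 < ε) h1 h2
    refine ⟨hε, fun t ht => ?_⟩
    have h3 : 0 < H ε t := lt_of_lt_of_le (by positivity) (h1 t ht)
    refine ⟨h3, h1 t ht, hX.gap_le_of_abs_velocity_le h hM hε h2 ht, ?_⟩
    rw [abs_div, abs_of_pos h3, div_le_iff₀ h3, hB, div_mul_eq_mul_div, le_div_iff₀ hc]
    calc |V ε t| * c ≤ M * ε * c := mul_le_mul_of_nonneg_right (h2 t ht) hc.le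
      _ = M * (c * ε) := by ring
      _ ≤ M * H ε t := mul_le_mul_of_nonneg_left (h1 t ht) hM
  have hWm : Measurable W := (hX.measurable_along h).comp measurable_prodMk_left
  have hPm : ∀ ε, Measurable fun t => V ε t / H ε t := fun ε =>
    hX.measurable_velocity_div_gap h ζ (ζ + ε)
  -- V/H is the difference quotient of v(·,t) at X(ζ,t) with increment H, and H tends to 0 from the
  -- right.
  have hPlim : ∀ᵐ t : ℝ, t ∈ Icc 0 S → Tendsto (fun ε => V ε t / H ε t) (𝓝[>] 0) (𝓝 (W t)) := by
    filter_upwards [hW] with t ht htS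
    have h1 : Tendsto (fun ε => H ε t) (𝓝[>] 0) (𝓝[>] 0) := by
      refine tendsto_nhdsWithin_iff.2 ⟨?_, hgood.mono fun ε hε => (hε.2 t htS).1⟩
      have h2 : Tendsto (fun ε : ℝ => (1 + S * M) * ε) (𝓝[>] 0) (𝓝 0) := by
        have : Continuous fun ε : ℝ => (1 + S * M) * ε := by fun_prop
        have := this.tendsto 0
        rw [mul_zero] at this
        exact this.mono_left nhdsWithin_le_nhds
      exact squeeze_zero' (hgood.mono fun ε hε => (hε.2 t htS).1.le)
        (hgood.mono fun ε hε => (hε.2 t htS).2.2.1) h2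
    refine ((tendsto_slope_nhdsGT (ht htS)).comp h1).congr fun ε => ?_
    simp only [Function.comp, hH, hVdef, add_sub_cancel]
  have hWb : ∀ᵐ t : ℝ, t ∈ Icc 0 S → |W t| ≤ B := by
    filter_upwards [hPlim] with t ht htS
    exact le_of_tendsto (ht htS).abs (hgood.mono fun ε hε => (hε.2 t htS).2.2.2)
  have hsub : ∀ {a b t : ℝ}, 0 ≤ a → a ≤ b → b ≤ S → t ∈ uIoc a b → t ∈ Icc 0 S := by
    intro a b t ha hab hb ht
    rw [uIoc_of_le hab] at ht
    exact ⟨ha.trans ht.1.le, ht.2.trans hb⟩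
  have hW2i : ∀ a b, 0 ≤ a → a ≤ b → b ≤ S →
      IntervalIntegrable (fun t => W t ^ 2) volume a b := by
    intro a b ha hab hb
    refine (intervalIntegrable_const (c := B ^ 2)).mono_fun (hWm.pow_const 2).aestronglyMeasurable ?_
    filter_upwards [ae_restrict_of_ae hWb, ae_restrict_mem measurableSet_uIoc] with t ht htI
    rw [norm_pow, Real.norm_eq_abs]
    exact (pow_le_pow_left₀ (abs_nonneg _) (ht (hsub ha hab hb htI)) 2).trans (le_abs_self _)
  refine ⟨hW2i 0 S le_rfl hS le_rfl, fun σ hσ => ?_⟩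
  -- convergence of the stretch
  set f : ℝ → ℝ := fun t => Real.exp (∫ s in (0 : ℝ)..t, W s) with hf
  have hflim : ∀ t ∈ Icc 0 S, Tendsto (fun ε => H ε t / ε) (𝓝[>] 0) (𝓝 (f t)) := by
    intro t ht
    have h1 : Tendsto (fun ε => ∫ s in (0 : ℝ)..t, V ε s / H ε s) (𝓝[>] 0)
        (𝓝 (∫ s in (0 : ℝ)..t, W s)) := by
      apply intervalIntegral.tendsto_integral_filter_of_dominated_convergence (fun _ => B)
      · exact Eventually.of_forall fun ε => (hPm ε).aestronglyMeasurable
      · filter_upwards [hgood] with ε hε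
        exact Eventually.of_forall fun s hs => (hε.2 s (hsub le_rfl ht.1 ht.2 hs)).2.2.2
      · exact intervalIntegrable_const
      · filter_upwards [hPlim] with s hs hst
        exact hs (hsub le_rfl ht.1 ht.2 hst)
    refine ((Real.continuous_exp.tendsto _).comp h1).congr' ?_
    filter_upwards [hgood] with ε hε
    exact (hX.integral_velocity_div_gap h hε.1 (fun t ht => (hε.2 t ht).1) ht).symm
  have hfm : AEStronglyMeasurable f (volume.restrict (uIoc 0 S)) := by
    refine aestronglyMeasurable_of_tendsto_ae (𝓝[>] (0 : ℝ)) (f := fun ε t => H ε t / ε)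
      (fun ε => ?_) ?_
    · exact (((hX.continuous _).sub (hX.continuous _)).div_const ε).aestronglyMeasurable
    · filter_upwards [ae_restrict_mem measurableSet_uIoc] with t ht
      exact hflim t (hsub le_rfl hS le_rfl ht)
  have hfb : ∀ t ∈ Icc 0 S, |f t| ≤ 1 + S * M := by
    intro t ht
    refine le_of_tendsto (hflim t ht).abs ?_
    filter_upwards [hgood] with ε hε
    rw [abs_div, abs_of_pos hε.1, abs_of_pos (hε.2 t ht).1, div_le_iff₀ hε.1]
    exact (hε.2 t ht).2.2.1
  -- the weighted squares of the difference quotients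
  set g : ℝ → ℝ → ℝ := fun ε t => (V ε t / H ε t) ^ 2 * (H ε t / ε) with hg
  have hgm : ∀ ε, Measurable (g ε) := fun ε => ((hPm ε).pow_const 2).mul
    (((hX.continuous _).sub (hX.continuous _)).div_const ε).measurable
  have hgb : ∀ᶠ ε in 𝓝[>] 0, ∀ t ∈ Icc 0 S, ‖g ε t‖ ≤ B ^ 2 * (1 + S * M) := by
    filter_upwards [hgood] with ε hε t ht
    obtain ⟨h1, h2, h3, h4⟩ := hε.2 t ht
    rw [norm_mul, norm_pow, Real.norm_eq_abs, Real.norm_eq_abs, abs_div (H ε t), abs_of_pos hε.1,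
      abs_of_pos h1]
    have h5 : H ε t / ε ≤ 1 + S * M := by rw [div_le_iff₀ hε.1]; exact h3
    have h6 : 0 ≤ H ε t / ε := div_nonneg h1.le hε.1.le
    exact mul_le_mul (pow_le_pow_left₀ (abs_nonneg _) h4 2) h5 h6 (by positivity)
  have hgi : ∀ᶠ ε in 𝓝[>] 0, IntervalIntegrable (g ε) volume 0 S := by
    filter_upwards [hgb] with ε hε
    refine (intervalIntegrable_const (c := B ^ 2 * (1 + S * M))).mono_fun
      (hgm ε).aestronglyMeasurable ?_
    filter_upwards [ae_restrict_mem measurableSet_uIoc] with t ht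
    exact (hε t (hsub le_rfl hS le_rfl ht)).trans (le_abs_self _)
  have hglim : Tendsto (fun ε => ∫ t in (0 : ℝ)..S, g ε t) (𝓝[>] 0)
      (𝓝 (∫ t in (0 : ℝ)..S, W t ^ 2 * f t)) := by
    apply intervalIntegral.tendsto_integral_filter_of_dominated_convergence
      (fun _ => B ^ 2 * (1 + S * M))
    · exact Eventually.of_forall fun ε => (hgm ε).aestronglyMeasurable
    · filter_upwards [hgb] with ε hε
      exact Eventually.of_forall fun t ht => hε t (hsub le_rfl hS le_rfl ht)
    · exact intervalIntegrable_const
    · filter_upwards [hPlim] with t ht htI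
      have htS := hsub le_rfl hS le_rfl htI
      exact ((ht htS).pow 2).mul (hflim t htS)
  -- Cauchy–Schwarz, V² ≤ He, divided by Hε.
  have hge : ∀ᶠ ε in 𝓝[>] 0, ∀ᵐ t : ℝ, t ∈ Icc 0 S → g ε t ≤ e ε t / ε := by
    filter_upwards [hgood] with ε hε
    filter_upwards [hX.sq_velocity_sub_le h (show ζ ≤ ζ + ε by linarith [hε.1])] with t ht htS
    have h1 := ht htS.1
    have h2 := (hε.2 t htS).1
    have h3 : g ε t = V ε t ^ 2 / H ε t / ε := by
      simp only [hg]
      field_simp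
    rw [h3]
    refine div_le_div_of_nonneg_right ?_ hε.1.le
    rw [div_le_iff₀ h2]
    linarith
  -- the energy carried by the characteristic bounds the density of the total energy
  have hFle : deriv (totalEnergy D X S) ζ ≤ ∫ t in (0 : ℝ)..S, W t ^ 2 * f t := by
    have hint : IntervalIntegrable (fun t => W t ^ 2 * f t) volume 0 S := by
      refine (intervalIntegrable_const (c := B ^ 2 * (1 + S * M))).mono_fun
        ((hWm.pow_const 2).aestronglyMeasurable.mul hfm) ?_
      filter_upwards [ae_restrict_of_ae hWb, ae_restrict_mem measurableSet_uIoc] with t ht htI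
      have htS := hsub le_rfl hS le_rfl htI
      rw [norm_mul, norm_pow, Real.norm_eq_abs, Real.norm_eq_abs]
      exact (mul_le_mul (pow_le_pow_left₀ (abs_nonneg _) (ht htS) 2) (hfb t htS) (abs_nonneg _)
        (by positivity)).trans (le_abs_self _)
    have hnn : ∀ t, 0 ≤ W t ^ 2 * f t := fun t => mul_nonneg (sq_nonneg _) (Real.exp_pos _).le
    -- The stretch H/ε converges, so the upper limit in `upperStretch` is f.
    have hK : carriedEnergy D X S ζ = ENNReal.ofReal (∫ t in (0 : ℝ)..S, W t ^ 2 * f t) := by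
      rw [intervalIntegral.integral_of_le hS, ← integral_Icc_eq_integral_Ioc,
        ofReal_integral_eq_lintegral_ofReal
          ((intervalIntegrable_iff_integrableOn_Icc_of_le hS).1 hint) (Eventually.of_forall hnn)]
      refine setLIntegral_congr_fun measurableSet_Icc fun t ht => ?_
      rw [upperStretch_eq (hflim t ht), ← ENNReal.ofReal_mul (Real.exp_pos _).le, mul_comm]
    rw [hK] at hFK
    exact (ENNReal.ofReal_le_ofReal_iff
      (intervalIntegral.integral_nonneg hS fun t _ => hnn t)).1 hFK
  have hei : ∀ ε, IntervalIntegrable (fun t => e ε t / ε) volume 0 S := fun ε =>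
    (hX.intervalIntegrable_energyBetween h _ _ _ _).div_const ε
  -- The integral tends to F' − ∫W²f. This is nonnegative because the integrands are, and
  -- nonpositive by `hFle`.
  have hdefect : Tendsto (fun ε => ∫ t in (0 : ℝ)..S, (e ε t / ε - g ε t)) (𝓝[>] 0) (𝓝 0) := by
    have h1 : Tendsto (fun ε => ∫ t in (0 : ℝ)..S, (e ε t / ε - g ε t)) (𝓝[>] 0)
        (𝓝 (deriv (totalEnergy D X S) ζ - ∫ t in (0 : ℝ)..S, W t ^ 2 * f t)) := by
      refine ((tendsto_slope_nhdsGT hF.hasDerivAt).sub hglim).congr' ?_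
      filter_upwards [hgi] with ε hε
      rw [intervalIntegral.integral_sub (hei ε) hε, intervalIntegral.integral_div,
        hX.integral_energyBetween h]
    have h2 : 0 ≤ deriv (totalEnergy D X S) ζ - ∫ t in (0 : ℝ)..S, W t ^ 2 * f t := by
      refine ge_of_tendsto h1 ?_
      filter_upwards [hge] with ε hε
      apply intervalIntegral.integral_nonneg_of_ae_restrict hS
      filter_upwards [ae_restrict_of_ae hε, ae_restrict_mem measurableSet_Icc] with t ht htS
      simpa using ht htS
    have h3 : deriv (totalEnergy D X S) ζ - ∫ t in (0 : ℝ)..S, W t ^ 2 * f t = 0 := by linarith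
    rwa [h3] at h1
  have hP2i : ∀ᶠ ε in 𝓝[>] 0, IntervalIntegrable (fun t => (V ε t / H ε t) ^ 2) volume σ S := by
    filter_upwards [hgood] with ε hε
    refine (intervalIntegrable_const (c := B ^ 2)).mono_fun
      ((hPm ε).pow_const 2).aestronglyMeasurable ?_
    filter_upwards [ae_restrict_mem measurableSet_uIoc] with t ht
    rw [norm_pow, Real.norm_eq_abs]
    exact (pow_le_pow_left₀ (abs_nonneg _) (hε.2 t (hsub hσ.1 hσ.2 le_rfl ht)).2.2.2 2).trans
      (le_abs_self _)
  have hPlim2 : Tendsto (fun ε => ∫ t in σ..S, (V ε t / H ε t) ^ 2) (𝓝[>] 0)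
      (𝓝 (∫ t in σ..S, W t ^ 2)) := by
    apply intervalIntegral.tendsto_integral_filter_of_dominated_convergence (fun _ => B ^ 2)
    · exact Eventually.of_forall fun ε => ((hPm ε).pow_const 2).aestronglyMeasurable
    · filter_upwards [hgood] with ε hε
      refine Eventually.of_forall fun t ht => ?_
      rw [norm_pow, Real.norm_eq_abs]
      exact pow_le_pow_left₀ (abs_nonneg _) (hε.2 t (hsub hσ.1 hσ.2 le_rfl ht)).2.2.2 2
    · exact intervalIntegrable_const
    · filter_upwards [hPlim] with t ht htI
      exact (ht (hsub hσ.1 hσ.2 le_rfl htI)).pow 2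
  have hEi : ∀ᶠ ε in 𝓝[>] 0, IntervalIntegrable (fun t => e ε t / H ε t) volume σ S := by
    filter_upwards [hgood] with ε hε
    exact hX.intervalIntegrable_energyBetween_div_gap h hσ fun t ht => (hε.2 t ht).1
  have hElim : Tendsto (fun ε => ∫ t in σ..S, (e ε t / H ε t - (V ε t / H ε t) ^ 2)) (𝓝[>] 0)
      (𝓝 0) := by
    have hpt : ∀ᶠ ε in 𝓝[>] 0, ∀ᵐ t : ℝ, t ∈ Icc 0 S → 0 ≤ e ε t / H ε t - (V ε t / H ε t) ^ 2 ∧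
        e ε t / H ε t - (V ε t / H ε t) ^ 2 ≤ c⁻¹ * (e ε t / ε - g ε t) := by
      filter_upwards [hgood, hge] with ε hε hε2
      filter_upwards [hε2] with t ht htS
      obtain ⟨h1, h2, -, -⟩ := hε.2 t htS
      have hε0 := hε.1
      -- The defect of the averages is the defect per unit of initial length times ε/H, and ε/H ≤
      -- 1/c.
      have h3 : e ε t / H ε t - (V ε t / H ε t) ^ 2 = (ε / H ε t) * (e ε t / ε - g ε t) := by
        simp only [hg]
        field_simp
      have h4 : 0 ≤ e ε t / ε - g ε t := sub_nonneg.2 (ht htS)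
      rw [h3]
      refine ⟨mul_nonneg (div_nonneg hε0.le h1.le) h4, mul_le_mul_of_nonneg_right ?_ h4⟩
      rw [div_le_iff₀ h1, inv_mul_eq_div, le_div_iff₀ hc]
      linarith
    have hlim0 := hdefect.const_mul c⁻¹
    rw [mul_zero] at hlim0
    refine squeeze_zero' ?_ ?_ hlim0
    · filter_upwards [hpt] with ε hε
      apply intervalIntegral.integral_nonneg_of_ae_restrict hσ.2
      filter_upwards [ae_restrict_of_ae hε, ae_restrict_mem measurableSet_Icc] with t ht htS
      exact (ht ⟨hσ.1.trans htS.1, htS.2⟩).1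
    · filter_upwards [hpt, hEi, hP2i, hgi, hge] with ε hε hi1 hi2 hi3 hε2
      have hi4 : IntervalIntegrable (fun t => c⁻¹ * (e ε t / ε - g ε t)) volume 0 S :=
        ((hei ε).sub hi3).const_mul _
      rw [← intervalIntegral.integral_const_mul]
      calc ∫ t in σ..S, (e ε t / H ε t - (V ε t / H ε t) ^ 2)
          ≤ ∫ t in σ..S, c⁻¹ * (e ε t / ε - g ε t) := by
            apply intervalIntegral.integral_mono_ae_restrict hσ.2 (hi1.sub hi2)
            · apply hi4.mono_set
              rw [uIcc_of_le hσ.2, uIcc_of_le hS]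
              exact Icc_subset_Icc hσ.1 le_rfl
            · filter_upwards [ae_restrict_of_ae hε, ae_restrict_mem measurableSet_Icc] with t ht htS
              exact (ht ⟨hσ.1.trans htS.1, htS.2⟩).2
        _ ≤ ∫ t in (0 : ℝ)..S, c⁻¹ * (e ε t / ε - g ε t) := by
            apply intervalIntegral.integral_mono_interval hσ.1 hσ.2 le_rfl _ hi4
            filter_upwards [ae_restrict_of_ae hε2, ae_restrict_mem measurableSet_Ioc] with t ht htS
            exact mul_nonneg (inv_nonneg.2 hc.le) (sub_nonneg.2 (ht (Ioc_subset_Icc_self htS)))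
  have hfinal := hElim.add (hPlim2.sub_const (∫ t in σ..S, W t ^ 2))
  rw [sub_self, add_zero] at hfinal
  refine hfinal.congr' ?_
  filter_upwards [hEi, hP2i] with ε hi1 hi2
  rw [intervalIntegral.integral_sub hi1 hi2,
    intervalIntegral.integral_sub hi1 (hW2i σ S hσ.1 hσ.2 le_rfl)]
  ring

end IsLeftFlow
end HunterSaxton

/-! ### Conclusion. -/

namespace HunterSaxton

/-- Since τ < T, the bound w₀ > −2/T keeps the comparison parabola away from its zero on [0,τ]. -/
theorem one_add_mul_pos_of_mem_setIAt {u w : ℝ → ℝ → ℝ} {T : ℝ≥0∞} {τ ζ : ℝ} (hτ : 0 ≤ τ)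
    (hτT : ENNReal.ofReal τ < T) (hζ : ζ ∈ setIAt u w T) : 0 < 1 + w ζ 0 * τ / 2 := by
  have h := hζ.2
  rcases eq_or_ne T ∞ with rfl | hT
  · simp only [ENNReal.div_top, ENNReal.toReal_zero, neg_zero] at h
    positivity
  · have h1 : τ < T.toReal := (ENNReal.ofReal_lt_iff_lt_toReal hτ hT).1 hτT
    rw [ENNReal.toReal_div, ENNReal.toReal_ofNat] at h
    have hT0 : 0 < T.toReal := hτ.trans_lt h1
    rw [neg_lt, lt_div_iff₀ hT0] at h
    rcases le_or_gt 0 (w ζ 0) with h2 | h2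
    · positivity
    · nlinarith

theorem ofReal_lt_lifespan {w : ℝ → ℝ → ℝ} {τ ζ : ℝ}
    (h : 0 < 1 + w ζ 0 * τ / 2) : ENNReal.ofReal τ < lifespan w ζ := by
  unfold lifespan
  split_ifs with h0
  · exact ENNReal.ofReal_lt_top
  · have hw := not_le.1 h0
    have h2 : τ < -2 / w ζ 0 := by
      rw [lt_div_iff_of_neg hw]
      linarith
    exact (ENNReal.ofReal_lt_ofReal_iff (div_pos_of_neg_of_neg (by norm_num) hw)).2 h2

end HunterSaxton

open HunterSaxton in
theorem mainTheorem9 (u w : ℝ → ℝ → ℝ) (hu : HunterSaxton.IsWeakSolution u w)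
    (T : ℝ≥0∞) (τ : ℝ) (hτ : 0 ≤ τ) (hτT : ENNReal.ofReal τ < T) :
    ∃ ε : ℕ → ℝ, (∀ k, 0 < ε k) ∧ StrictAnti ε ∧ Tendsto ε atTop (𝓝 0) ∧
      ∀ᵐ ζ : ℝ, ζ ∈ HunterSaxton.setJUnique u w T →
        ∀ x : ℝ → ℝ, HunterSaxton.IsCharacteristic u τ ζ x →
          -- the denominators are positive and the integrands are integrable in time
          (∀ k, ∀ t ∈ Icc 0 τ, x t < HunterSaxton.leftmost u (ζ + ε k) t) ∧
          IntervalIntegrable (fun t => w (x t) t ^ 2) volume 0 τ ∧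
          (∀ k, IntervalIntegrable (fun t =>
            HunterSaxton.energyAverage w (x t) (HunterSaxton.leftmost u (ζ + ε k) t) t)
            volume 0 τ) ∧
          ∀ σ ∈ Icc 0 τ,
            Tendsto (fun k => ∫ t in σ..τ,
              (HunterSaxton.energyAverage w (x t) (HunterSaxton.leftmost u (ζ + ε k) t) t
                - w (x t) t ^ 2)) atTop (𝓝 0) := by
  obtain ⟨v, D, C, h, hvu, hDw⟩ := hu.exists_energyFlow
  obtain ⟨X, hX⟩ := h.exists_leftFlow hτ
  have hvu0 : (fun x => v x 0) = fun x => u x 0 := funext fun x => hvu x 0 le_rfl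
  have hv0 : ∀ᵐ ζ, DifferentiableAt ℝ (fun x => v x 0) ζ := by
    rw [hvu0]
    exact (hu.hasDerivAt 0 le_rfl).mono fun ζ hζ => hζ.differentiableAt
  have hanti : StrictAnti fun n : ℕ => 1 / ((n : ℝ) + 1) := fun m n hmn =>
    Nat.one_div_lt_one_div hmn
  -- The limit holds as ε → 0⁺ without selection, so the sequence need not depend on u, T or τ.
  refine ⟨fun n => 1 / ((n : ℝ) + 1), fun _ => Nat.one_div_pos_of_nat, hanti,
    tendsto_one_div_add_atTop_nhds_zero_nat, ?_⟩
  filter_upwards [hX.ae_deriv_totalEnergy_le h hv0] with ζ hFζ hζ x hx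
  obtain ⟨hF, hFK⟩ := hFζ
  obtain ⟨⟨hIAt, huniq⟩, -, y, hychar, hyΓ⟩ := hζ
  have hpos := one_add_mul_pos_of_mem_setIAt hτ hτT hIAt
  have hlife := ofReal_lt_lifespan hpos
  have hXchar : IsCharacteristic u τ ζ (X ζ) := (hX.char ζ).isCharacteristic h.cont hvu hτ
  have hxX : EqOn x (X ζ) (Icc 0 τ) := huniq τ hτ hτT.le x (X ζ) hx hXchar
  -- The characteristic provided by J exists beyond τ, since τ is less than the lifespan; uniqueness
  -- identifies it with X(ζ,·).
  have hyX : EqOn y (X ζ) (Icc 0 τ) := huniq τ hτ hτT.le y (X ζ) (hychar τ hτ hlife) hXchar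
  have hΓ : ∀ᵐ t : ℝ, t ∈ Icc 0 τ → HasDerivAt (fun x => u x t) (w (X ζ t) t) (X ζ t) := by
    filter_upwards [hyΓ] with t ht htI
    have := ht htI.1 ((ENNReal.ofReal_le_ofReal htI.2).trans_lt hlife)
    rw [hyX htI] at this
    exact this
  -- D agrees with w at every point where w is the derivative, for a.e. t; agreement for a.e. x
  -- would say nothing on a curve.
  have hDX : ∀ᵐ t : ℝ, t ∈ Icc 0 τ → D (X ζ t) t = w (X ζ t) t := by
    filter_upwards [hΓ, hDw] with t ht hDt htI
    exact (hDt htI.1).1 _ (ht htI)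
  have hW : ∀ᵐ t : ℝ, t ∈ Icc 0 τ → HasDerivAt (fun x => v x t) (D (X ζ t) t) (X ζ t) := by
    filter_upwards [hΓ, hDX] with t ht hDt htI
    rw [hDt htI, show (fun x => v x t) = fun x => u x t from funext fun x => hvu x t htI.1]
    exact ht htI
  have hw₀ : HasDerivAt (fun x => v x 0) (w ζ 0) ζ := by
    rw [hvu0]
    exact hIAt.1
  obtain ⟨hint, hlim⟩ := hX.tendsto_integral_average h hw₀ hpos hF hFK hW
  -- Separation is known only for small ε. For the other k, it follows from a later index n ≥ k by
  -- monotonicity of X(·,t).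
  have hgap : ∀ k : ℕ, ∀ t ∈ Icc 0 τ, 0 < X (ζ + 1 / ((k : ℝ) + 1)) t - X ζ t := by
    intro k t ht
    obtain ⟨c, hc, hcε⟩ := hX.eventually_mul_le_gap h hw₀ hpos
    obtain ⟨n, hn, hkn⟩ :=
      ((tendsto_one_div_add_nhdsGT.eventually hcε).and (eventually_ge_atTop k)).exists
    have h1 := hn t ht
    have h2 : X (ζ + 1 / ((n : ℝ) + 1)) t ≤ X (ζ + 1 / ((k : ℝ) + 1)) t :=
      hX.monotone t (add_le_add_right (hanti.antitone hkn) ζ)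
    have h3 : 0 < c * (1 / ((n : ℝ) + 1)) := by positivity
    linarith
  have hleft : ∀ η, ∀ t ∈ Icc 0 τ, leftmost u η t = X η t := fun η t ht =>
    hX.leftmost_eq h.cont hvu η ht
  have hsq : ∀ᵐ t : ℝ, t ∈ Icc 0 τ → D (X ζ t) t ^ 2 = w (x t) t ^ 2 := by
    filter_upwards [hDX] with t ht htI
    rw [ht htI, hxX htI]
  have havg : ∀ k : ℕ, ∀ᵐ t : ℝ, t ∈ Icc 0 τ →
      energyBetween D X ζ (ζ + 1 / ((k : ℝ) + 1)) t / (X (ζ + 1 / ((k : ℝ) + 1)) t - X ζ t)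
        = energyAverage w (x t) (leftmost u (ζ + 1 / ((k : ℝ) + 1)) t) t := by
    intro k
    filter_upwards [hDw] with t hDt htI
    have h1 : ∫ z in (X ζ t)..(X (ζ + 1 / ((k : ℝ) + 1)) t), D z t ^ 2
        = ∫ z in (X ζ t)..(X (ζ + 1 / ((k : ℝ) + 1)) t), w z t ^ 2 := by
      apply intervalIntegral.integral_congr_ae
      filter_upwards [(hDt htI.1).2] with z hz _
      rw [hz]
    rw [energyAverage, hleft _ t htI, hxX htI, IsLeftFlow.energyBetween_eq h, h1, div_eq_mul_one_div, mul_comm]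
  have huIoc : ∀ σ ∈ Icc 0 τ, ∀ t ∈ uIoc σ τ, t ∈ Icc 0 τ := by
    intro σ hσ t ht
    rw [uIoc_of_le hσ.2] at ht
    exact ⟨hσ.1.trans ht.1.le, ht.2⟩
  have h0τ := huIoc 0 ⟨le_rfl, hτ⟩
  refine ⟨fun k t ht => ?_, ?_, fun k => ?_, fun σ hσ => ?_⟩
  · rw [hleft _ t ht, hxX ht]
    exact sub_pos.1 (hgap k t ht)
  · refine hint.congr_ae ?_
    filter_upwards [ae_restrict_of_ae hsq, ae_restrict_mem measurableSet_uIoc] with t ht htI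
    exact ht (h0τ t htI)
  · refine (hX.intervalIntegrable_energyBetween_div_gap h ⟨le_rfl, hτ⟩ (hgap k)).congr_ae ?_
    filter_upwards [ae_restrict_of_ae (havg k), ae_restrict_mem measurableSet_uIoc] with t ht htI
    exact ht (h0τ t htI)
  · refine ((hlim σ hσ).comp tendsto_one_div_add_nhdsGT).congr fun k => ?_
    apply intervalIntegral.integral_congr_ae
    filter_upwards [havg k, hsq] with t h1 h2 htI
    rw [h1 (huIoc σ hσ t htI), h2 (huIoc σ hσ t htI)]
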